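/- Let $A,B$ be real $n\times n$ matrices such that $A$ is hyperbolic (no eigenvalue is $0$ or of modulus $1$) and $e^{B}=A$, i.e. $B$ is a real logarithm of $A$. Let $\lambda=(\lambda_1,\dots,\lambda_n)$ and $\mu=(\mu_1,\dots,\mu_n)$ be the complex eigenvalues of $A$ and of $B$, listed with multiplicity. Assume: (1) $\mu$ is weakly nonresonant: there are no $j$, $k\in\mathbb Z_{\ge 0}^n$ with $|k|=k_1+\dots+k_n\ge 2$ and $l\in\mathbb Z\setminus\{0\}$ with $\mu_j-\sum_i k_i\mu_i=2l\pi\sqrt{-1}$; (2) there are only finitely many pairs $(j,k)$ with $k\in\mathbb Z_{\ge 0}^n$, $|k|\ge 2$ and $\lambda_j=\lambda_1^{k_1}\cdots\lambda_n^{k_n}$; (3) $F(x)=Ax+f(x)$ on $\mathbb R^n$, where $f$ is a real polynomial map which is resonant: in complex linear coordinates $y$ given by a basis of generalized eigenvectors of $A$ (for instance a Jordan basis), ordered according to $\lambda$, it contains only monomials $y^m e_j$ with $|m|\ge 2$ and $\lambda_j=\lambda^m$. A vector field near $0$ is called an embedding vector field of $F$ if $F$ is, as a germ at $0$, the time one map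 of its local flow. Then $F$ has an embedding vector field of the form $\mathcal X(x)=Bx+v(x)$, where $v$ is a real polynomial map which is resonant for $B$: in complex linear coordinates $y$ given by a basis of generalized eigenvectors of $B$, ordered according to $\mu$, it contains only monomials $y^m e_j$ with $|m|\ge 2$ and $\mu_j=\sum_i m_i\mu_i$. It is unique among the embedding vector fields with linear part $B$ at $0$, in the following sense: (a) every real analytic embedding vector field of $F$ with linear part $B$ at $0$ coincides with $\mathcal X$ near $0$; (b) every $C^\infty$ embedding vector field of $F$ with linear part $B$ at $0$ has the same Taylor series at $0$ as $\mathcal X$; (c) if all eigenvalues of $A$ have modulus less than $1$, or all have modulus larger than $1$, then every $C^\infty$ embedding vector field of $F$ with linear part $B$ at $0$ coincides with $\mathcal X$ near $0$. -/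

import Mathlib

open scoped ContDiff Topology

noncomputable section

/-- A polynomial self-map of `ℝⁿ`, given by its component polynomials. -/
abbrev PolyVec (n : ℕ) : Type := Fin n → MvPolynomial (Fin n) ℝ

/-- The map `x ↦ M x + p x` on `ℝⁿ` with linear part the matrix `M` and polynomial part `p`. It is
used both for the diffeomorphism `A x + f x` and for the vector field `B x + v x`. -/
def linAdd {n : ℕ} (M : Matrix (Fin n) (Fin n) ℝ) (p : PolyVec n) (x : Fin n → ℝ) : Fin n → ℝ :=
  M.mulVec x + fun i => MvPolynomial.eval x (p i)

/-- A real matrix, regarded as a complex one. -/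
def complexify {n : ℕ} (M : Matrix (Fin n) (Fin n) ℝ) : Matrix (Fin n) (Fin n) ℂ :=
  M.map (algebraMap ℝ ℂ)

/-- `lam` is the `n`-tuple of complex eigenvalues of `M`, listed with algebraic multiplicity. -/
def IsEigenvalueTuple {n : ℕ} (M : Matrix (Fin n) (Fin n) ℝ) (lam : Fin n → ℂ) : Prop :=
  (complexify M).charpoly = ∏ i, (Polynomial.X - Polynomial.C (lam i))

/-- `M` is hyperbolic: it has no eigenvalue `0` or of modulus `1`. -/
def IsHyperbolic {n : ℕ} (M : Matrix (Fin n) (Fin n) ℝ) : Prop :=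
  ∀ z : ℂ, (complexify M).charpoly.IsRoot z → z ≠ 0 ∧ ‖z‖ ≠ 1

/-- The resonance relation `lam_j = lam^k`, `|k| ≥ 2`, for the eigenvalues of a diffeomorphism. -/
def DiffeoResonance {n : ℕ} (lam : Fin n → ℂ) (j : Fin n) (k : Fin n → ℕ) : Prop :=
  2 ≤ ∑ i, k i ∧ lam j = ∏ i, lam i ^ k i

/-- The resonance relation `mu_j = ⟨k, mu⟩`, `|k| ≥ 2`, for the eigenvalues of a vector field. -/
def FieldResonance {n : ℕ} (mu : Fin n → ℂ) (j : Fin n) (k : Fin n → ℕ) : Prop :=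
  2 ≤ ∑ i, k i ∧ mu j = ∑ i, (k i : ℂ) * mu i

/-- The weak resonance relation `mu_j - ⟨k, mu⟩ = 2 l π √-1`, `|k| ≥ 2`, `l` a nonzero integer. -/
def WeakResonance {n : ℕ} (mu : Fin n → ℂ) (j : Fin n) (k : Fin n → ℕ) : Prop :=
  2 ≤ ∑ i, k i ∧ ∃ l : ℤ, l ≠ 0 ∧
    mu j - ∑ i, (k i : ℂ) * mu i = 2 * (l : ℂ) * (Real.pi : ℂ) * Complex.I

/-- The eigenvalues of `B` are weakly nonresonant. -/
def IsWeaklyNonresonant {n : ℕ} (B : Matrix (Fin n) (Fin n) ℝ) : Prop :=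
  ∀ mu : Fin n → ℂ, IsEigenvalueTuple B mu → ∀ j k, ¬ WeakResonance mu j k

/-- The eigenvalues of `A` satisfy only finitely many resonance relations. -/
def HasFinitelyManyResonances {n : ℕ} (A : Matrix (Fin n) (Fin n) ℝ) : Prop :=
  ∀ lam : Fin n → ℂ, IsEigenvalueTuple A lam →
    {p : Fin n × (Fin n → ℕ) | DiffeoResonance lam p.1 p.2}.Finite

/-- The columns of `P` are a basis of `ℂⁿ` of generalized eigenvectors of `M`, the `i`-th one for
the eigenvalue `lam i`. Every basis bringing `M` to Jordan normal form is of this kind. -/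
def IsGenEigenbasis {n : ℕ} (M : Matrix (Fin n) (Fin n) ℝ) (P : Matrix (Fin n) (Fin n) ℂ)
    (lam : Fin n → ℂ) : Prop :=
  IsUnit P.det ∧
    ∀ i, ((complexify M - Matrix.scalar (Fin n) (lam i)) ^ n).mulVec (fun r => P r i) = 0

/-- The polynomial map `p` written in the complex coordinates `y` with `x = P y`, that is,
`y ↦ P⁻¹ p (P y)`. -/
def inCoords {n : ℕ} (P : Matrix (Fin n) (Fin n) ℂ) (p : PolyVec n) :
    Fin n → MvPolynomial (Fin n) ℂ := fun j =>
  ∑ i, MvPolynomial.C (P⁻¹ j i) *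
    MvPolynomial.bind₁ (fun r => ∑ s, MvPolynomial.C (P r s) * MvPolynomial.X s)
      (MvPolynomial.map (algebraMap ℝ ℂ) (p i))

/-- The nonlinear part `f` of a diffeomorphism `A x + f x` is a resonant polynomial: in coordinates
given by generalized eigenvectors of `A` it contains only monomials `y ^ m e_j` with `|m| ≥ 2` and
`lam_j = lam ^ m`. The condition does not depend on the choice of the coordinates. -/
def IsResonantForDiffeo {n : ℕ} (A : Matrix (Fin n) (Fin n) ℝ) (f : PolyVec n) : Prop :=
  ∃ (P : Matrix (Fin n) (Fin n) ℂ) (lam : Fin n → ℂ), IsGenEigenbasis A P lam ∧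
    ∀ j, ∀ m ∈ (inCoords P f j).support, DiffeoResonance lam j m

/-- The nonlinear part `v` of a vector field `B x + v x` is a resonant polynomial: in coordinates
given by generalized eigenvectors of `B` it contains only monomials `y ^ m e_j` with `|m| ≥ 2` and
`mu_j = ⟨m, mu⟩`. The condition does not depend on the choice of the coordinates. -/
def IsResonantForField {n : ℕ} (B : Matrix (Fin n) (Fin n) ℝ) (v : PolyVec n) : Prop :=
  ∃ (P : Matrix (Fin n) (Fin n) ℂ) (mu : Fin n → ℂ), IsGenEigenbasis B P mu ∧
    ∀ j, ∀ m ∈ (inCoords P v j).support, FieldResonance mu j m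

/-- `X` is a `C^k` embedding vector field of `F` in `(ℝⁿ, 0)`: `X` is of class `C^k` near `0`, and
`F` is near `0` the time one map of the local flow of `X`. As `X` and `F` stand for germs at `0`,
the solution from `x` to `F x` is asked to stay in any prescribed neighbourhood `U` of `0`
once `x` is close enough to `0`. -/
def IsEmbeddingField {n : ℕ} (k : WithTop ℕ∞) (X F : (Fin n → ℝ) → (Fin n → ℝ)) : Prop :=
  (∃ W ∈ 𝓝 (0 : Fin n → ℝ), ContDiffOn ℝ k X W) ∧
    ∀ U ∈ 𝓝 (0 : Fin n → ℝ), ∀ᶠ x in 𝓝 (0 : Fin n → ℝ),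
      ∃ γ : ℝ → Fin n → ℝ, γ 0 = x ∧ γ 1 = F x ∧
        ∀ t ∈ Set.Icc (0 : ℝ) 1,
          γ t ∈ U ∧ HasDerivWithinAt γ (X (γ t)) (Set.Icc (0 : ℝ) 1) t

/-- The linear part of the vector field `X` at `0` is the matrix `B`. -/
def HasLinearPart {n : ℕ} (X : (Fin n → ℝ) → (Fin n → ℝ)) (B : Matrix (Fin n) (Fin n) ℝ) : Prop :=
  HasFDerivAt X (LinearMap.toContinuousLinearMap (Matrix.mulVecLin B)) 0

/-- All eigenvalues of `A` have modulus less than `1`, or all have modulus larger than `1`. -/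
def InPoincareDomain {n : ℕ} (A : Matrix (Fin n) (Fin n) ℝ) : Prop :=
  (∀ z : ℂ, (complexify A).charpoly.IsRoot z → ‖z‖ < 1) ∨
    (∀ z : ℂ, (complexify A).charpoly.IsRoot z → 1 < ‖z‖)

end

/-!
Embedding vector fields are constructed and compared one homogeneous degree at a time, and both
existence and uniqueness rest on a single linear operator. If two vector fields with linear part `B`
differ at lowest order by a homogeneous field `P` of degree `d`, then their time one maps differ at
lowest order by `exp B` applied to the average `flowAverage B P` of the pull-backs of `P` by the
linear flow `x ↦ exp (s B) x`, `0 ≤ s ≤ 1`. This is a Grönwall estimate in the coordinates moving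
with the linear flow (`exists_nhds_norm_curve_sub_curve_le`). So the point is to understand the
averaging operator on polynomial vector fields. The pull-back satisfies a differential equation
governed by the bracket `adLin B` with the linear field `B x`, whose generalized eigenvalues are the
numbers `⟨m, μ⟩ - μ_j`; thus averaging acts there like `(exp z - 1) / z`.

*Existence.* Under weak nonresonance, the resonant maps for `A = exp B` are the resonant ones for
`B`, up to linear terms the elements of `weightPreserving P μ`, where `P` is a basis of generalized
eigenvectors. On this space `adLin B` is nilpotent and averaging is unipotent, hence invertible
(`exists_flowAverage_eq`). As there are only finitely many resonances, the space has finite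
dimension; it is stable under the derivation along any of its members, so the coordinate functions
satisfy a linear differential equation with constant coefficients along the solutions, and the time
one map of a resonant vector field is again a resonant polynomial map
(`IsGenEigenbasis.exists_isEmbeddingField`). Correcting the vector field degree by degree, one
reaches a vector field whose time one map agrees with `F` in all degrees that can occur
(`IsGenEigenbasis.exists_embedding`).

*Uniqueness of the Taylor series.* The first terms of degree at least `2` in which two embedding
vector fields of `F` differ have average zero. The generalized eigenvalues `z = ⟨m, μ⟩ - μ_j` of
`adLin B` satisfy `exp z = 1` only if `z = 0`, by weak nonresonance, so averaging is injective
(`eq_zero_of_flowAverage_eq_zero`) and the terms vanish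
(`IsGenEigenbasis.iteratedFDeriv_sub_eq_zero`). For analytic vector fields this gives equality near
the origin.

*Uniqueness in the Poincaré domain.* The difference `Z` of two smooth embedding vector fields is
flat at `0` and invariant under `F`, that is, `F'(x) Z(x) = Z(F(x))`. As `F` or its inverse has an
iterate that contracts, and flatness outweighs the growth of `F'` along the iterates, iterating this
relation bounds `Z` by a geometric sequence with limit `0` (`eventually_eq_of_isEmbeddingField_of_flat`).
-/

open scoped ContDiff Topology

noncomputable section

/-! ### Linear flows, and solutions near an equilibrium -/

section
attribute [local instance] Matrix.linftyOpNormedRing Matrix.linftyOpNormedAlgebra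

variable {n : ℕ} {𝕜 : Type*} [RCLike 𝕜]

/-- The flow `exp (t B)` of the linear vector field `B x`, for a real or complex matrix `B` and real
time `t`. -/
def linFlow (B : Matrix (Fin n) (Fin n) 𝕜) (t : ℝ) : Matrix (Fin n) (Fin n) 𝕜 :=
  NormedSpace.exp (t • B)

lemma linFlow_zero (B : Matrix (Fin n) (Fin n) 𝕜) : linFlow B 0 = 1 := by
  simp [linFlow]

lemma linFlow_add (B : Matrix (Fin n) (Fin n) 𝕜) (s t : ℝ) :
    linFlow B (s + t) = linFlow B s * linFlow B t := by
  rw [linFlow, add_smul, Matrix.exp_add_of_commute]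
  · rfl
  · exact ((Commute.refl B).smul_left s).smul_right t

lemma linFlow_neg_mul (B : Matrix (Fin n) (Fin n) 𝕜) (t : ℝ) :
    linFlow B (-t) * linFlow B t = 1 := by
  rw [← linFlow_add, neg_add_cancel, linFlow_zero]

lemma linFlow_mul_neg (B : Matrix (Fin n) (Fin n) 𝕜) (t : ℝ) :
    linFlow B t * linFlow B (-t) = 1 := by
  rw [← linFlow_add, add_neg_cancel, linFlow_zero]

lemma commute_linFlow (B : Matrix (Fin n) (Fin n) 𝕜) (t : ℝ) : Commute B (linFlow B t) :=
  ((Commute.refl B).smul_right t).exp_right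

lemma hasDerivAt_linFlow (B : Matrix (Fin n) (Fin n) 𝕜) (t : ℝ) :
    HasDerivAt (linFlow B) (B * linFlow B t) t :=
  hasDerivAt_exp_smul_const' (𝕂 := ℝ) B t

lemma continuous_linFlow (B : Matrix (Fin n) (Fin n) 𝕜) : Continuous (linFlow B) :=
  continuous_iff_continuousAt.2 fun t => (hasDerivAt_linFlow B t).continuousAt

lemma HasDerivWithinAt.matrix_mulVec {M : ℝ → Matrix (Fin n) (Fin n) 𝕜}
    {M' : Matrix (Fin n) (Fin n) 𝕜} {c : ℝ → Fin n → 𝕜} {c' : Fin n → 𝕜} {s : Set ℝ} {t : ℝ}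
    (hM : HasDerivWithinAt M M' s t) (hc : HasDerivWithinAt c c' s t) :
    HasDerivWithinAt (fun t => (M t).mulVec (c t)) (M'.mulVec (c t) + (M t).mulVec c') s t := by
  have hent : ∀ i j, HasDerivWithinAt (fun t => M t i j) (M' i j) s t := fun i j =>
    ((Matrix.entryLinearMap ℝ 𝕜 i j).toContinuousLinearMap.hasFDerivAt.comp_hasDerivWithinAt t hM)
  rw [hasDerivWithinAt_pi] at hc ⊢
  intro i
  simp only [Matrix.mulVec, dotProduct, Pi.add_apply, ← Finset.sum_add_distrib]
  exact HasDerivWithinAt.fun_sum fun j _ => (hent i j).mul (hc j)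

lemma hasDerivWithinAt_linFlow_neg_mulVec (B : Matrix (Fin n) (Fin n) 𝕜)
    {c : ℝ → Fin n → 𝕜} {c' : Fin n → 𝕜} {s : Set ℝ} {t : ℝ} (hc : HasDerivWithinAt c c' s t) :
    HasDerivWithinAt (fun t => (linFlow B (-t)).mulVec (c t))
      ((linFlow B (-t)).mulVec (c' - B.mulVec (c t))) s t := by
  have h1 : HasDerivAt (fun t => linFlow B (-t)) (-(B * linFlow B (-t))) t :=
    ((hasDerivAt_linFlow B (-t)).scomp t (hasDerivAt_neg t)).congr_deriv (neg_one_smul ℝ _)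
  convert h1.hasDerivWithinAt.matrix_mulVec hc using 1
  rw [(commute_linFlow B (-t)).eq, Matrix.mulVec_sub, Matrix.mulVec_mulVec, Matrix.neg_mulVec]
  abel

lemma hasDerivWithinAt_linFlow_mulVec (B : Matrix (Fin n) (Fin n) 𝕜)
    {c : ℝ → Fin n → 𝕜} {c' : Fin n → 𝕜} {s : Set ℝ} {t : ℝ} (hc : HasDerivWithinAt c c' s t) :
    HasDerivWithinAt (fun t => (linFlow B t).mulVec (c t))
      (B.mulVec ((linFlow B t).mulVec (c t)) + (linFlow B t).mulVec c') s t := by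
  rw [Matrix.mulVec_mulVec]
  exact (hasDerivAt_linFlow B t).hasDerivWithinAt.matrix_mulVec hc

lemma hasDerivAt_linFlow_mulVec (B : Matrix (Fin n) (Fin n) 𝕜) (x : Fin n → 𝕜) (t : ℝ) :
    HasDerivAt (fun t => (linFlow B t).mulVec x) (B.mulVec ((linFlow B t).mulVec x)) t := by
  rw [← hasDerivWithinAt_univ]
  simpa using hasDerivWithinAt_linFlow_mulVec B (hasDerivWithinAt_const t Set.univ x)

lemma continuous_linFlow_mulVec (B : Matrix (Fin n) (Fin n) 𝕜) :
    Continuous fun p : ℝ × (Fin n → 𝕜) => (linFlow B p.1).mulVec p.2 :=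
  ((continuous_linFlow B).comp continuous_fst).matrix_mulVec continuous_snd

lemma exists_linFlow_bound (B : Matrix (Fin n) (Fin n) 𝕜) :
    ∃ M : ℝ, 1 ≤ M ∧ ∀ t ∈ Set.Icc (-1 : ℝ) 1, ∀ x : Fin n → 𝕜,
      ‖(linFlow B t).mulVec x‖ ≤ M * ‖x‖ := by
  obtain ⟨C, hC⟩ := isCompact_Icc (a := (-1 : ℝ)) (b := 1) |>.exists_bound_of_continuousOn
    (continuous_linFlow B).continuousOn
  refine ⟨max 1 C, le_max_left _ _, fun t ht x => ?_⟩
  exact (Matrix.linfty_opNorm_mulVec _ _).trans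
    (mul_le_mul_of_nonneg_right ((hC t ht).trans (le_max_right _ _)) (norm_nonneg _))

end
/-- A Grönwall bound -/
lemma norm_le_mul_exp_of_norm_deriv_le {E : Type*} [NormedAddCommGroup E] [NormedSpace ℝ E]
    {f f' : ℝ → E} {K ε : ℝ} (hK : 0 ≤ K) (hε : 0 ≤ ε) (h0 : f 0 = 0)
    (hf : ∀ t ∈ Set.Icc (0 : ℝ) 1, HasDerivWithinAt f (f' t) (Set.Icc 0 1) t)
    (hb : ∀ t ∈ Set.Icc (0 : ℝ) 1, ‖f' t‖ ≤ K * ‖f t‖ + ε) :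
    ∀ t ∈ Set.Icc (0 : ℝ) 1, ‖f t‖ ≤ ε * Real.exp (K + 1) := by
  intro t ht
  have key := norm_le_gronwallBound_of_norm_deriv_right_le (f := f) (f' := f') (δ := 0)
    (K := K + 1) (ε := ε) (a := 0) (b := 1)
    (fun t ht => (hf t ht).continuousWithinAt)
    (fun t ht => (hf t ⟨ht.1, ht.2.le⟩).mono_of_mem_nhdsWithin
      (Icc_mem_nhdsGE_of_mem ht)) (by simp [h0])
    (fun t ht => (hb t ⟨ht.1, ht.2.le⟩).trans (by nlinarith [norm_nonneg (f t)])) t ht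
  refine key.trans ?_
  rw [gronwallBound_of_K_ne_0 (by positivity)]
  have h1 : Real.exp ((K + 1) * (t - 0)) ≤ Real.exp (K + 1) := by
    apply Real.exp_le_exp.2; nlinarith [ht.2]
  have h2 : ε / (K + 1) ≤ ε := div_le_self hε (by linarith)
  have h3 : 0 ≤ ε / (K + 1) := by positivity
  have h4 : 1 ≤ Real.exp (K + 1) := Real.one_le_exp (by linarith)
  nlinarith [Real.exp_pos (K + 1)]

/-- `γ` is a solution of `γ' = X γ` on the time interval `[0, 1]` that stays in `U`. -/
def IsCurveIn {n : ℕ} (X : (Fin n → ℝ) → (Fin n → ℝ)) (U : Set (Fin n → ℝ))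
    (γ : ℝ → Fin n → ℝ) : Prop :=
  ∀ t ∈ Set.Icc (0 : ℝ) 1, γ t ∈ U ∧ HasDerivWithinAt γ (X (γ t)) (Set.Icc (0 : ℝ) 1) t

lemma IsCurveIn.mono {n : ℕ} {X : (Fin n → ℝ) → (Fin n → ℝ)} {U V : Set (Fin n → ℝ)}
    {γ : ℝ → Fin n → ℝ} (h : IsCurveIn X U γ) (hUV : U ⊆ V) : IsCurveIn X V γ :=
  fun t ht => ⟨hUV (h t ht).1, (h t ht).2⟩

variable {n : ℕ}

lemma linFlow_mulVec_neg_cancel {𝕜 : Type*} [RCLike 𝕜] (B : Matrix (Fin n) (Fin n) 𝕜) (t : ℝ)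
    (x : Fin n → 𝕜) : (linFlow B t).mulVec ((linFlow B (-t)).mulVec x) = x := by
  rw [Matrix.mulVec_mulVec, linFlow_mul_neg, Matrix.one_mulVec]

lemma linFlow_neg_mulVec_cancel {𝕜 : Type*} [RCLike 𝕜] (B : Matrix (Fin n) (Fin n) 𝕜) (t : ℝ)
    (x : Fin n → 𝕜) : (linFlow B (-t)).mulVec ((linFlow B t).mulVec x) = x := by
  rw [Matrix.mulVec_mulVec, linFlow_neg_mul, Matrix.one_mulVec]

/-- Near `0` the solutions of `γ' = Y γ` follow the linearised flow. -/
lemma exists_nhds_norm_curve_sub_linFlow_le {Y : (Fin n → ℝ) → (Fin n → ℝ)}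
    {B : Matrix (Fin n) (Fin n) ℝ} (hY : HasLinearPart Y B) (hY0 : Y 0 = 0) {ε : ℝ}
    (hε : 0 < ε) :
    ∃ U ∈ 𝓝 (0 : Fin n → ℝ), ∀ γ, IsCurveIn Y U γ → ∀ t ∈ Set.Icc (0 : ℝ) 1,
      ‖γ t - (linFlow B t).mulVec (γ 0)‖ ≤ ε * ‖γ 0‖ := by
  obtain ⟨M, hM1, hM⟩ := exists_linFlow_bound B
  have hM0 : 0 < M := by linarith
  set c : ℝ := min 1 (ε / (M ^ 3 * Real.exp (M ^ 2 + 1))) with hc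
  have hc0 : 0 < c := lt_min one_pos (by positivity)
  have hc1 : c ≤ 1 := min_le_left _ _
  have hcε : M ^ 3 * c * Real.exp (M ^ 2 + 1) ≤ ε := by
    have : c ≤ ε / (M ^ 3 * Real.exp (M ^ 2 + 1)) := min_le_right _ _
    rw [le_div_iff₀ (by positivity)] at this
    linarith
  have hU : ∀ᶠ a in 𝓝 (0 : Fin n → ℝ), ‖Y a - B.mulVec a‖ ≤ c * ‖a‖ := by
    simpa [hY0] using hY.isLittleO.def hc0
  refine ⟨_, hU, fun γ hγ t ht => ?_⟩
  -- the deviation of `γ` from the linear flow, in the coordinates moving with that flow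
  set h : ℝ → Fin n → ℝ := fun t => (linFlow B (-t)).mulVec (γ t) - γ 0 with hh
  have hγh : ∀ t, γ t = (linFlow B t).mulVec (h t + γ 0) := fun t => by
    simp only [hh, sub_add_cancel, linFlow_mulVec_neg_cancel]
  have hbound : ∀ t ∈ Set.Icc (0 : ℝ) 1, ‖h t‖ ≤ M ^ 2 * c * ‖γ 0‖ * Real.exp (M ^ 2 * c + 1) := by
    apply norm_le_mul_exp_of_norm_deriv_le (K := M ^ 2 * c)
      (f' := fun t => (linFlow B (-t)).mulVec (Y (γ t) - B.mulVec (γ t)))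
    · positivity
    · positivity
    · simp [hh, linFlow_zero]
    · exact fun t ht => (hasDerivWithinAt_linFlow_neg_mulVec B (hγ t ht).2).sub_const _
    · intro t ht
      have h1 := hM (-t) ⟨by linarith [ht.2], by linarith [ht.1]⟩ (Y (γ t) - B.mulVec (γ t))
      have h2 : ‖Y (γ t) - B.mulVec (γ t)‖ ≤ c * ‖γ t‖ := (hγ t ht).1
      have h3 : ‖γ t‖ ≤ M * (‖h t‖ + ‖γ 0‖) := by
        conv_lhs => rw [hγh t]
        exact (hM t ⟨by linarith [ht.1], ht.2⟩ _).trans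
          (mul_le_mul_of_nonneg_left (norm_add_le _ _) hM0.le)
      calc _ ≤ M * (c * (M * (‖h t‖ + ‖γ 0‖))) := h1.trans (by gcongr; exact h2.trans (by gcongr))
        _ = _ := by ring
  have hexp : Real.exp (M ^ 2 * c + 1) ≤ Real.exp (M ^ 2 + 1) := by
    apply Real.exp_le_exp.2; nlinarith [sq_nonneg M]
  have h4 : γ t - (linFlow B t).mulVec (γ 0) = (linFlow B t).mulVec (h t) := by
    conv_lhs => rw [hγh t, Matrix.mulVec_add]
    abel
  rw [h4]
  calc _ ≤ M * ‖h t‖ := hM t ⟨by linarith [ht.1], ht.2⟩ _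
    _ ≤ M * (M ^ 2 * c * ‖γ 0‖ * Real.exp (M ^ 2 + 1)) := by
      gcongr
      exact (hbound t ht).trans (by gcongr)
    _ = M ^ 3 * c * Real.exp (M ^ 2 + 1) * ‖γ 0‖ := by ring
    _ ≤ _ := by gcongr

/-- The time average of the pull-backs of the vector field `P` by the flow of the linear
field `B`. -/
def flowAverage {𝕜 : Type*} [RCLike 𝕜] (B : Matrix (Fin n) (Fin n) 𝕜)
    (P : (Fin n → 𝕜) → (Fin n → 𝕜)) (x : Fin n → 𝕜) : Fin n → 𝕜 :=
  ∫ s in (0 : ℝ)..1, (linFlow B (-s)).mulVec (P ((linFlow B s).mulVec x))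

lemma continuous_pullback_linFlow {𝕜 : Type*} [RCLike 𝕜] (B : Matrix (Fin n) (Fin n) 𝕜)
    {P : (Fin n → 𝕜) → (Fin n → 𝕜)} (hP : Continuous P) (x : Fin n → 𝕜) :
    Continuous fun s : ℝ => (linFlow B (-s)).mulVec (P ((linFlow B s).mulVec x)) :=
  (continuous_linFlow_mulVec B).comp (continuous_neg.prodMk
    (hP.comp ((continuous_linFlow_mulVec B).comp (continuous_id.prodMk continuous_const))))

/-- A continuous homogeneous map takes nearby points to nearby points, at the scale of its
degree. -/
lemma exists_norm_sub_le_of_homogeneous {P : (Fin n → ℝ) → (Fin n → ℝ)} {d : ℕ}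
    (hP : Continuous P) (hPd : ∀ (c : ℝ) x, P (c • x) = c ^ d • P x) (R : ℝ) {ε : ℝ}
    (hε : 0 < ε) :
    ∃ δ > 0, ∀ r : ℝ, 0 < r → ∀ a b : Fin n → ℝ, ‖a‖ ≤ R * r → ‖b‖ ≤ R * r →
      ‖a - b‖ ≤ δ * r → ‖P a - P b‖ ≤ ε * r ^ d := by
  have huc := (isCompact_closedBall (0 : Fin n → ℝ) R).uniformContinuousOn_of_continuous
    hP.continuousOn
  rw [Metric.uniformContinuousOn_iff] at huc
  obtain ⟨δ, hδ, hδ'⟩ := huc ε hε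
  refine ⟨δ / 2, by positivity, fun r hr a b ha hb hab => ?_⟩
  have hs : ∀ a : Fin n → ℝ, a = r • (r⁻¹ • a) := fun a => by
    rw [smul_smul, mul_inv_cancel₀ hr.ne', one_smul]
  have hn : ∀ a : Fin n → ℝ, ‖r⁻¹ • a‖ = ‖a‖ / r := fun a => by
    rw [norm_smul, Real.norm_of_nonneg (by positivity), inv_mul_eq_div]
  have h1 := hδ' (r⁻¹ • a) (by rw [mem_closedBall_zero_iff, hn, div_le_iff₀ hr]; exact ha)
    (r⁻¹ • b) (by rw [mem_closedBall_zero_iff, hn, div_le_iff₀ hr]; exact hb)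
    (by rw [dist_eq_norm, ← smul_sub, hn, div_lt_iff₀ hr]; nlinarith)
  have h2 : ∀ a, P a = r ^ d • P (r⁻¹ • a) := fun a => by rw [← hPd, ← hs a]
  rw [h2 a, h2 b, ← smul_sub, norm_smul, Real.norm_of_nonneg (by positivity), mul_comm]
  rw [dist_eq_norm] at h1
  gcongr

/-- Comparison of the time one maps of two vector fields with the same linear part `B` at `0`
which differ by a homogeneous field `P` of degree `d` up to higher order: to leading order, the
difference is `exp B` applied to the average of `P` along the flow of `B`. -/
lemma exists_nhds_norm_curve_sub_curve_le {X Y P : (Fin n → ℝ) → (Fin n → ℝ)}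
    {B : Matrix (Fin n) (Fin n) ℝ} {d : ℕ}
    (hX : HasStrictFDerivAt X (LinearMap.toContinuousLinearMap (Matrix.mulVecLin B)) 0)
    (hY : HasLinearPart Y B) (hY0 : Y 0 = 0) (hd : d ≠ 0)
    (hP : Continuous P) (hPd : ∀ (c : ℝ) x, P (c • x) = c ^ d • P x)
    (hYX : (fun x => Y x - X x - P x) =o[𝓝 0] fun x => ‖x‖ ^ d) {ε : ℝ} (hε : 0 < ε) :
    ∃ U ∈ 𝓝 (0 : Fin n → ℝ), ∀ γ σ, IsCurveIn X U γ → IsCurveIn Y U σ → γ 0 = σ 0 →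
      ‖σ 1 - γ 1 - (linFlow B 1).mulVec (flowAverage B P (σ 0))‖ ≤ ε * ‖σ 0‖ ^ d := by
  obtain ⟨M, hM1, hM⟩ := exists_linFlow_bound B
  have hM0 : 0 < M := by linarith
  -- `C` bounds `P` on the ball that contains the orbits issuing from the unit ball
  obtain ⟨C, hC0, hC⟩ : ∃ C : ℝ, 0 ≤ C ∧ ∀ x, ‖P x‖ ≤ C * ‖x‖ ^ d := by
    obtain ⟨C, hC⟩ := (isCompact_closedBall (0 : Fin n → ℝ) 1).exists_bound_of_continuousOn
      hP.continuousOn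
    refine ⟨C, (norm_nonneg _).trans (hC 0 (by simp)), fun x => ?_⟩
    rcases eq_or_ne x 0 with rfl | hx
    · have := hPd 0 0
      simp only [smul_zero, zero_pow hd, zero_smul] at this
      simp [this, zero_pow hd]
    · have hx' : 0 < ‖x‖ := norm_pos_iff.2 hx
      have h1 : x = ‖x‖ • (‖x‖⁻¹ • x) := by
        rw [smul_smul, mul_inv_cancel₀ hx'.ne', one_smul]
      conv_lhs => rw [h1, hPd, norm_smul, Real.norm_of_nonneg (by positivity), mul_comm]
      gcongr
      apply hC
      rw [mem_closedBall_zero_iff, norm_smul, norm_inv, norm_norm, inv_mul_cancel₀ hx'.ne']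
  -- `R` bounds `‖σ t‖ / ‖σ 0‖`, and `D η ‖x‖ ^ d` is the inhomogeneous term in Grönwall's inequality
  set R : ℝ := M + 1 with hR
  set D : ℝ := M * (M ^ 2 * C * M ^ d + R ^ d + 1) with hD
  have hD0 : 0 < D := by positivity
  set η : ℝ := min 1 (ε / (M * D * Real.exp (M ^ 2 + 1))) with hη
  have hη0 : 0 < η := lt_min one_pos (by positivity)
  have hη1 : η ≤ 1 := min_le_left _ _
  have hηε : M * (D * η * Real.exp (M ^ 2 + 1)) ≤ ε := by
    have : η ≤ ε / (M * D * Real.exp (M ^ 2 + 1)) := min_le_right _ _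
    rw [le_div_iff₀ (by positivity)] at this
    linarith
  obtain ⟨δ, hδ0, hδ⟩ := exists_norm_sub_le_of_homogeneous hP hPd R hη0
  obtain ⟨U₁, hU₁, hU₁'⟩ := exists_nhds_norm_curve_sub_linFlow_le hY hY0 (lt_min one_pos hδ0)
  have hU₂ : ∀ᶠ a in 𝓝 (0 : Fin n → ℝ), ‖Y a - X a - P a‖ ≤ η * ‖a‖ ^ d := by
    simpa using hYX.def hη0
  obtain ⟨V, hV, hV'⟩ : ∃ V ∈ 𝓝 (0 : Fin n → ℝ), ∀ a ∈ V, ∀ b ∈ V,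
      ‖X a - X b - B.mulVec (a - b)‖ ≤ η * ‖a - b‖ := by
    have := hX.isLittleO.def hη0
    rw [nhds_prod_eq] at this
    obtain ⟨V, hV, hV'⟩ := Filter.mem_prod_same_iff.1 this
    exact ⟨V, hV, fun a ha b hb => hV' (Set.mk_mem_prod ha hb)⟩
  refine ⟨_, Filter.inter_mem hV (Filter.inter_mem hU₁ hU₂), fun γ σ hγ hσ h0 => ?_⟩
  set x := σ 0 with hx
  have hlin : ∀ t ∈ Set.Icc (0 : ℝ) 1, ‖(linFlow B t).mulVec x‖ ≤ M * ‖x‖ :=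
    fun t ht => hM t ⟨by linarith [ht.1], ht.2⟩ x
  have hlin' : ∀ t ∈ Set.Icc (0 : ℝ) 1, ∀ y : Fin n → ℝ, ‖(linFlow B (-t)).mulVec y‖ ≤ M * ‖y‖ :=
    fun t ht => hM (-t) ⟨by linarith [ht.2], by linarith [ht.1]⟩
  have hσlin : ∀ t ∈ Set.Icc (0 : ℝ) 1,
      ‖σ t - (linFlow B t).mulVec x‖ ≤ min 1 δ * ‖x‖ :=
    hU₁' σ (hσ.mono fun a ha => ha.2.1)
  have hσR : ∀ t ∈ Set.Icc (0 : ℝ) 1, ‖σ t‖ ≤ R * ‖x‖ := fun t ht => by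
    have h1 := hσlin t ht
    have h2 := norm_le_norm_add_norm_sub' (σ t) ((linFlow B t).mulVec x)
    have h3 : min 1 δ * ‖x‖ ≤ 1 * ‖x‖ := by gcongr; exact min_le_left _ _
    rw [hR]
    linarith [hlin t ht]
  have hPσ : ∀ t ∈ Set.Icc (0 : ℝ) 1, ‖P (σ t) - P ((linFlow B t).mulVec x)‖ ≤ η * ‖x‖ ^ d := by
    intro t ht
    rcases eq_or_ne x 0 with h0 | h0
    · have h1 := hσR t ht
      rw [h0, norm_zero, mul_zero, norm_le_zero_iff] at h1
      simp [h1, h0, hd]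
    · refine hδ _ (norm_pos_iff.2 h0) _ _ (hσR t ht) ((hlin t ht).trans ?_) ((hσlin t ht).trans ?_)
      · gcongr; linarith
      · gcongr; exact min_le_right _ _
  set p : ℝ → Fin n → ℝ := fun s => (linFlow B (-s)).mulVec (P ((linFlow B s).mulVec x)) with hp
  have hpc : Continuous p := continuous_pullback_linFlow B hP x
  set I : ℝ → Fin n → ℝ := fun t => ∫ s in (0 : ℝ)..t, p s with hI
  have hpb : ∀ t ∈ Set.Icc (0 : ℝ) 1, ‖p t‖ ≤ M * (C * (M * ‖x‖) ^ d) := fun t ht =>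
    (hlin' t ht _).trans (by gcongr; exact (hC _).trans (by gcongr; exact hlin t ht))
  have hIb : ∀ t ∈ Set.Icc (0 : ℝ) 1, ‖I t‖ ≤ M * (C * (M * ‖x‖) ^ d) := fun t ht => by
    have h1 := intervalIntegral.norm_integral_le_of_norm_le_const (a := (0 : ℝ)) (b := t) (f := p)
      (C := M * (C * (M * ‖x‖) ^ d)) (fun s hs => by
        rw [Set.uIoc_of_le ht.1] at hs
        exact hpb s ⟨hs.1.le, hs.2.trans ht.2⟩)
    rw [sub_zero, abs_of_nonneg ht.1] at h1
    exact h1.trans (mul_le_of_le_one_right (by positivity) ht.2)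
  -- in the coordinates moving with the linear flow, `θ` is the part of `σ - γ` that the partial
  -- average `I` does not account for
  set θ : ℝ → Fin n → ℝ := fun t => (linFlow B (-t)).mulVec (σ t - γ t) - I t with hθ
  have hσγ : ∀ t, σ t - γ t = (linFlow B t).mulVec (θ t + I t) := fun t => by
    simp only [hθ, sub_add_cancel, linFlow_mulVec_neg_cancel]
  have hbound : ∀ t ∈ Set.Icc (0 : ℝ) 1,
      ‖θ t‖ ≤ D * η * ‖x‖ ^ d * Real.exp (M ^ 2 * η + 1) := by
    apply norm_le_mul_exp_of_norm_deriv_le (K := M ^ 2 * η)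
      (f' := fun t => (linFlow B (-t)).mulVec (Y (σ t) - X (γ t) - B.mulVec (σ t - γ t)) - p t)
    · positivity
    · positivity
    · simp only [hθ, hI, neg_zero, linFlow_zero, Matrix.one_mulVec, h0,
        intervalIntegral.integral_same, sub_zero]
      exact sub_self _
    · intro t ht
      refine (hasDerivWithinAt_linFlow_neg_mulVec B ((hσ t ht).2.sub (hγ t ht).2)).sub ?_
      exact (hpc.integral_hasStrictDerivAt 0 t).hasDerivAt.hasDerivWithinAt
    · intro t ht
      -- the nonlinear part of `X`, the remainder of `Y - X`, and `P` along `σ` against `P` along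
      -- the linear flow
      have hsplit : (linFlow B (-t)).mulVec (Y (σ t) - X (γ t) - B.mulVec (σ t - γ t)) - p t
          = (linFlow B (-t)).mulVec ((X (σ t) - X (γ t) - B.mulVec (σ t - γ t)) +
            (Y (σ t) - X (σ t) - P (σ t)) + (P (σ t) - P ((linFlow B t).mulVec x))) := by
        simp only [hp, ← Matrix.mulVec_sub]
        congr 1
        abel
      rw [hsplit]
      have e1 := hV' _ (hσ t ht).1.1 _ (hγ t ht).1.1
      have e2 : ‖Y (σ t) - X (σ t) - P (σ t)‖ ≤ η * (R * ‖x‖) ^ d :=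
        (show _ ≤ η * ‖σ t‖ ^ d from (hσ t ht).1.2.2).trans (by gcongr; exact hσR t ht)
      have e3 := hPσ t ht
      have e4 : ‖σ t - γ t‖ ≤ M * (‖θ t‖ + M * (C * (M * ‖x‖) ^ d)) := by
        rw [hσγ t]
        refine (hM t ⟨by linarith [ht.1], ht.2⟩ _).trans ?_
        gcongr
        exact (norm_add_le _ _).trans (by gcongr; exact hIb t ht)
      calc _ ≤ M * (η * (M * (‖θ t‖ + M * (C * (M * ‖x‖) ^ d))) + η * (R * ‖x‖) ^ d
            + η * ‖x‖ ^ d) := by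
            refine (hlin' t ht _).trans ?_
            gcongr
            refine (norm_add₃_le).trans ?_
            gcongr
            exact e1.trans (by gcongr)
        _ = _ := by rw [hD, mul_pow, mul_pow]; ring
  have hexp : Real.exp (M ^ 2 * η + 1) ≤ Real.exp (M ^ 2 + 1) := by
    apply Real.exp_le_exp.2; nlinarith [sq_nonneg M]
  have h1 : (1 : ℝ) ∈ Set.Icc (0 : ℝ) 1 := by simp
  have h4 : σ 1 - γ 1 - (linFlow B 1).mulVec (flowAverage B P x) = (linFlow B 1).mulVec (θ 1) := by
    rw [hσγ 1, Matrix.mulVec_add]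
    exact add_sub_cancel_right _ _
  rw [h4]
  calc _ ≤ M * ‖θ 1‖ := hM 1 (by simp) _
    _ ≤ M * (D * η * ‖x‖ ^ d * Real.exp (M ^ 2 + 1)) := by
      gcongr
      exact (hbound 1 h1).trans (by gcongr)
    _ = M * (D * η * Real.exp (M ^ 2 + 1)) * ‖x‖ ^ d := by ring
    _ ≤ _ := by gcongr

/-! ### Taylor expansions and embedding vector fields -/

section
variable {E F : Type*} [NormedAddCommGroup E] [NormedSpace ℝ E] [NormedAddCommGroup F]
  [NormedSpace ℝ F]

lemma ContDiffAt.eventually_iteratedFDeriv_succ {d k : ℕ} {f : E → F} {x : E}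
    (hf : ContDiffAt ℝ d f x) (hk : k < d) : ∀ᶠ y in 𝓝 x, ∀ v : Fin (k + 1) → E,
      iteratedFDeriv ℝ (k + 1) f y v =
        fderiv ℝ (fun z => iteratedFDeriv ℝ k f z (Fin.tail v)) y (v 0) := by
  filter_upwards [hf.eventually (by simp)] with y hy v
  exact (hy.differentiableAt_iteratedFDeriv (by exact_mod_cast hk)).iteratedFDeriv_succ_apply_left'

/-- The iterated derivatives of a real `C^d` function are symmetric up to order `d`. -/
theorem ContDiffAt.iteratedFDeriv_comp_perm_real {d : ℕ} {f : E → F} {x : E}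
    (hf : ContDiffAt ℝ d f x) (v : Fin d → E) (σ : Equiv.Perm (Fin d)) :
    iteratedFDeriv ℝ d f x (v ∘ σ) = iteratedFDeriv ℝ d f x v := by
  induction d generalizing x with
  | zero => rw [Subsingleton.elim (v ∘ σ) v]
  | succ d ih =>
    -- the transpositions of neighbours generate; the first one is the symmetry of the second
    -- derivative, and the others do not involve the outermost derivative
    have hmem : σ ∈ Submonoid.closure
        (Set.range fun i : Fin d => Equiv.swap i.castSucc i.succ) := by
      rw [Equiv.Perm.mclosure_swap_castSucc_succ]; trivial
    induction hmem using Submonoid.closure_induction generalizing v with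
    | one => rfl
    | mul σ τ _ _ h₁ h₂ =>
      rw [Equiv.Perm.coe_mul, ← Function.comp_assoc, h₂, h₁]
    | mem σ hσ =>
      obtain ⟨i, rfl⟩ := hσ
      have hd : ContDiffAt ℝ d f x := hf.of_le (by exact_mod_cast d.le_succ)
      have hs := hf.eventually_iteratedFDeriv_succ d.lt_succ_self
      rcases d with - | d
      · exact i.elim0
      induction i using Fin.cases with
      | zero =>
        have h2 := hf.eventually_iteratedFDeriv_succ (k := d) (by lia)
        set g : E → F := fun z => iteratedFDeriv ℝ d f z (Fin.tail (Fin.tail v)) with hg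
        have hgC : ContDiffAt ℝ 2 g x := by
          have : ContDiffAt ℝ 2 (iteratedFDeriv ℝ d f) x :=
            hf.iteratedFDeriv_right (by push_cast; rw [add_comm, add_assoc]; rfl)
          exact (ContinuousMultilinearMap.apply ℝ (fun _ => E) F
            (Fin.tail (Fin.tail v))).contDiff.contDiffAt.comp x this
        have key : ∀ w : Fin (d + 2) → E, Fin.tail (Fin.tail w) = Fin.tail (Fin.tail v) →
            iteratedFDeriv ℝ (d + 2) f x w = fderiv ℝ (fderiv ℝ g) x (w 0) (w 1) := by
          intro w hw
          rw [hs.self_of_nhds w]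
          have : (fun z => iteratedFDeriv ℝ (d + 1) f z (Fin.tail w)) =ᶠ[𝓝 x]
              fun z => fderiv ℝ g z (w 1) := by
            filter_upwards [h2] with z hz
            rw [hz, hw]; rfl
          rw [this.fderiv_eq]
          have hd2 : DifferentiableAt ℝ (fderiv ℝ g) x :=
            (hgC.fderiv_right (m := 1) (by norm_num)).differentiableAt (by norm_num)
          rw [fderiv_clm_apply hd2 (differentiableAt_const _)]
          simp
        have hsymm := hgC.isSymmSndFDerivAt (by simp)
        rw [key v rfl, key (v ∘ _), hsymm.eq]
        · simp
        · ext j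
          simp only [Fin.tail, Function.comp_apply]
          rw [Equiv.swap_apply_of_ne_of_ne] <;> simp [Fin.ext_iff]
      | succ i =>
        rw [hs.self_of_nhds, hs.self_of_nhds]
        have hperm : Fin.tail (v ∘ (Equiv.swap i.succ.castSucc i.succ.succ)) =
            Fin.tail v ∘ (Equiv.swap i.castSucc i.succ) := by
          ext j
          simp only [Fin.tail, Function.comp_apply]
          congr 1
          simp only [Equiv.swap_apply_def, Fin.ext_iff]
          split_ifs <;> simp_all
        have h0 : (v ∘ (Equiv.swap i.succ.castSucc i.succ.succ)) 0 = v 0 := by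
          simp only [Function.comp_apply]
          rw [Equiv.swap_apply_of_ne_of_ne] <;> simp [Fin.ext_iff]
        rw [h0, hperm]
        congr 1
        apply Filter.EventuallyEq.fderiv_eq
        filter_upwards [hd.eventually (by simp)] with y hy
        exact ih hy _ _

/-- By polarization, the top derivative of a `C^d` function vanishes if it does on the diagonal. -/
lemma ContDiffAt.iteratedFDeriv_eq_zero_of_diagonal {d : ℕ} {f : E → F} {x : E}
    (hf : ContDiffAt ℝ d f x) (h : ∀ y, iteratedFDeriv ℝ d f x (fun _ => y) = 0) :
    iteratedFDeriv ℝ d f x = 0 := by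
  ext v
  have h1 := (iteratedFDeriv ℝ d f x).iteratedFDeriv_comp_diagonal 0 v
  simp only [h] at h1
  have h2 : ∀ σ : Equiv.Perm (Fin d),
      iteratedFDeriv ℝ d f x (fun i => v (σ i)) = iteratedFDeriv ℝ d f x v :=
    fun σ => hf.iteratedFDeriv_comp_perm_real v σ
  simp only [h2, Finset.sum_const, Finset.card_univ, Fintype.card_perm, Fintype.card_fin] at h1
  rw [iteratedFDeriv_fun_zero] at h1
  simpa [← Nat.cast_smul_eq_nsmul ℝ, Nat.factorial_ne_zero] using h1.symm

/-- Taylor's formula at `0` for a function whose derivatives of order less than `d` vanish. -/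
lemma isBigO_sub_diagonal_of_iteratedFDeriv_eq_zero [CompleteSpace F] {d : ℕ} {f : E → F}
    (hf : ContDiffAt ℝ (d + 1 : ℕ) f 0) (h : ∀ k < d, iteratedFDeriv ℝ k f 0 = 0) :
    (fun x => f x - (d.factorial : ℝ)⁻¹ • iteratedFDeriv ℝ d f 0 (fun _ => x)) =O[𝓝 0]
      fun x => ‖x‖ ^ (d + 1) := by
  have hev := hf.eventually (by simp)
  have hbd : ∀ᶠ y in 𝓝 (0 : E), ‖iteratedFDeriv ℝ (d + 1) f y‖ ≤
      ‖iteratedFDeriv ℝ (d + 1) f 0‖ + 1 := by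
    have hc : ContinuousAt (iteratedFDeriv ℝ (d + 1) f) 0 :=
      (hf.iteratedFDeriv_right (m := 0) (i := d + 1) (by simp)).continuousAt
    filter_upwards [hc.norm.eventually_lt continuousAt_const (lt_add_one _)] with y hy
    exact hy.le
  obtain ⟨r, hr, hball⟩ := Metric.eventually_nhds_iff_ball.1 (hev.and hbd)
  set C := ‖iteratedFDeriv ℝ (d + 1) f 0‖ + 1 with hC
  refine Asymptotics.IsBigO.of_bound C ?_
  filter_upwards [Metric.ball_mem_nhds 0 hr] with y hy
  have hmem : ∀ t ∈ Set.Icc (0 : ℝ) 1, (0 : E) + t • y ∈ Metric.ball (0 : E) r := by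
    intro t ht
    rw [zero_add, mem_ball_zero_iff, norm_smul, Real.norm_of_nonneg ht.1]
    exact (mul_le_of_le_one_left (norm_nonneg _) ht.2).trans_lt (mem_ball_zero_iff.1 hy)
  have key := map_add_eq_sum_add_integral_iteratedFDeriv (n := d) (f := f) (x := 0) (y := y)
    (fun t ht => by exact_mod_cast (hball _ (hmem t ht)).1)
  rw [Finset.sum_range_succ, Finset.sum_eq_zero (fun k hk => by
    rw [h k (Finset.mem_range.1 hk)]; simp), zero_add, zero_add] at key
  rw [key, add_sub_cancel_left, norm_smul, norm_pow, norm_norm]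
  have hint := intervalIntegral.norm_integral_le_of_norm_le_const (a := (0 : ℝ)) (b := 1)
    (f := fun t : ℝ => (1 - t) ^ d • iteratedFDeriv ℝ (d + 1) f (0 + t • y) (fun _ => y))
    (C := C * ‖y‖ ^ (d + 1)) (fun t ht => by
      rw [Set.uIoc_of_le zero_le_one] at ht
      have ht' : t ∈ Set.Icc (0 : ℝ) 1 := ⟨ht.1.le, ht.2⟩
      rw [norm_smul, norm_pow, Real.norm_of_nonneg (by linarith [ht.2])]
      have h1 : (1 - t) ^ d ≤ 1 := pow_le_one₀ (by linarith [ht.2]) (by linarith [ht.1])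
      have h2 := (iteratedFDeriv ℝ (d + 1) f (0 + t • y)).le_opNorm (fun _ => y)
      simp only [Finset.prod_const, Finset.card_univ, Fintype.card_fin] at h2
      calc _ ≤ 1 * (C * ‖y‖ ^ (d + 1)) := by
            gcongr
            exact h2.trans (by gcongr; exact (hball _ (hmem t ht')).2)
        _ = _ := one_mul _)
  simp only [sub_zero, abs_one, mul_one] at hint
  have h3 : ‖((d.factorial : ℝ))⁻¹‖ ≤ 1 := by
    rw [norm_inv, Real.norm_natCast]
    exact inv_le_one_of_one_le₀ (by exact_mod_cast Nat.one_le_iff_ne_zero.2 d.factorial_ne_zero)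
  calc _ ≤ 1 * (C * ‖y‖ ^ (d + 1)) := by gcongr
    _ = _ := one_mul _

/-- An analytic function with vanishing Taylor series vanishes near the point. -/
lemma AnalyticAt.eventually_eq_zero_of_iteratedFDeriv_eq_zero [CompleteSpace F] {f : E → F}
    {x : E} (hf : AnalyticAt ℝ f x) (h : ∀ k, iteratedFDeriv ℝ k f x = 0) : f =ᶠ[𝓝 x] 0 := by
  obtain ⟨p, r, hp⟩ := hf
  filter_upwards [Metric.eball_mem_nhds x hp.r_pos] with y hy
  have hs := hp.hasSum_iteratedFDeriv (y := y - x) (by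
    rw [Metric.mem_eball, edist_zero_right, ← edist_eq_enorm_sub]; exact hy)
  simp only [h, add_sub_cancel] at hs
  exact hs.unique (by simp)

end

section
variable {n : ℕ}

/-- The polynomial map `x ↦ M (x, …, x)` attached to a multilinear map `M`. -/
def diagonalPoly {d : ℕ} (M : MultilinearMap ℝ (fun _ : Fin d => Fin n → ℝ) (Fin n → ℝ)) :
    PolyVec n := fun i =>
  ∑ φ : Fin d → Fin n, MvPolynomial.C (M (fun k => Pi.single (φ k) 1) i) *
    ∏ k, MvPolynomial.X (φ k)

lemma eval_diagonalPoly {d : ℕ}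
    (M : MultilinearMap ℝ (fun _ : Fin d => Fin n → ℝ) (Fin n → ℝ)) (x : Fin n → ℝ) (i : Fin n) :
    MvPolynomial.eval x (diagonalPoly M i) = M (fun _ => x) i := by
  have hx : x = ∑ j, x j • Pi.single (M := fun _ => ℝ) j 1 := by
    ext k; simp [Pi.single_apply]
  have h1 : M (fun _ => x) = ∑ φ : Fin d → Fin n, (∏ k, x (φ k)) •
      M (fun k => Pi.single (φ k) 1) := by
    conv_lhs => rw [hx]
    rw [M.map_sum]
    exact Finset.sum_congr rfl fun φ _ => M.map_smul_univ _ _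
  rw [h1, diagonalPoly, Finset.sum_apply]
  simp [mul_comm]

lemma isHomogeneous_diagonalPoly {d : ℕ}
    (M : MultilinearMap ℝ (fun _ : Fin d => Fin n → ℝ) (Fin n → ℝ)) (i : Fin n) :
    (diagonalPoly M i).IsHomogeneous d := by
  refine MvPolynomial.IsHomogeneous.sum _ _ _ fun φ _ => ?_
  refine MvPolynomial.IsHomogeneous.C_mul ?_ _
  simpa using MvPolynomial.IsHomogeneous.prod Finset.univ
    (fun k => (MvPolynomial.X (φ k) : MvPolynomial (Fin n) ℝ)) (fun _ => 1)
    fun k _ => MvPolynomial.isHomogeneous_X ℝ (φ k)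

end

section
variable {n : ℕ}

lemma IsEmbeddingField.eventually_curve {k : WithTop ℕ∞} {X F : (Fin n → ℝ) → (Fin n → ℝ)}
    (h : IsEmbeddingField k X F) {U : Set (Fin n → ℝ)} (hU : U ∈ 𝓝 0) :
    ∀ᶠ x in 𝓝 (0 : Fin n → ℝ), ∃ γ : ℝ → Fin n → ℝ, γ 0 = x ∧ γ 1 = F x ∧ IsCurveIn X U γ :=
  h.2 U hU

lemma IsEmbeddingField.contDiffAt {k : WithTop ℕ∞} {X F : (Fin n → ℝ) → (Fin n → ℝ)}
    (h : IsEmbeddingField k X F) : ContDiffAt ℝ k X 0 := by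
  obtain ⟨W, hW, hX⟩ := h.1
  exact hX.contDiffAt hW

/-- The origin is fixed, since the solutions from nearby points stay in arbitrarily small
neighbourhoods. -/
lemma IsEmbeddingField.map_zero {k : WithTop ℕ∞} {X F : (Fin n → ℝ) → (Fin n → ℝ)}
    (h : IsEmbeddingField k X F) : F 0 = 0 := by
  by_contra hne
  obtain ⟨γ, -, h1, hγ⟩ := (h.eventually_curve (isOpen_ne.mem_nhds (Ne.symm hne))).self_of_nhds
  exact (hγ 1 (by simp)).1 h1

/-- The origin is an equilibrium of an embedding vector field: otherwise the vector field would
push the solution from `0` to `F 0 = 0` away from `0`. -/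
lemma IsEmbeddingField.field_zero {k : WithTop ℕ∞} {X F : (Fin n → ℝ) → (Fin n → ℝ)}
    (h : IsEmbeddingField k X F) : X 0 = 0 := by
  rw [← norm_le_zero_iff]
  refine le_of_forall_pos_le_add fun ε hε => ?_
  have hU : ∀ᶠ a in 𝓝 (0 : Fin n → ℝ), ‖X a - X 0‖ ≤ ε := by
    filter_upwards [h.contDiffAt.continuousAt.eventually (Metric.ball_mem_nhds (X 0) hε)] with a ha
    exact (mem_ball_iff_norm.1 ha).le
  obtain ⟨γ, h0, h1, hγ⟩ := (h.eventually_curve hU).self_of_nhds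
  have key := Convex.norm_image_sub_le_of_norm_hasDerivWithin_le (s := Set.Icc (0 : ℝ) 1)
    (f := fun t => γ t - t • X 0) (f' := fun t => X (γ t) - (1 : ℝ) • X 0) (C := ε)
    (fun t ht => (hγ t ht).2.sub ((hasDerivWithinAt_id t _).smul_const _))
    (fun t ht => by rw [one_smul]; exact (hγ t ht).1) (convex_Icc 0 1)
    (x := 0) (y := 1) (by simp) (by simp)
  simpa [h0, h1, h.map_zero] using key

lemma HasLinearPart.hasStrictFDerivAt {X : (Fin n → ℝ) → (Fin n → ℝ)}
    {B : Matrix (Fin n) (Fin n) ℝ} (hX : HasLinearPart X B) {k : WithTop ℕ∞}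
    (hC : ContDiffAt ℝ k X 0) (hk : k ≠ 0) :
    HasStrictFDerivAt X (LinearMap.toContinuousLinearMap (Matrix.mulVecLin B)) 0 :=
  hC.hasStrictFDerivAt' hX hk

/-- The linear part of the time one map is the exponential of that of the vector field. -/
lemma IsEmbeddingField.isLittleO_sub_linFlow {k : WithTop ℕ∞} {X F : (Fin n → ℝ) → (Fin n → ℝ)}
    {B : Matrix (Fin n) (Fin n) ℝ} (h : IsEmbeddingField k X F) (hX : HasLinearPart X B) :
    (fun x => F x - (linFlow B 1).mulVec x) =o[𝓝 0] fun x : Fin n → ℝ => ‖x‖ := by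
  refine Asymptotics.isLittleO_iff.2 fun ε hε => ?_
  obtain ⟨U, hU, hU'⟩ := exists_nhds_norm_curve_sub_linFlow_le hX h.field_zero hε
  filter_upwards [h.eventually_curve hU] with x ⟨γ, h0, h1, hγ⟩
  simpa [h0, h1] using hU' γ hγ 1 (by simp)

/-- If `Y - X` is a homogeneous field `P` of degree `d` up to higher order, then the difference of the
time one maps is `exp B` applied to the average of `P` up to higher order. -/
lemma IsEmbeddingField.isLittleO_sub_sub_flowAverage {k l : WithTop ℕ∞}
    {X Y F G P : (Fin n → ℝ) → (Fin n → ℝ)} {B : Matrix (Fin n) (Fin n) ℝ} {d : ℕ}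
    (h : IsEmbeddingField k X F) (h' : IsEmbeddingField l Y G) (hk : k ≠ 0)
    (hX : HasLinearPart X B) (hY : HasLinearPart Y B) (hd : d ≠ 0)
    (hP : Continuous P) (hPd : ∀ (c : ℝ) x, P (c • x) = c ^ d • P x)
    (hYX : (fun x => Y x - X x - P x) =o[𝓝 0] fun x => ‖x‖ ^ d) :
    (fun x => G x - F x - (linFlow B 1).mulVec (flowAverage B P x)) =o[𝓝 0]
      fun x : Fin n → ℝ => ‖x‖ ^ d := by
  refine Asymptotics.isLittleO_iff.2 fun ε hε => ?_
  obtain ⟨U, hU, hU'⟩ := exists_nhds_norm_curve_sub_curve_le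
    (hX.hasStrictFDerivAt h.contDiffAt hk) hY h'.field_zero hd hP hPd hYX hε
  filter_upwards [h.eventually_curve hU, h'.eventually_curve hU] with x ⟨γ, h0, h1, hγ⟩
    ⟨σ, h0', h1', hσ⟩
  simpa [h0, h1, h0', h1'] using hU' γ σ hγ hσ (h0.trans h0'.symm)

end

/-! ### Uniqueness in the Poincaré domain -/

section
variable {n : ℕ}

/-- Uniqueness of solutions on `[0, b]`. -/
lemma eqOn_of_hasDerivWithinAt_field {E : Type*} [NormedAddCommGroup E] [NormedSpace ℝ E]
    {Y : E → E} {K : NNReal} {s : Set E} (hY : LipschitzOnWith K Y s) {b : ℝ} {γ σ : ℝ → E}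
    (hγ : ∀ t ∈ Set.Icc 0 b, γ t ∈ s ∧ HasDerivWithinAt γ (Y (γ t)) (Set.Icc 0 b) t)
    (hσ : ∀ t ∈ Set.Icc 0 b, σ t ∈ s ∧ HasDerivWithinAt σ (Y (σ t)) (Set.Icc 0 b) t)
    (h0 : γ 0 = σ 0) : Set.EqOn γ σ (Set.Icc 0 b) := by
  have hR : ∀ τ : ℝ → E,
      (∀ t ∈ Set.Icc 0 b, τ t ∈ s ∧ HasDerivWithinAt τ (Y (τ t)) (Set.Icc 0 b) t) →
      ∀ t ∈ Set.Ico 0 b, HasDerivWithinAt τ (Y (τ t)) (Set.Ici t) t := fun τ hτ t ht =>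
    (hτ t ⟨ht.1, ht.2.le⟩).2.mono_of_mem_nhdsWithin (Icc_mem_nhdsGE_of_mem ht)
  exact ODE_solution_unique_of_mem_Icc_right (v := fun _ => Y) (s := fun _ => s) (K := K)
    (fun _ _ => hY)
    (fun t ht => (hγ t ht).2.continuousWithinAt) (hR γ hγ) (fun t ht => (hγ t ⟨ht.1, ht.2.le⟩).1)
    (fun t ht => (hσ t ht).2.continuousWithinAt) (hR σ hσ) (fun t ht => (hσ t ⟨ht.1, ht.2.le⟩).1)
    h0

/-- An embedding vector field `Y` is invariant under the map `F` that it embeds, since `F` commutes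
with the local flow of `Y`. -/
lemma IsEmbeddingField.eventually_fderiv_apply {k : WithTop ℕ∞}
    {Y F : (Fin n → ℝ) → (Fin n → ℝ)} (h : IsEmbeddingField k Y F) (hk : 1 ≤ k)
    (hF : Differentiable ℝ F) :
    ∀ᶠ x in 𝓝 (0 : Fin n → ℝ), fderiv ℝ F x (Y x) = Y (F x) := by
  obtain ⟨K, U, hU, hL⟩ := (h.contDiffAt.of_le hk).exists_lipschitzOnWith
  have hV := h.eventually_curve hU
  have hFV : Filter.Tendsto F (𝓝 0) (𝓝 0) := by
    have := hF.continuous.tendsto 0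
    rwa [h.map_zero] at this
  filter_upwards [hFV.eventually hV, h.eventually_curve (Filter.inter_mem hU hV)]
    with x ⟨σ, hσ0, hσ1, hσ⟩ ⟨γ, hγ0, hγ1, hγ⟩
  -- the solution issuing from `γ s` is first `γ` itself and then the solution issuing from `F x`
  have key : ∀ s ∈ Set.Icc (0 : ℝ) 1, F (γ s) = σ s := by
    intro s hs
    obtain ⟨τ, hτ0, hτ1, hτ⟩ := (hγ s hs).1.2
    have e1 : Set.EqOn τ (fun t => γ (t + s)) (Set.Icc 0 (1 - s)) := by
      refine eqOn_of_hasDerivWithinAt_field hL (fun t ht => ?_) (fun t ht => ?_) (by simp [hτ0])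
      · have ht' : t ∈ Set.Icc (0 : ℝ) 1 := ⟨ht.1, by linarith [ht.2, hs.1]⟩
        exact ⟨(hτ t ht').1, (hτ t ht').2.mono (Set.Icc_subset_Icc_right (by linarith [hs.1]))⟩
      · have ht' : t + s ∈ Set.Icc (0 : ℝ) 1 := ⟨by linarith [ht.1, hs.1], by linarith [ht.2]⟩
        refine ⟨(hγ _ ht').1.1, ?_⟩
        have := (hγ _ ht').2.scomp t (g₁ := γ) (h := fun t => t + s) (s := Set.Icc 0 (1 - s))
          ((hasDerivWithinAt_id t _).add_const s)
          (fun u hu => ⟨by linarith [hu.1, hs.1], by linarith [hu.2]⟩)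
        rw [one_smul] at this
        exact this
    have e2 : Set.EqOn (fun t => τ (t + (1 - s))) σ (Set.Icc 0 s) := by
      refine eqOn_of_hasDerivWithinAt_field hL (fun t ht => ?_) (fun t ht => ?_) ?_
      · have ht' : t + (1 - s) ∈ Set.Icc (0 : ℝ) 1 :=
          ⟨by linarith [ht.1, hs.2], by linarith [ht.2]⟩
        refine ⟨(hτ _ ht').1, ?_⟩
        have := (hτ _ ht').2.scomp t (g₁ := τ) (h := fun t => t + (1 - s)) (s := Set.Icc 0 s)
          ((hasDerivWithinAt_id t _).add_const _)
          (fun u hu => ⟨by linarith [hu.1, hs.2], by linarith [hu.2]⟩)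
        rw [one_smul] at this
        exact this
      · have ht' : t ∈ Set.Icc (0 : ℝ) 1 := ⟨ht.1, by linarith [ht.2, hs.2]⟩
        exact ⟨(hσ t ht').1, (hσ t ht').2.mono (Set.Icc_subset_Icc_right hs.2)⟩
      · have := e1 (x := 1 - s) ⟨by linarith [hs.2], le_rfl⟩
        simpa [hγ1, hσ0] using this
    have := e2 (x := s) ⟨hs.1, le_rfl⟩
    simp only [add_sub_cancel] at this
    rw [← this, hτ1]
  have h01 : (0 : ℝ) ∈ Set.Icc (0 : ℝ) 1 := by simp
  have d1 : HasDerivWithinAt (F ∘ γ) (fderiv ℝ F x (Y x)) (Set.Icc 0 1) 0 := by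
    have := (hF (γ 0)).hasFDerivAt.comp_hasDerivWithinAt 0 (hγ 0 h01).2
    rwa [hγ0] at this
  have d2 : HasDerivWithinAt (F ∘ γ) (Y (F x)) (Set.Icc 0 1) 0 := by
    have := (hσ 0 h01).2.congr (fun s hs => key s hs) (key 0 h01)
    rwa [hσ0] at this
  exact (uniqueDiffOn_Icc zero_lt_one 0 h01).eq_deriv _ d1 d2

/-- A flat map that is bounded by a multiple of its composition with a contraction vanishes. -/
lemma eventually_eq_zero_of_contraction {E F : Type*} [NormedAddCommGroup E] [NormedSpace ℝ E]
    [NormedAddCommGroup F] {Z : E → F} {G : E → E} {C : E →L[ℝ] E} {k : ℕ} {K : ℝ}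
    (hG0 : G 0 = 0) (hG : HasFDerivAt G C 0) (hC : ‖C ^ k‖ < 1)
    (hZ : ∀ᶠ x in 𝓝 (0 : E), ‖Z x‖ ≤ K * ‖Z (G x)‖)
    (hflat : ∀ N : ℕ, Z =O[𝓝 0] fun x => ‖x‖ ^ N) : ∀ᶠ x in 𝓝 (0 : E), Z x = 0 := by
  obtain ⟨ρ, hρ, hρ1⟩ := exists_between hC
  have hρ0 : 0 < ρ := (norm_nonneg _).trans_lt hρ
  set L : ℝ := max K 0 with hL
  have hL0 : 0 ≤ L := le_max_right _ _
  have hZL : ∀ᶠ x in 𝓝 (0 : E), ‖Z x‖ ≤ L * ‖Z (G x)‖ := by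
    filter_upwards [hZ] with x hx
    exact hx.trans (by gcongr; exact le_max_left _ _)
  -- the `k`-th iterate contracts by the factor `ρ`, at the cost of the constant `L ^ k`; the order
  -- `N` of flatness is chosen such that `ρ ^ N` beats it
  have hit0 : ∀ j, G^[j] 0 = 0 := fun j => Function.iterate_fixed hG0 j
  have hitD : ∀ j, HasFDerivAt (G^[j]) (C ^ j) 0 := fun j => hG.iterate hG0 j
  have hit : ∀ j, ∀ᶠ x in 𝓝 (0 : E), ‖Z x‖ ≤ L ^ j * ‖Z (G^[j] x)‖ := by
    intro j
    induction j with
    | zero => simp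
    | succ j ih =>
      have ht : Filter.Tendsto (G^[j]) (𝓝 0) (𝓝 0) := by
        have := (hitD j).continuousAt.tendsto
        rwa [hit0] at this
      filter_upwards [ih, ht.eventually hZL] with x h1 h2
      rw [Function.iterate_succ_apply', pow_succ, mul_assoc]
      exact h1.trans (by gcongr)
  have hH : ∀ᶠ x in 𝓝 (0 : E), ‖G^[k] x‖ ≤ ρ * ‖x‖ := by
    have h1 := (hitD k).isLittleO.def (sub_pos.2 hρ)
    filter_upwards [h1] with x hx
    simp only [hit0, sub_zero] at hx
    have h2 := norm_le_norm_add_norm_sub' (G^[k] x) ((C ^ k) x)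
    have h3 := (C ^ k).le_opNorm x
    nlinarith
  obtain ⟨N, hN⟩ : ∃ N : ℕ, L ^ k * ρ ^ N < 1 := by
    have h1 : Filter.Tendsto (fun N : ℕ => L ^ k * ρ ^ N) Filter.atTop (𝓝 (L ^ k * 0)) :=
      (tendsto_pow_atTop_nhds_zero_of_lt_one hρ0.le hρ1).const_mul _
    rw [mul_zero] at h1
    exact (h1.eventually_lt_const one_pos).exists
  obtain ⟨c, hc⟩ := (hflat N).bound
  obtain ⟨r, hr, hball⟩ := Metric.eventually_nhds_iff_ball.1 ((hit k).and (hH.and hc))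
  filter_upwards [Metric.ball_mem_nhds 0 hr] with x hx
  have hmem : ∀ j, ‖(G^[k])^[j] x‖ ≤ ρ ^ j * ‖x‖ ∧ (G^[k])^[j] x ∈ Metric.ball (0 : E) r := by
    intro j
    induction j with
    | zero => simpa using hx
    | succ j ih =>
      rw [Function.iterate_succ_apply']
      have h1 : ‖G^[k] ((G^[k])^[j] x)‖ ≤ ρ ^ (j + 1) * ‖x‖ :=
        ((hball _ ih.2).2.1).trans (by rw [pow_succ', mul_assoc]; gcongr; exact ih.1)
      refine ⟨h1, mem_ball_zero_iff.2 (h1.trans_lt ?_)⟩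
      exact (mul_le_of_le_one_left (norm_nonneg _) (pow_le_one₀ hρ0.le hρ1.le)).trans_lt
        (mem_ball_zero_iff.1 hx)
  have hZj : ∀ j, ‖Z x‖ ≤ (L ^ k) ^ j * ‖Z ((G^[k])^[j] x)‖ := by
    intro j
    induction j with
    | zero => simp
    | succ j ih =>
      rw [Function.iterate_succ_apply', pow_succ, mul_assoc]
      exact ih.trans (by gcongr; exact (hball _ (hmem j).2).1)
  have hfin : ∀ j, ‖Z x‖ ≤ (L ^ k * ρ ^ N) ^ j * (|c| * ‖x‖ ^ N) := by
    intro j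
    refine (hZj j).trans ?_
    have h1 := (hball _ (hmem j).2).2.2
    rw [norm_pow, norm_norm] at h1
    calc _ ≤ (L ^ k) ^ j * (|c| * (ρ ^ j * ‖x‖) ^ N) := by
          gcongr
          refine h1.trans ?_
          gcongr
          · exact le_abs_self c
          · exact (hmem j).1
      _ = _ := by rw [mul_pow, mul_pow, ← pow_mul, ← pow_mul, ← pow_mul, mul_comm j N]; ring
  have hlim : Filter.Tendsto (fun j : ℕ => (L ^ k * ρ ^ N) ^ j * (|c| * ‖x‖ ^ N)) Filter.atTop
      (𝓝 (0 * (|c| * ‖x‖ ^ N))) :=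
    (tendsto_pow_atTop_nhds_zero_of_lt_one (by positivity) hN).mul_const _
  rw [zero_mul] at hlim
  exact norm_le_zero_iff.1 (ge_of_tendsto' hlim hfin)

section
attribute [local instance] Matrix.linftyOpNormedRing Matrix.linftyOpNormedAlgebra

/-- A real matrix all of whose complex eigenvalues have modulus less than `1` has a power that is
a contraction. -/
lemma exists_norm_pow_lt_one {A : Matrix (Fin n) (Fin n) ℝ}
    (hA : ∀ z : ℂ, (complexify A).charpoly.IsRoot z → ‖z‖ < 1) :
    ∃ k, ‖(LinearMap.toContinuousLinearMap (Matrix.mulVecLin A)) ^ k‖ < 1 := by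
  -- for `n = 0` the matrix ring is trivial, and the spectral radius formula does not apply
  rcases isEmpty_or_nonempty (Fin n) with hn | hn
  · exact ⟨1, by rw [Subsingleton.elim ((LinearMap.toContinuousLinearMap _) ^ 1) 0]; simp⟩
  have hr : spectralRadius ℂ (complexify A) < 1 := by
    refine spectrum.spectralRadius_lt_of_forall_lt (r := 1) _ fun z hz => ?_
    exact hA z (Matrix.mem_spectrum_iff_isRoot_charpoly.1 hz)
  obtain ⟨k, hk, hk0⟩ := (((spectrum.pow_nnnorm_pow_one_div_tendsto_nhds_spectralRadius
    (complexify A)).eventually_lt_const hr).and (Filter.eventually_gt_atTop 0)).exists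
  have hk1 : ‖(complexify A) ^ k‖ < 1 := by
    by_contra! hcon
    refine hk.not_ge (ENNReal.one_le_rpow ?_ (by positivity))
    exact_mod_cast hcon
  refine ⟨k, lt_of_le_of_lt (ContinuousLinearMap.opNorm_le_bound _ (norm_nonneg _) fun x => ?_) hk1⟩
  have hpow : ∀ (j : ℕ) (x : Fin n → ℝ),
      ((LinearMap.toContinuousLinearMap (Matrix.mulVecLin A)) ^ j) x = (A ^ j).mulVec x := by
    intro j x
    induction j with
    | zero => simp
    | succ j ih =>
      rw [pow_succ', pow_succ', ← Matrix.mulVec_mulVec, ← ih]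
      rfl
  -- the row sum norm does not change under complexification
  have hnorm : ‖A ^ k‖ = ‖(complexify A) ^ k‖ := by
    rw [complexify, ← Matrix.map_pow, Matrix.linfty_opNorm_def, Matrix.linfty_opNorm_def]
    simp
  rw [hpow, ← hnorm]
  exact Matrix.linfty_opNorm_mulVec _ _
end

/-- The eigenvalues of the inverse matrix are the inverses of the eigenvalues. -/
lemma norm_lt_one_of_isRoot_charpoly_inv {A A' : Matrix (Fin n) (Fin n) ℝ} (hAA' : A * A' = 1)
    (hA : ∀ z : ℂ, (complexify A).charpoly.IsRoot z → 1 < ‖z‖) (z : ℂ)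
    (hz : (complexify A').charpoly.IsRoot z) : ‖z‖ < 1 := by
  have h1 : complexify A * complexify A' = 1 := by
    rw [complexify, complexify, ← Matrix.map_mul, hAA']
    simp
  have h2 : complexify A' * complexify A = 1 := mul_eq_one_comm.1 h1
  let u : (Matrix (Fin n) (Fin n) ℂ)ˣ := ⟨complexify A, complexify A', h1, h2⟩
  have hz' : z ∈ spectrum ℂ (↑u⁻¹ : Matrix (Fin n) (Fin n) ℂ) :=
    Matrix.mem_spectrum_iff_isRoot_charpoly.2 hz
  have hz0 : z ≠ 0 := by
    rintro rfl
    exact spectrum.zero_notMem ℂ u⁻¹.isUnit hz'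
  have h3 : z⁻¹ ∈ spectrum ℂ (complexify A) := (spectrum.inv₀_mem_iff (a := u)).2 hz'
  have h4 := hA _ (Matrix.mem_spectrum_iff_isRoot_charpoly.1 h3)
  rw [norm_inv] at h4
  exact (one_lt_inv₀ (norm_pos_iff.2 hz0)).1 h4

lemma inPoincareDomain_cases {A A' : Matrix (Fin n) (Fin n) ℝ} (hAA' : A * A' = 1)
    (hA : InPoincareDomain A) :
    (∃ k, ‖(LinearMap.toContinuousLinearMap (Matrix.mulVecLin A)) ^ k‖ < 1) ∨
    (∃ k, ‖(LinearMap.toContinuousLinearMap (Matrix.mulVecLin A')) ^ k‖ < 1) :=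
  hA.imp exists_norm_pow_lt_one fun h =>
    exists_norm_pow_lt_one (norm_lt_one_of_isRoot_charpoly_inv hAA' h)

/-- In the Poincaré domain, two embedding vector fields of the same map that agree to infinite
order coincide: their difference is invariant under the map, and `F` or its inverse contracts. -/
lemma eventually_eq_of_isEmbeddingField_of_flat {k l : WithTop ℕ∞}
    {X Y F : (Fin n → ℝ) → (Fin n → ℝ)} {A A' : Matrix (Fin n) (Fin n) ℝ}
    (hAA' : A * A' = 1) (hA : InPoincareDomain A) (hF : ContDiff ℝ 1 F) (hFA : HasLinearPart F A)
    (hX : IsEmbeddingField k X F) (hY : IsEmbeddingField l Y F) (hk : 1 ≤ k) (hl : 1 ≤ l)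
    (hflat : ∀ N : ℕ, (fun x => Y x - X x) =O[𝓝 0] fun x : Fin n → ℝ => ‖x‖ ^ N) :
    Y =ᶠ[𝓝 0] X := by
  have hFd : Differentiable ℝ F := hF.differentiable one_ne_zero
  set Z : (Fin n → ℝ) → Fin n → ℝ := fun x => Y x - X x with hZ
  have hinv : ∀ᶠ x in 𝓝 (0 : Fin n → ℝ), fderiv ℝ F x (Z x) = Z (F x) := by
    filter_upwards [hX.eventually_fderiv_apply hk hFd, hY.eventually_fderiv_apply hl hFd]
      with x h1 h2
    simp only [hZ, map_sub, h1, h2]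
  set C := LinearMap.toContinuousLinearMap (Matrix.mulVecLin A) with hC
  set C' := LinearMap.toContinuousLinearMap (Matrix.mulVecLin A') with hC'
  have hC'C : ∀ x, C' (C x) = x := fun x => by
    simp [hC, hC', Matrix.mulVec_mulVec, mul_eq_one_comm.1 hAA']
  have hCC' : ∀ x, C (C' x) = x := fun x => by
    simp [hC, hC', Matrix.mulVec_mulVec, hAA']
  have hstrict : HasStrictFDerivAt F C 0 := hF.contDiffAt.hasStrictFDerivAt' hFA one_ne_zero
  have hcont : Filter.Tendsto (fderiv ℝ F) (𝓝 0) (𝓝 C) := by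
    have := (hF.continuous_fderiv one_ne_zero).tendsto 0
    rwa [hstrict.hasFDerivAt.fderiv] at this
  suffices h : ∀ᶠ x in 𝓝 (0 : Fin n → ℝ), Z x = 0 by
    filter_upwards [h] with x hx
    exact sub_eq_zero.1 hx
  rcases inPoincareDomain_cases hAA' hA with ⟨j, hj⟩ | ⟨j, hj⟩
  -- `F` contracts, and its derivative near `0` is bounded below as it is close to `C`
  · refine eventually_eq_zero_of_contraction (K := 2 * (‖C'‖ + 1)) hX.map_zero
      hstrict.hasFDerivAt hj ?_ hflat
    have hε : 0 < (2 * (‖C'‖ + 1))⁻¹ := by positivity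
    filter_upwards [hinv, hcont.eventually (Metric.ball_mem_nhds C hε)] with x h1 h2
    rw [← h1]
    have e1 : ‖Z x‖ ≤ ‖C'‖ * ‖C (Z x)‖ := by
      conv_lhs => rw [← hC'C (Z x)]
      exact C'.le_opNorm _
    have e2 : ‖C (Z x)‖ ≤ ‖fderiv ℝ F x (Z x)‖ + (2 * (‖C'‖ + 1))⁻¹ * ‖Z x‖ := by
      have := norm_le_norm_add_norm_sub' (C (Z x)) (fderiv ℝ F x (Z x))
      have e3 := (C - fderiv ℝ F x).le_opNorm (Z x)
      rw [sub_apply] at e3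
      have e4 : ‖C - fderiv ℝ F x‖ ≤ (2 * (‖C'‖ + 1))⁻¹ := by
        rw [norm_sub_rev]; exact (mem_ball_iff_norm.1 h2).le
      nlinarith [norm_nonneg (Z x)]
    have e5 : (‖C'‖ + 1) * ((2 * (‖C'‖ + 1))⁻¹ * ‖Z x‖) = ‖Z x‖ / 2 := by
      field_simp
    have e6 : ‖Z x‖ ≤ (‖C'‖ + 1) * (‖fderiv ℝ F x (Z x)‖ + (2 * (‖C'‖ + 1))⁻¹ * ‖Z x‖) :=
      e1.trans (by gcongr; linarith)
    rw [mul_add, e5] at e6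
    linarith
  -- the local inverse of `F` contracts
  · let e : (Fin n → ℝ) ≃L[ℝ] (Fin n → ℝ) := ContinuousLinearEquiv.equivOfInverse C C' hC'C hCC'
    have hs : HasStrictFDerivAt F (e : (Fin n → ℝ) →L[ℝ] (Fin n → ℝ)) 0 := hstrict
    set G := hs.localInverse with hG
    have hG0 : G 0 = 0 := by
      have := hs.localInverse_apply_image
      rwa [hX.map_zero] at this
    have hGd : HasFDerivAt G C' 0 := by
      have := hs.to_localInverse.hasFDerivAt
      rwa [hX.map_zero] at this
    have hGr : ∀ᶠ y in 𝓝 (0 : Fin n → ℝ), F (G y) = y := by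
      have := hs.eventually_right_inverse
      rwa [hX.map_zero] at this
    have hGt : Filter.Tendsto G (𝓝 0) (𝓝 0) := by
      have := hGd.continuousAt.tendsto
      rwa [hG0] at this
    refine eventually_eq_zero_of_contraction (K := ‖C‖ + 1) hG0 hGd hj ?_ hflat
    filter_upwards [hGr, hGt.eventually hinv,
      (hcont.comp hGt).eventually (Metric.ball_mem_nhds C one_pos)] with y h1 h2 h3
    rw [h1] at h2
    rw [← h2]
    refine ((fderiv ℝ F (G y)).le_opNorm _).trans ?_
    gcongr
    have := norm_le_norm_add_norm_sub' (fderiv ℝ F (G y)) C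
    have h4 := mem_ball_iff_norm.1 h3
    simp only [Function.comp_apply] at h4
    linarith

end

/-! ### Generalized eigenbases -/

section
variable {n : ℕ}

lemma sub_scalar_pow_mulVec (M : Matrix (Fin n) (Fin n) ℂ) (c : ℂ) (N : ℕ) (u : Fin n → ℂ) :
    ((M - Matrix.scalar (Fin n) c) ^ N).mulVec u = ((Matrix.toLin' M - c • 1) ^ N) u := by
  have h : Matrix.toLin' M - c • 1 = Matrix.toLin' (M - Matrix.scalar (Fin n) c) := by
    rw [map_sub, sub_right_inj, Matrix.scalar_apply, ← Matrix.smul_one_eq_diagonal, map_smul,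
      Matrix.toLin'_one]
    rfl
  rw [h, ← Matrix.toLin'_pow, Matrix.toLin'_apply]

lemma mem_maxGenEigenspace_iff_matrix (M : Matrix (Fin n) (Fin n) ℂ) (c : ℂ) (u : Fin n → ℂ) :
    u ∈ Module.End.maxGenEigenspace (Matrix.toLin' M) c ↔
      ∃ N, ((M - Matrix.scalar (Fin n) c) ^ N).mulVec u = 0 := by
  simp only [Module.End.mem_maxGenEigenspace, sub_scalar_pow_mulVec]

lemma pow_mulVec_eq_zero_of_mem_maxGenEigenspace {M : Matrix (Fin n) (Fin n) ℂ} {c : ℂ}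
    {u : Fin n → ℂ} (h : u ∈ Module.End.maxGenEigenspace (Matrix.toLin' M) c) :
    ((M - Matrix.scalar (Fin n) c) ^ n).mulVec u = 0 := by
  rw [Module.End.maxGenEigenspace_eq_genEigenspace_finrank, Module.End.mem_genEigenspace_nat,
    LinearMap.mem_ker, Module.finrank_fin_fun] at h
  rwa [sub_scalar_pow_mulVec]

variable {M : Matrix (Fin n) (Fin n) ℝ} {P : Matrix (Fin n) (Fin n) ℂ} {lam : Fin n → ℂ}

lemma IsGenEigenbasis.mem_maxGenEigenspace (h : IsGenEigenbasis M P lam) (i : Fin n) :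
    P.col i ∈ Module.End.maxGenEigenspace (Matrix.toLin' (complexify M)) (lam i) :=
  (mem_maxGenEigenspace_iff_matrix _ _ _).2 ⟨n, h.2 i⟩

lemma IsGenEigenbasis.mul_inv (h : IsGenEigenbasis M P lam) : P * P⁻¹ = 1 :=
  Matrix.mul_nonsing_inv P h.1

lemma IsGenEigenbasis.inv_mul (h : IsGenEigenbasis M P lam) : P⁻¹ * P = 1 :=
  Matrix.nonsing_inv_mul P h.1

/-- A generalized eigenvector for the eigenvalue `c` only involves the basis vectors that belong to
the same eigenvalue. -/
lemma IsGenEigenbasis.inv_mulVec_eq_zero (h : IsGenEigenbasis M P lam) {c : ℂ} {N : ℕ}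
    {u : Fin n → ℂ} (hu : ((complexify M - Matrix.scalar (Fin n) c) ^ N).mulVec u = 0) {i : Fin n}
    (hi : lam i ≠ c) : (P⁻¹.mulVec u) i = 0 := by
  classical
  set f := Matrix.toLin' (complexify M) with hf
  set w := P⁻¹.mulVec u with hw
  have hu' : u ∈ Module.End.maxGenEigenspace f c := (mem_maxGenEigenspace_iff_matrix _ _ _).2 ⟨N, hu⟩
  have hPw : P.mulVec w = u := by
    rw [hw, Matrix.mulVec_mulVec, h.mul_inv, Matrix.one_mulVec]
  -- splitting `u` into its parts for the eigenvalue `c` and for the other ones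
  set w₁ : Fin n → ℂ := fun i => if lam i = c then w i else 0 with hw₁
  set w₂ : Fin n → ℂ := fun i => if lam i = c then 0 else w i with hw₂
  have hw12 : w₁ + w₂ = w := by
    ext j; simp only [hw₁, hw₂, Pi.add_apply]; split_ifs <;> simp
  have hsum : ∀ w : Fin n → ℂ, P.mulVec w = ∑ j, w j • P.col j := fun w => by
    ext r; simp [Matrix.mulVec, dotProduct, mul_comm]
  have h1 : P.mulVec w₁ ∈ Module.End.maxGenEigenspace f c := by
    rw [hsum]
    refine Submodule.sum_mem _ fun j _ => ?_
    by_cases hj : lam j = c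
    · exact Submodule.smul_mem _ _ (hj ▸ h.mem_maxGenEigenspace j)
    · simp [hw₁, hj]
  have h2 : P.mulVec w₂ ∈ ⨆ d, ⨆ (_ : d ≠ c), Module.End.maxGenEigenspace f d := by
    rw [hsum]
    refine Submodule.sum_mem _ fun j _ => ?_
    by_cases hj : lam j = c
    · simp [hw₂, hj]
    · exact Submodule.smul_mem _ _
        (Submodule.mem_iSup_of_mem (lam j) (Submodule.mem_iSup_of_mem hj (h.mem_maxGenEigenspace j)))
  have h2' : P.mulVec w₂ ∈ Module.End.maxGenEigenspace f c := by
    have : P.mulVec w₂ = u - P.mulVec w₁ := by rw [← hPw, ← hw12, Matrix.mulVec_add]; abel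
    rw [this]
    exact Submodule.sub_mem _ hu' h1
  have h3 : P.mulVec w₂ = 0 :=
    Submodule.disjoint_def.1 (Module.End.independent_maxGenEigenspace f c) _ h2' h2
  have h4 : w₂ = 0 := by
    have := congrArg P⁻¹.mulVec h3
    rwa [Matrix.mulVec_mulVec, h.inv_mul, Matrix.one_mulVec, Matrix.mulVec_zero] at this
  simpa [hw₂, hi] using congrFun h4 i

lemma exists_isGenEigenbasis (M : Matrix (Fin n) (Fin n) ℝ) :
    ∃ P lam, IsGenEigenbasis M P lam := by
  set f := Matrix.toLin' (complexify M) with hf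
  set S : Set (Fin n → ℂ) := {v | ∃ c, v ∈ Module.End.maxGenEigenspace f c} with hS
  have hspan : Submodule.span ℂ S = ⊤ := by
    rw [eq_top_iff, ← Module.End.iSup_maxGenEigenspace_eq_top f, iSup_le_iff]
    exact fun c v hv => Submodule.subset_span ⟨c, hv⟩
  obtain ⟨T, hTS, hTspan, hT⟩ := exists_linearIndependent ℂ S
  let b : Module.Basis T ℂ (Fin n → ℂ) := Module.Basis.mk hT (by simp [hTspan, hspan])
  let b' := b.reindex (b.indexEquiv (Pi.basisFun ℂ (Fin n)))
  have hb' : ∀ i, b' i ∈ S := fun i => by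
    simp only [b', b, Module.Basis.reindex_apply, Module.Basis.mk_apply]
    exact hTS (Subtype.mem _)
  choose lam hlam using hb'
  refine ⟨(Pi.basisFun ℂ (Fin n)).toMatrix b', lam, ?_, fun i => ?_⟩
  · exact (Pi.basisFun ℂ (Fin n)).isUnit_det b'
  · exact pow_mulVec_eq_zero_of_mem_maxGenEigenspace (hlam i)

/-- The eigenvalues attached to a basis of generalized eigenvectors are the eigenvalues of the
matrix with their algebraic multiplicities. -/
lemma IsGenEigenbasis.isEigenvalueTuple (h : IsGenEigenbasis M P lam) :
    IsEigenvalueTuple M lam := by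
  classical
  have hroots : (complexify M).charpoly.roots = Finset.univ.val.map lam := by
    ext c
    rw [Polynomial.count_roots, ← Matrix.charpoly_toLin', ← LinearMap.finrank_maxGenEigenspace_eq,
      Multiset.count_map]
    have hind : LinearIndependent ℂ P.col :=
      Matrix.linearIndependent_cols_iff_isUnit.2 ((Matrix.isUnit_iff_isUnit_det P).2 h.1)
    have hspan : Module.End.maxGenEigenspace (Matrix.toLin' (complexify M)) c =
        Submodule.span ℂ (Set.range fun i : {i // lam i = c} => P.col i) := by
      refine le_antisymm (fun u hu => ?_) ?_
      · obtain ⟨N, hN⟩ := (mem_maxGenEigenspace_iff_matrix _ _ _).1 hu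
        have hu' : u = ∑ j, (P⁻¹.mulVec u) j • P.col j := by
          have : u = P.mulVec (P⁻¹.mulVec u) := by
            rw [Matrix.mulVec_mulVec, h.mul_inv, Matrix.one_mulVec]
          conv_lhs => rw [this]
          ext r; simp [Matrix.mulVec, dotProduct, mul_comm]
        rw [hu']
        refine Submodule.sum_mem _ fun j _ => ?_
        by_cases hj : lam j = c
        · exact Submodule.smul_mem _ _ (Submodule.subset_span ⟨⟨j, hj⟩, rfl⟩)
        · rw [h.inv_mulVec_eq_zero hN hj, zero_smul]
          exact Submodule.zero_mem _
      · rw [Submodule.span_le]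
        rintro _ ⟨⟨j, rfl⟩, rfl⟩
        exact h.mem_maxGenEigenspace j
    have hcard := finrank_span_eq_card
      (hind.comp (Subtype.val : {i // lam i = c} → Fin n) Subtype.val_injective)
    rw [hspan, show (fun i : {i // lam i = c} => P.col i) = P.col ∘ Subtype.val from rfl, hcard,
      Fintype.card_subtype]
    simp only [eq_comm]
    rfl
  rw [IsEigenvalueTuple, (IsAlgClosed.splits (complexify M).charpoly).eq_prod_roots_of_monic
    (Matrix.charpoly_monic _), hroots, Multiset.map_map]
  rfl

/-- A matrix commuting with `M` is block diagonal in a basis of generalized eigenvectors of `M`. -/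
lemma IsGenEigenbasis.inv_mul_mul_apply_eq_zero (h : IsGenEigenbasis M P lam)
    {C : Matrix (Fin n) (Fin n) ℂ} (hC : Commute C (complexify M)) {i j : Fin n}
    (hij : lam i ≠ lam j) : (P⁻¹ * C * P) i j = 0 := by
  have h1 : ((complexify M - Matrix.scalar (Fin n) (lam j)) ^ n).mulVec (C.mulVec (P.col j)) = 0 := by
    have hc : Commute C ((complexify M - Matrix.scalar (Fin n) (lam j)) ^ n) :=
      (hC.sub_right (Matrix.scalar_comm _ (fun r => Commute.all _ r) _).symm).pow_right n
    rw [Matrix.mulVec_mulVec, ← hc.eq, ← Matrix.mulVec_mulVec]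
    have := h.2 j
    rw [show P.col j = fun r => P r j from rfl, this, Matrix.mulVec_zero]
  have h2 := h.inv_mulVec_eq_zero h1 hij
  rw [Matrix.mulVec_mulVec] at h2
  simpa [Matrix.mulVec, Matrix.mul_apply, dotProduct] using h2

/-- The basis of dual vectors consists of generalized eigenvectors of the transposed matrix. -/
lemma IsGenEigenbasis.inv_row_vecMul (h : IsGenEigenbasis M P lam) (i : Fin n) :
    Matrix.vecMul (P⁻¹ i) ((complexify M - Matrix.scalar (Fin n) (lam i)) ^ n) = 0 := by
  set C := (complexify M - Matrix.scalar (Fin n) (lam i)) ^ n with hC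
  have hcomm : Commute C (complexify M) :=
    ((Commute.refl (complexify M)).sub_left
      (Matrix.scalar_comm (lam i) (fun r => Commute.all _ r) (complexify M))).pow_left n
  have hrow : ∀ k, (P⁻¹ * C * P) i k = 0 := by
    intro k
    by_cases hik : lam i = lam k
    · have := h.2 k
      rw [← hik] at this
      rw [Matrix.mul_assoc, Matrix.mul_apply]
      refine Finset.sum_eq_zero fun r _ => ?_
      have h2 : (C * P) r k = 0 := congrFun this r
      rw [h2, mul_zero]
    · exact h.inv_mul_mul_apply_eq_zero hcomm hik
  have h3 : P⁻¹ * C = (P⁻¹ * C * P) * P⁻¹ := by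
    rw [Matrix.mul_assoc _ P, h.mul_inv, Matrix.mul_one]
  ext k
  have h4 : (P⁻¹ * C) i k = 0 := by
    rw [h3, Matrix.mul_apply]
    exact Finset.sum_eq_zero fun r _ => by rw [hrow, zero_mul]
  exact h4

section
attribute [local instance] Matrix.linftyOpNormedRing Matrix.linftyOpNormedAlgebra

lemma exp_mulVec_of_mulVec_eq_zero {N : Matrix (Fin n) (Fin n) ℂ} {u : Fin n → ℂ}
    (hu : N.mulVec u = 0) : (NormedSpace.exp N).mulVec u = u := by
  have h : ∀ t : ℝ, HasDerivAt (fun t => (linFlow N t).mulVec u) 0 t := fun t => by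
    have := hasDerivAt_linFlow_mulVec N u t
    rwa [Matrix.mulVec_mulVec, (commute_linFlow N t).eq, ← Matrix.mulVec_mulVec, hu,
      Matrix.mulVec_zero] at this
  have := is_const_of_deriv_eq_zero (fun t => (h t).differentiableAt) (fun t => (h t).deriv) 1 0
  simpa [linFlow] using this

lemma complexify_exp (B : Matrix (Fin n) (Fin n) ℝ) :
    complexify (NormedSpace.exp B) = NormedSpace.exp (complexify B) := by
  have hc : Continuous fun A : Matrix (Fin n) (Fin n) ℝ => complexify A :=
    Continuous.matrix_map continuous_id (continuous_algebraMap ℝ ℂ)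
  exact NormedSpace.map_exp ((algebraMap ℝ ℂ).mapMatrix (m := Fin n)) hc B

lemma exp_sub_scalar (C : Matrix (Fin n) (Fin n) ℂ) (c : ℂ) :
    NormedSpace.exp C - Matrix.scalar (Fin n) (Complex.exp c) =
      Complex.exp c • (NormedSpace.exp (C - Matrix.scalar (Fin n) c) - 1) := by
  have hcomm : Commute (Matrix.scalar (Fin n) c) (C - Matrix.scalar (Fin n) c) :=
    (Matrix.scalar_comm _ (fun r => Commute.all _ r) _)
  have h1 : NormedSpace.exp C = NormedSpace.exp (Matrix.scalar (Fin n) c) *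
      NormedSpace.exp (C - Matrix.scalar (Fin n) c) := by
    rw [← Matrix.exp_add_of_commute _ _ hcomm, add_sub_cancel]
  have h2 : NormedSpace.exp (Matrix.scalar (Fin n) c) = Matrix.scalar (Fin n) (Complex.exp c) := by
    rw [Matrix.scalar_apply, Matrix.exp_diagonal, Matrix.scalar_apply, Pi.exp_def,
      Complex.exp_eq_exp_ℂ]
  rw [h1, h2, smul_sub, Matrix.scalar_apply, ← Matrix.smul_one_eq_diagonal, smul_mul_assoc, one_mul]

/-- Generalized eigenvectors of `B` are generalized eigenvectors of `exp B`. -/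
lemma IsGenEigenbasis.exp {B : Matrix (Fin n) (Fin n) ℝ} {mu : Fin n → ℂ}
    (h : IsGenEigenbasis B P mu) :
    IsGenEigenbasis (NormedSpace.exp B) P (fun i => Complex.exp (mu i)) := by
  refine ⟨h.1, fun i => ?_⟩
  set N := complexify B - Matrix.scalar (Fin n) (mu i) with hN
  set E := NormedSpace.exp N - 1 with hE
  have hcomm : Commute N E := ((Commute.refl N).exp_right).sub_right (Commute.one_right _)
  -- `exp N - 1` kills the kernel of `N`, and so lowers the order of a generalized eigenvector
  have key : ∀ (k : ℕ) (u : Fin n → ℂ), (N ^ k).mulVec u = 0 → (E ^ k).mulVec u = 0 := by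
    intro k
    induction k with
    | zero => intro u hu; simpa using hu
    | succ k ih =>
      intro u hu
      rw [pow_succ, ← Matrix.mulVec_mulVec]
      apply ih
      rw [Matrix.mulVec_mulVec, (hcomm.pow_left k).eq, ← Matrix.mulVec_mulVec, hE,
        Matrix.sub_mulVec, Matrix.one_mulVec, exp_mulVec_of_mulVec_eq_zero, sub_self]
      rw [Matrix.mulVec_mulVec, ← pow_succ', hu]
  rw [complexify_exp, exp_sub_scalar, smul_pow, Matrix.smul_mulVec, key n _ (h.2 i), smul_zero]

end
end

/-! ### Polynomial maps in linear coordinates -/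

section
variable {n : ℕ}
open MvPolynomial

/-- The linear substitution `x_r ↦ ∑ s, Q r s * y_s`. -/
def linSub (Q : Matrix (Fin n) (Fin n) ℂ) :
    MvPolynomial (Fin n) ℂ →ₐ[ℂ] MvPolynomial (Fin n) ℂ :=
  bind₁ fun r => ∑ s, C (Q r s) * X s

lemma linSub_X (Q : Matrix (Fin n) (Fin n) ℂ) (r : Fin n) :
    linSub Q (X r) = ∑ s, C (Q r s) * X s := bind₁_X_right _ _

lemma linSub_linSub (Q R : Matrix (Fin n) (Fin n) ℂ) (p : MvPolynomial (Fin n) ℂ) :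
    linSub R (linSub Q p) = linSub (Q * R) p := by
  have : (linSub R).comp (linSub Q) = linSub (Q * R) := by
    refine algHom_ext fun r => ?_
    simp only [AlgHom.comp_apply, linSub_X, map_sum, map_mul, algHom_C, Finset.mul_sum,
      algebraMap_eq, Matrix.mul_apply, Finset.sum_mul, mul_assoc]
    exact Finset.sum_comm
  exact DFunLike.congr_fun this p

lemma linSub_one (p : MvPolynomial (Fin n) ℂ) : linSub 1 p = p := by
  have : linSub (1 : Matrix (Fin n) (Fin n) ℂ) = AlgHom.id ℂ _ := by
    refine algHom_ext fun r => ?_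
    simp [linSub_X, Matrix.one_apply, ite_mul]
  rw [this, AlgHom.id_apply]

lemma isWeightedHomogeneous_linear {M : Type*} [AddCommMonoid M] {w : Fin n → M} {c : M}
    {a : Fin n → ℂ} (h : ∀ s, a s ≠ 0 → w s = c) :
    IsWeightedHomogeneous w (∑ s, C (a s) * X s : MvPolynomial (Fin n) ℂ) c := by
  refine IsWeightedHomogeneous.sum _ _ _ fun s _ => ?_
  by_cases hs : a s = 0
  · rw [hs, C_0, zero_mul]; exact isWeightedHomogeneous_zero _ _ _
  · exact h s hs ▸ (isWeightedHomogeneous_X ℂ w s).C_mul _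

lemma MvPolynomial.IsWeightedHomogeneous.linSub {M : Type*} [AddCommMonoid M] {w w' : Fin n → M}
    {c : M} {Q : Matrix (Fin n) (Fin n) ℂ} (hQ : ∀ r s, Q r s ≠ 0 → w s = w' r)
    {p : MvPolynomial (Fin n) ℂ} (hp : IsWeightedHomogeneous w' p c) :
    IsWeightedHomogeneous w (linSub Q p) c := by
  rw [_root_.linSub, bind₁, aeval_def, eval₂_eq']
  refine IsWeightedHomogeneous.sum _ _ _ fun m hm => ?_
  rw [algebraMap_eq]
  refine IsWeightedHomogeneous.C_mul ?_ _
  rw [← hp (mem_support_iff.1 hm), Finsupp.weight_apply, Finsupp.sum_fintype _ _ (by simp)]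
  exact IsWeightedHomogeneous.prod _ _ _ fun r _ => (isWeightedHomogeneous_linear (hQ r)).pow _

lemma isHomogeneous_linSub {d : ℕ} (Q : Matrix (Fin n) (Fin n) ℂ) {p : MvPolynomial (Fin n) ℂ}
    (hp : p.IsHomogeneous d) : (linSub Q p).IsHomogeneous d :=
  MvPolynomial.IsWeightedHomogeneous.linSub (fun _ _ _ => rfl) hp

lemma homogeneousComponent_linSub (d : ℕ) (Q : Matrix (Fin n) (Fin n) ℂ)
    (p : MvPolynomial (Fin n) ℂ) :
    homogeneousComponent d (linSub Q p) = linSub Q (homogeneousComponent d p) := by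
  conv_lhs => rw [← sum_homogeneousComponent p]
  rw [map_sum, map_sum]
  simp_rw [homogeneousComponent_of_mem
    (isHomogeneous_linSub Q (homogeneousComponent_isHomogeneous _ p))]
  rw [Finset.sum_ite_eq]
  split_ifs with h
  · rfl
  · rw [homogeneousComponent_eq_zero _ _ (by simpa using h), map_zero]

lemma homogeneousComponent_map {R S : Type*} [CommSemiring R] [CommSemiring S] (f : R →+* S)
    (d : ℕ) (p : MvPolynomial (Fin n) R) :
    homogeneousComponent d (map f p) = map f (homogeneousComponent d p) := by
  ext m
  simp only [coeff_homogeneousComponent, coeff_map]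
  split_ifs <;> simp

/-- The linear vector field `M x`, as a polynomial map. -/
def linPoly {K : Type*} [CommRing K] (M : Matrix (Fin n) (Fin n) K) :
    Fin n → MvPolynomial (Fin n) K := fun i => ∑ j, C (M i j) * X j

/-- The polynomial map `x ↦ M (p x)`. -/
def matPoly {K : Type*} [CommRing K] (M : Matrix (Fin n) (Fin n) K)
    (p : Fin n → MvPolynomial (Fin n) K) : Fin n → MvPolynomial (Fin n) K :=
  fun i => ∑ j, C (M i j) * p j

lemma inCoords_apply (P : Matrix (Fin n) (Fin n) ℂ) (p : PolyVec n) (j : Fin n) :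
    inCoords P p j = ∑ i, C (P⁻¹ j i) * linSub P (map (algebraMap ℝ ℂ) (p i)) := rfl

lemma inCoords_add (P : Matrix (Fin n) (Fin n) ℂ) (p q : PolyVec n) :
    inCoords P (p + q) = inCoords P p + inCoords P q := by
  ext1 j
  simp [inCoords_apply, mul_add, Finset.sum_add_distrib]

lemma inCoords_smul (P : Matrix (Fin n) (Fin n) ℂ) (c : ℝ) (p : PolyVec n) :
    inCoords P (c • p) = (c : ℂ) • inCoords P p := by
  ext1 j
  simp only [inCoords_apply, Pi.smul_apply, Finset.smul_sum, smul_eq_C_mul, map_mul, map_C,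
    algHom_C, algebraMap_eq, Complex.coe_algebraMap]
  exact Finset.sum_congr rfl fun i _ => by ring

/-- The passage to complex coordinates, as a real linear map. -/
def inCoordsₗ (P : Matrix (Fin n) (Fin n) ℂ) :
    PolyVec n →ₗ[ℝ] (Fin n → MvPolynomial (Fin n) ℂ) where
  toFun := inCoords P
  map_add' := inCoords_add P
  map_smul' c p := by
    rw [inCoords_smul]; rfl

lemma inCoordsₗ_apply (P : Matrix (Fin n) (Fin n) ℂ) (p : PolyVec n) :
    inCoordsₗ P p = inCoords P p := rfl

/-- Passing from the coordinates given by `P` to those given by `Q`. -/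
lemma inCoords_eq_inCoords {P Q : Matrix (Fin n) (Fin n) ℂ} (hP : P * P⁻¹ = 1)
    (p : PolyVec n) (j : Fin n) :
    inCoords Q p j = ∑ k, C ((Q⁻¹ * P) j k) * linSub (P⁻¹ * Q) (inCoords P p k) := by
  have h1 : P * (P⁻¹ * Q) = Q := by rw [← Matrix.mul_assoc, hP, Matrix.one_mul]
  have h2 : Q⁻¹ * P * P⁻¹ = Q⁻¹ := by rw [Matrix.mul_assoc, hP, Matrix.mul_one]
  simp only [inCoords_apply, map_sum, map_mul, algHom_C, algebraMap_eq, linSub_linSub, h1,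
    Finset.mul_sum, ← mul_assoc]
  rw [Finset.sum_comm]
  refine Finset.sum_congr rfl fun i _ => ?_
  rw [← Finset.sum_mul]
  congr 1
  conv_lhs => rw [← h2]
  simp [Matrix.mul_apply]

/-- Recovering a real polynomial map from its expression in complex coordinates. -/
lemma map_eq_sum_linSub_inCoords {P : Matrix (Fin n) (Fin n) ℂ} (hP : P * P⁻¹ = 1)
    (p : PolyVec n) (i : Fin n) :
    map (algebraMap ℝ ℂ) (p i) = ∑ j, C (P i j) * linSub P⁻¹ (inCoords P p j) := by
  have h := inCoords_eq_inCoords (Q := 1) hP p i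
  simp only [inv_one, Matrix.one_mul, Matrix.mul_one] at h
  rw [← h, inCoords_apply]
  simp [Matrix.one_apply, linSub_one, ite_mul]

lemma eq_zero_of_inCoords_eq_zero {P : Matrix (Fin n) (Fin n) ℂ} (hP : P * P⁻¹ = 1)
    {p : PolyVec n} (h : inCoords P p = 0) : p = 0 := by
  ext1 i
  have := map_eq_sum_linSub_inCoords hP p i
  simp only [h, Pi.zero_apply, map_zero, mul_zero, Finset.sum_const_zero] at this
  exact (map_eq_zero_iff _ (map_injective _ (algebraMap ℝ ℂ).injective)).1 this

lemma homogeneousComponent_inCoords (d : ℕ) (P : Matrix (Fin n) (Fin n) ℂ) (p : PolyVec n)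
    (j : Fin n) : homogeneousComponent d (inCoords P p j) =
      inCoords P (fun i => homogeneousComponent d (p i)) j := by
  simp only [inCoords_apply, map_sum, homogeneousComponent_C_mul, homogeneousComponent_linSub,
    homogeneousComponent_map]

lemma inCoords_matPoly {P : Matrix (Fin n) (Fin n) ℂ} (hP : P * P⁻¹ = 1)
    (M : Matrix (Fin n) (Fin n) ℝ) (p : PolyVec n) :
    inCoords P (matPoly M p) = matPoly (P⁻¹ * complexify M * P) (inCoords P p) := by
  have h2 : P⁻¹ * complexify M * P * P⁻¹ = P⁻¹ * complexify M := by
    rw [Matrix.mul_assoc _ P, hP, Matrix.mul_one]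
  ext1 j
  have e1 : inCoords P (matPoly M p) j = ∑ i, ∑ k, C (P⁻¹ j i * complexify M i k) *
      linSub P (map (algebraMap ℝ ℂ) (p k)) := by
    simp only [inCoords_apply, matPoly, map_sum, map_mul, map_C, algHom_C, algebraMap_eq,
      Finset.mul_sum, ← mul_assoc]
    rfl
  have e2 : matPoly (P⁻¹ * complexify M * P) (inCoords P p) j =
     ∑ i, ∑ k, C ((P⁻¹ * complexify M * P) j k * P⁻¹ k i) * linSub P (map (algebraMap ℝ ℂ) (p i)) := by
    rw [Finset.sum_comm]
    simp only [inCoords_apply, matPoly, Finset.mul_sum, ← mul_assoc, C_mul]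
  rw [e1, e2, Finset.sum_comm]
  refine Finset.sum_congr rfl fun i _ => ?_
  rw [← Finset.sum_mul, ← Finset.sum_mul, ← map_sum, ← map_sum, ← Matrix.mul_apply,
   ← Matrix.mul_apply, h2]

lemma derivation_C_mul_eq {K : Type*} [CommRing K]
    (D : Derivation K (MvPolynomial (Fin n) K) (MvPolynomial (Fin n) K)) (a : K)
    (p : MvPolynomial (Fin n) K) : D (C a * p) = C a * D p := by
  rw [← smul_eq_C_mul, D.map_smul, smul_eq_C_mul]

lemma mkDerivation_apply_eq_sum {K : Type*} [CommRing K] (V : Fin n → MvPolynomial (Fin n) K)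
    (p : MvPolynomial (Fin n) K) : mkDerivation K V p = ∑ i, V i * pderiv i p := by
  induction p using MvPolynomial.induction_on with
  | C a => simp
  | add p q hp hq => simp only [map_add, hp, hq, mul_add, Finset.sum_add_distrib]
  | mul_X p i hp =>
    simp only [Derivation.leibniz, mkDerivation_X, hp, smul_eq_mul, pderiv_X, mul_add,
      Finset.sum_add_distrib, Finset.mul_sum]
    congr 1
    · simp [Pi.single_apply, mul_comm]
    · exact Finset.sum_congr rfl fun _ _ => by ring

/-- The derivation along a polynomial vector field is compatible with the change of coordinates. -/
lemma linSub_map_mkDerivation {P : Matrix (Fin n) (Fin n) ℂ} (hP : P * P⁻¹ = 1) (V : PolyVec n)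
    (p : MvPolynomial (Fin n) ℝ) :
    linSub P (map (algebraMap ℝ ℂ) (mkDerivation ℝ V p)) =
      mkDerivation ℂ (inCoords P V) (linSub P (map (algebraMap ℝ ℂ) p)) := by
  induction p using MvPolynomial.induction_on with
  | C a => simp [algHom_C]
  | add p q hp hq => simp only [map_add, hp, hq]
  | mul_X p i hp =>
    have hX : linSub P (map (algebraMap ℝ ℂ) (V i)) =
        mkDerivation ℂ (inCoords P V) (linSub P (X i)) := by
      simp only [linSub_X, map_sum, derivation_C_mul_eq, mkDerivation_X, inCoords_apply,
        Finset.mul_sum, ← mul_assoc, ← C_mul]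
      rw [Finset.sum_comm]
      simp_rw [← Finset.sum_mul, ← map_sum, ← Matrix.mul_apply, hP]
      simp [Matrix.one_apply, ite_mul]
    simp only [Derivation.leibniz, map_add, map_mul, smul_eq_mul, mkDerivation_X, map_X, hp, hX]

lemma inCoords_mkDerivation {P : Matrix (Fin n) (Fin n) ℂ} (hP : P * P⁻¹ = 1) (V p : PolyVec n)
    (j : Fin n) : inCoords P (fun i => mkDerivation ℝ V (p i)) j =
      mkDerivation ℂ (inCoords P V) (inCoords P p j) := by
  simp only [inCoords_apply, linSub_map_mkDerivation hP, map_sum, derivation_C_mul_eq]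

lemma isWeightedHomogeneous_mkDerivation {w : Fin n → ℂ} {V : Fin n → MvPolynomial (Fin n) ℂ}
    (hV : ∀ i, IsWeightedHomogeneous w (V i) (w i)) {p : MvPolynomial (Fin n) ℂ} {c : ℂ}
    (hp : IsWeightedHomogeneous w p c) : IsWeightedHomogeneous w (mkDerivation ℂ V p) c := by
  rw [mkDerivation_apply_eq_sum]
  refine IsWeightedHomogeneous.sum _ _ _ fun i _ => ?_
  have := (hV i).mul (hp.pderiv (i := i) (n' := c - w i) (by ring))
  rwa [add_sub_cancel] at this

/-- The real polynomial maps fixing `0` that preserve the weights `mu`: in the coordinates given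
by `P`, the component number `j` only contains monomials of weight `mu j`. These are the resonant
polynomial maps, with linear terms allowed. -/
def weightPreserving (P : Matrix (Fin n) (Fin n) ℂ) (mu : Fin n → ℂ) : Submodule ℝ (PolyVec n) where
  carrier := {p | (∀ i, constantCoeff (p i) = 0) ∧
    ∀ j, IsWeightedHomogeneous mu (inCoords P p j) (mu j)}
  add_mem' := fun {p q} hp hq => ⟨fun i => by simp [hp.1 i, hq.1 i], fun j => by
    rw [inCoords_add]; exact (hp.2 j).add (hq.2 j)⟩
  zero_mem' := ⟨fun i => by simp, fun j => by
    rw [← inCoordsₗ_apply, LinearMap.map_zero]; exact isWeightedHomogeneous_zero _ _ _⟩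
  smul_mem' := fun c p hp => ⟨fun i => by simp [hp.1 i], fun j => by
    rw [inCoords_smul, Pi.smul_apply, smul_eq_C_mul]; exact (hp.2 j).C_mul _⟩

section
variable {B : Matrix (Fin n) (Fin n) ℝ} {P : Matrix (Fin n) (Fin n) ℂ} {mu : Fin n → ℂ}

lemma IsGenEigenbasis.matPoly_mem_weightPreserving (h : IsGenEigenbasis B P mu)
    {M : Matrix (Fin n) (Fin n) ℝ} (hM : Commute (complexify M) (complexify B)) {p : PolyVec n}
    (hp : p ∈ weightPreserving P mu) : matPoly M p ∈ weightPreserving P mu := by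
  refine ⟨fun i => by simp [matPoly, hp.1], fun j => ?_⟩
  rw [inCoords_matPoly h.mul_inv]
  refine IsWeightedHomogeneous.sum _ _ _ fun k _ => ?_
  by_cases hjk : mu j = mu k
  · rw [hjk]; exact (hp.2 k).C_mul _
  · rw [h.inv_mul_mul_apply_eq_zero hM hjk, C_0, zero_mul]
    exact isWeightedHomogeneous_zero _ _ _

lemma IsGenEigenbasis.X_mem_weightPreserving (h : IsGenEigenbasis B P mu) :
    (X : PolyVec n) ∈ weightPreserving P mu := by
  refine ⟨fun i => constantCoeff_X _ _, fun j => ?_⟩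
  have : inCoords P (X : PolyVec n) j = X j := by
    simp only [inCoords_apply, map_X, linSub_X, Finset.mul_sum, ← mul_assoc, ← C_mul]
    rw [Finset.sum_comm]
    simp_rw [← Finset.sum_mul, ← map_sum, ← Matrix.mul_apply, h.inv_mul]
    simp [Matrix.one_apply, ite_mul]
  rw [this]
  exact isWeightedHomogeneous_X _ _ _

lemma IsGenEigenbasis.linPoly_mem_weightPreserving (h : IsGenEigenbasis B P mu) :
    linPoly B ∈ weightPreserving P mu :=
  h.matPoly_mem_weightPreserving (Commute.refl _) h.X_mem_weightPreserving

lemma IsGenEigenbasis.mkDerivation_mem_weightPreserving (h : IsGenEigenbasis B P mu)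
    {V p : PolyVec n} (hV : V ∈ weightPreserving P mu) (hp : p ∈ weightPreserving P mu) :
    (fun i => mkDerivation ℝ V (p i)) ∈ weightPreserving P mu := by
  refine ⟨fun i => ?_, fun j => ?_⟩
  · simp [mkDerivation_apply_eq_sum, hV.1]
  · rw [inCoords_mkDerivation h.mul_inv]
    exact isWeightedHomogeneous_mkDerivation hV.2 (hp.2 j)

lemma homogeneousComponent_mem_weightPreserving {p : PolyVec n}
    (hp : p ∈ weightPreserving P mu) (d : ℕ) :
    (fun i => homogeneousComponent d (p i)) ∈ weightPreserving P mu := by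
  refine ⟨fun i => ?_, fun j m hm => ?_⟩
  · have := hp.1 i
    rw [constantCoeff_eq] at this ⊢
    rw [coeff_homogeneousComponent, this, ite_self]
  · rw [← homogeneousComponent_inCoords, coeff_homogeneousComponent] at hm
    exact hp.2 j (fun h0 => hm (by rw [h0, ite_self]))

end
end

/-! ### Resonances -/

section
variable {n : ℕ}
open MvPolynomial

lemma weight_eq_sum_mul (mu : Fin n → ℂ) (m : Fin n →₀ ℕ) :
    Finsupp.weight mu m = ∑ i, (m i : ℂ) * mu i := by
  rw [Finsupp.weight_apply, Finsupp.sum_fintype _ _ (by simp)]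
  simp

lemma weight_ofMul_eq_prod (lam : Fin n → ℂ) (m : Fin n →₀ ℕ) :
    Finsupp.weight (fun i => Additive.ofMul (lam i)) m = Additive.ofMul (∏ i, lam i ^ m i) := by
  rw [Finsupp.weight_apply, Finsupp.sum_fintype _ _ (by simp), ofMul_prod]
  simp

lemma homogeneousComponent_eq_zero_of_inCoords {P : Matrix (Fin n) (Fin n) ℂ} (hP : P * P⁻¹ = 1)
    {p : PolyVec n} {d : ℕ} (h : ∀ j, ∀ m ∈ (inCoords P p j).support, m.degree ≠ d) (i : Fin n) :
    homogeneousComponent d (p i) = 0 := by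
  have h1 : inCoords P (fun i => homogeneousComponent d (p i)) = 0 := by
    ext1 j
    rw [← homogeneousComponent_inCoords]
    exact homogeneousComponent_eq_zero' _ _ (h j)
  exact congrFun (eq_zero_of_inCoords_eq_zero hP h1) i

lemma degree_ne_of_homogeneousComponent_eq_zero {P : Matrix (Fin n) (Fin n) ℂ}
    {p : PolyVec n} {d : ℕ} (h : ∀ i, homogeneousComponent d (p i) = 0) {j : Fin n}
    {m : Fin n →₀ ℕ} (hm : m ∈ (inCoords P p j).support) : m.degree ≠ d := by
  rintro rfl
  have h1 : homogeneousComponent m.degree (inCoords P p j) = 0 := by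
    rw [homogeneousComponent_inCoords, show (fun i => homogeneousComponent m.degree (p i)) = 0 from
      funext h, ← inCoordsₗ_apply, LinearMap.map_zero, Pi.zero_apply]
  have h2 := congrArg (coeff m) h1
  rw [coeff_homogeneousComponent, if_pos rfl, coeff_zero] at h2
  exact (mem_support_iff.1 hm) h2

variable {B : Matrix (Fin n) (Fin n) ℝ} {P : Matrix (Fin n) (Fin n) ℂ} {mu : Fin n → ℂ}

/-- A resonance relation between the eigenvalues of `exp B` is one between those of `B` when the
latter are weakly nonresonant. -/
lemma fieldResonance_of_diffeoResonance_exp (hres : ∀ j k, ¬ WeakResonance mu j k) {j : Fin n}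
    {k : Fin n → ℕ} (h : DiffeoResonance (fun i => Complex.exp (mu i)) j k) :
    FieldResonance mu j k := by
  refine ⟨h.1, ?_⟩
  have h2 : Complex.exp (mu j) = Complex.exp (∑ i, (k i : ℂ) * mu i) := by
    rw [Complex.exp_sum]
    simp only [Complex.exp_nat_mul]
    exact h.2
  obtain ⟨l, hl⟩ := Complex.exp_eq_exp_iff_exists_int.1 h2
  by_cases hl0 : l = 0
  · simpa [hl0] using hl
  · exact absurd ⟨h.1, l, hl0, by rw [hl]; ring⟩ (hres j k)

lemma diffeoResonance_exp_of_fieldResonance {j : Fin n} {k : Fin n → ℕ}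
    (h : FieldResonance mu j k) : DiffeoResonance (fun i => Complex.exp (mu i)) j k :=
  ⟨h.1, by simp only [h.2, Complex.exp_sum, Complex.exp_nat_mul]⟩

lemma IsResonantForDiffeo.homogeneousComponent_eq_zero {A : Matrix (Fin n) (Fin n) ℝ}
    {f : PolyVec n} (hf : IsResonantForDiffeo A f) {d : ℕ} (hd : d < 2) (i : Fin n) :
    homogeneousComponent d (f i) = 0 := by
  obtain ⟨P, lam, hP, hf⟩ := hf
  refine homogeneousComponent_eq_zero_of_inCoords hP.mul_inv (fun j m hm => ?_) i
  have := (hf j m hm).1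
  rw [← Finsupp.degree_eq_sum] at this
  lia

/-- Resonance for a diffeomorphism does not depend on the basis of generalized eigenvectors. -/
lemma isWeightedHomogeneous_inCoords_of_isGenEigenbasis {A : Matrix (Fin n) (Fin n) ℝ}
    {P Q : Matrix (Fin n) (Fin n) ℂ} {lam kap : Fin n → ℂ} (hP : IsGenEigenbasis A P lam)
    (hQ : IsGenEigenbasis A Q kap) {f : PolyVec n}
    (hf : ∀ j, IsWeightedHomogeneous (fun i => Additive.ofMul (lam i)) (inCoords P f j)
      (Additive.ofMul (lam j))) (j : Fin n) :
    IsWeightedHomogeneous (fun i => Additive.ofMul (kap i)) (inCoords Q f j)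
      (Additive.ofMul (kap j)) := by
  -- the transition matrix is block diagonal
  have hblock : ∀ {P Q : Matrix (Fin n) (Fin n) ℂ} {lam kap : Fin n → ℂ},
      IsGenEigenbasis A P lam → IsGenEigenbasis A Q kap → ∀ r s, (P⁻¹ * Q) r s ≠ 0 →
      kap s = lam r := by
    intro P Q lam kap hP hQ r s hrs
    by_contra hne
    refine hrs ?_
    have := hP.inv_mulVec_eq_zero (hQ.2 s) (i := r) (Ne.symm hne)
    simpa [Matrix.mulVec, Matrix.mul_apply, dotProduct] using this
  rw [inCoords_eq_inCoords hP.mul_inv]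
  refine IsWeightedHomogeneous.sum _ _ _ fun k _ => ?_
  by_cases hjk : (Q⁻¹ * P) j k = 0
  · rw [hjk, C_0, zero_mul]; exact isWeightedHomogeneous_zero _ _ _
  · rw [← hblock hQ hP j k hjk]
    refine IsWeightedHomogeneous.C_mul ?_ _
    exact MvPolynomial.IsWeightedHomogeneous.linSub
      (fun r s hrs => by rw [hblock hP hQ r s hrs]) (hf k)

/-- Resonance for `exp B` implies resonance for `B`, by weak nonresonance. -/
lemma IsResonantForDiffeo.mem_weightPreserving (hP : IsGenEigenbasis B P mu)
    (hres : ∀ j k, ¬ WeakResonance mu j k) {f : PolyVec n}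
    (hf : IsResonantForDiffeo (NormedSpace.exp B) f) : f ∈ weightPreserving P mu := by
  have hf' := hf
  obtain ⟨Q, lam, hQ, hfQ⟩ := hf'
  refine ⟨fun i => ?_, fun j m hm => ?_⟩
  · have h0 := hf.homogeneousComponent_eq_zero (d := 0) (by norm_num) i
    rw [homogeneousComponent_zero, C_eq_zero] at h0
    rwa [constantCoeff_eq]
  · have h1 := isWeightedHomogeneous_inCoords_of_isGenEigenbasis hQ hP.exp (f := f)
      (fun j m hm => by
        rw [weight_ofMul_eq_prod, ← (hfQ j m (mem_support_iff.2 hm)).2]) j hm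
    rw [weight_ofMul_eq_prod] at h1
    have hm2 : 2 ≤ ∑ i, m i := by
      rw [← Finsupp.degree_eq_sum]
      by_contra! hlt
      exact degree_ne_of_homogeneousComponent_eq_zero
        (fun i => hf.homogeneousComponent_eq_zero hlt i) (mem_support_iff.2 hm) rfl
    have h2 : DiffeoResonance (fun i => Complex.exp (mu i)) j m :=
      ⟨hm2, (Additive.ofMul.injective h1).symm⟩
    rw [weight_eq_sum_mul]
    exact (fieldResonance_of_diffeoResonance_exp hres h2).2.symm

lemma isResonantForField_of_mem_weightPreserving (hP : IsGenEigenbasis B P mu) {v : PolyVec n}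
    (hv : v ∈ weightPreserving P mu) (hv2 : ∀ d < 2, ∀ i, homogeneousComponent d (v i) = 0) :
    IsResonantForField B v := by
  refine ⟨P, mu, hP, fun j m hm => ⟨?_, ?_⟩⟩
  · rw [← Finsupp.degree_eq_sum]
    by_contra! hlt
    exact degree_ne_of_homogeneousComponent_eq_zero (hv2 _ hlt) hm rfl
  · rw [← weight_eq_sum_mul]
    exact (hv.2 j (mem_support_iff.1 hm)).symm

/-- If there are only finitely many resonances, the resonant polynomial maps have bounded degree. -/
lemma exists_degree_bound_weightPreserving (hP : IsGenEigenbasis B P mu)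
    (hfin : HasFinitelyManyResonances (NormedSpace.exp B)) :
    ∃ K : ℕ, ∀ p ∈ weightPreserving P mu, ∀ d, K < d → ∀ i, homogeneousComponent d (p i) = 0 := by
  have hfin' := hfin _ hP.exp.isEigenvalueTuple
  obtain ⟨K, hK⟩ := (hfin'.image fun p => ∑ i, p.2 i).bddAbove
  -- the linear terms are not counted as resonances
  refine ⟨max K 1, fun p hp d hd i => homogeneousComponent_eq_zero_of_inCoords hP.mul_inv
    (fun j m hm => ?_) i⟩
  rintro rfl
  have hd2 : 2 ≤ ∑ i, m i := by
    rw [← Finsupp.degree_eq_sum]; have := le_max_right K 1; lia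
  have h1 : FieldResonance mu j m :=
    ⟨hd2, by rw [← weight_eq_sum_mul]; exact (hp.2 j (mem_support_iff.1 hm)).symm⟩
  have h2 : ∑ i, m i ≤ K := hK ⟨(j, m), diffeoResonance_exp_of_fieldResonance h1, rfl⟩
  rw [← Finsupp.degree_eq_sum] at h2
  have := le_max_left K 1
  lia

end

/-! ### Pull-backs by a linear flow and their averages -/

section
variable {n : ℕ}
open MvPolynomial

/-- Evaluation of a polynomial map. -/
def evalVec {K : Type*} [CommRing K] (p : Fin n → MvPolynomial (Fin n) K) (x : Fin n → K) :
    Fin n → K := fun i => eval x (p i)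

lemma evalVec_matPoly {K : Type*} [CommRing K] (M : Matrix (Fin n) (Fin n) K)
    (p : Fin n → MvPolynomial (Fin n) K) (x : Fin n → K) :
    evalVec (matPoly M p) x = M.mulVec (evalVec p x) := by
  ext i; simp [evalVec, matPoly, Matrix.mulVec, dotProduct]

lemma evalVec_linPoly {K : Type*} [CommRing K] (M : Matrix (Fin n) (Fin n) K) (x : Fin n → K) :
    evalVec (linPoly M) x = M.mulVec x := by
  ext i; simp [evalVec, linPoly, Matrix.mulVec, dotProduct]

lemma continuous_evalVec {𝕜 : Type*} [RCLike 𝕜] (p : Fin n → MvPolynomial (Fin n) 𝕜) :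
    Continuous (evalVec p) :=
  continuous_pi fun i => MvPolynomial.continuous_eval (p i)

/-- The Lie bracket with the linear vector field `M x`: it sends the polynomial vector field `p`
to `p'(x) M x - M p(x)`. -/
def adLin {K : Type*} [CommRing K] (M : Matrix (Fin n) (Fin n) K) :
    Module.End K (Fin n → MvPolynomial (Fin n) K) where
  toFun p := (fun i => mkDerivation K (linPoly M) (p i)) - matPoly M p
  map_add' p q := by
    ext1 i
    simp only [Pi.add_apply, Pi.sub_apply, map_add, matPoly, mul_add, Finset.sum_add_distrib]
    ring
  map_smul' c p := by
    ext1 i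
    simp only [Pi.smul_apply, Pi.sub_apply, matPoly, Derivation.map_smul, RingHom.id_apply,
      smul_sub, Finset.smul_sum, mul_smul_comm]

lemma adLin_apply {K : Type*} [CommRing K] (M : Matrix (Fin n) (Fin n) K)
    (p : Fin n → MvPolynomial (Fin n) K) (i : Fin n) :
    adLin M p i = mkDerivation K (linPoly M) (p i) - ∑ j, C (M i j) * p j := rfl

/-- Along a solution of `c' = V c`, the derivative of a polynomial is its derivation along `V`. -/
lemma hasDerivWithinAt_eval {𝕜 : Type*} [RCLike 𝕜] {V : Fin n → MvPolynomial (Fin n) 𝕜}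
    {c : ℝ → Fin n → 𝕜} {s : Set ℝ} {t : ℝ} (hc : HasDerivWithinAt c (evalVec V (c t)) s t)
    (p : MvPolynomial (Fin n) 𝕜) :
    HasDerivWithinAt (fun u => eval (c u) p) (eval (c t) (mkDerivation 𝕜 V p)) s t := by
  rw [hasDerivWithinAt_pi] at hc
  induction p using MvPolynomial.induction_on with
  | C a => simpa using hasDerivWithinAt_const t s a
  | add p q hp hq =>
    simp only [map_add]
    exact hp.add hq
  | mul_X p i hp =>
    have := hp.mul (hc i)
    simp only [map_mul, eval_X, Derivation.leibniz, mkDerivation_X, smul_eq_mul, map_add]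
    refine this.congr_deriv ?_
    simp only [evalVec]
    ring

/-- The pull-back of the polynomial vector field `p` by the linear flow of `M` at time `s`. -/
def pullback {𝕜 : Type*} [RCLike 𝕜] (M : Matrix (Fin n) (Fin n) 𝕜)
    (p : Fin n → MvPolynomial (Fin n) 𝕜) (x : Fin n → 𝕜) (s : ℝ) : Fin n → 𝕜 :=
  (linFlow M (-s)).mulVec (evalVec p ((linFlow M s).mulVec x))

lemma pullback_zero_time {𝕜 : Type*} [RCLike 𝕜] (M : Matrix (Fin n) (Fin n) 𝕜)
    (p : Fin n → MvPolynomial (Fin n) 𝕜) (x : Fin n → 𝕜) : pullback M p x 0 = evalVec p x := by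
  simp [pullback, linFlow_zero]

lemma flowAverage_evalVec {𝕜 : Type*} [RCLike 𝕜] (M : Matrix (Fin n) (Fin n) 𝕜)
    (p : Fin n → MvPolynomial (Fin n) 𝕜) (x : Fin n → 𝕜) :
    flowAverage M (evalVec p) x = ∫ s in (0 : ℝ)..1, pullback M p x s := rfl

lemma continuous_pullback {𝕜 : Type*} [RCLike 𝕜] (M : Matrix (Fin n) (Fin n) 𝕜)
    (p : Fin n → MvPolynomial (Fin n) 𝕜) (x : Fin n → 𝕜) : Continuous (pullback M p x) :=
  continuous_pullback_linFlow M (continuous_evalVec p) x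

lemma hasDerivAt_pullback {𝕜 : Type*} [RCLike 𝕜] (M : Matrix (Fin n) (Fin n) 𝕜)
    (p : Fin n → MvPolynomial (Fin n) 𝕜) (x : Fin n → 𝕜) (s : ℝ) :
    HasDerivAt (pullback M p x) (pullback M (adLin M p) x s) s := by
  have hc : HasDerivAt (fun s => (linFlow M s).mulVec x)
      (evalVec (linPoly M) ((linFlow M s).mulVec x)) s := by
    rw [evalVec_linPoly]; exact hasDerivAt_linFlow_mulVec M x s
  have h1 : HasDerivWithinAt (fun s => evalVec p ((linFlow M s).mulVec x))
      (fun i => eval ((linFlow M s).mulVec x) (mkDerivation 𝕜 (linPoly M) (p i))) Set.univ s :=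
    hasDerivWithinAt_pi.2 fun i => hasDerivWithinAt_eval hc.hasDerivWithinAt (p i)
  have h2 := hasDerivWithinAt_linFlow_neg_mulVec M h1
  rw [hasDerivWithinAt_univ] at h2
  refine h2.congr_deriv ?_
  unfold pullback
  rw [← evalVec_matPoly]
  congr 1
  ext i
  simp [evalVec, adLin, matPoly]

lemma pullback_add_time {𝕜 : Type*} [RCLike 𝕜] (M : Matrix (Fin n) (Fin n) 𝕜)
    (p : Fin n → MvPolynomial (Fin n) 𝕜) (x : Fin n → 𝕜) (s t : ℝ) :
    pullback M p x (s + t) =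
      (linFlow M (-t)).mulVec (pullback M p ((linFlow M t).mulVec x) s) := by
  simp only [pullback, Matrix.mulVec_mulVec, ← linFlow_add]
  rw [show -(s + t) = -t + -s by ring]

lemma intervalIntegral_mulVec {𝕜 : Type*} [RCLike 𝕜] (M : Matrix (Fin n) (Fin n) 𝕜)
    {f : ℝ → Fin n → 𝕜} (hf : Continuous f) (a b : ℝ) :
    ∫ s in a..b, M.mulVec (f s) = M.mulVec (∫ s in a..b, f s) := by
  have := (LinearMap.toContinuousLinearMap (M.mulVecLin.restrictScalars ℝ)).intervalIntegral_comp_comm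
    (hf.intervalIntegrable (μ := MeasureTheory.volume) a b)
  simpa using this

/-- If the average of `p` along the flow vanishes on an invariant set, the pull-back of `p` is
`1`-periodic there. -/
lemma pullback_one_eq_of_flowAverage_eq_zero {𝕜 : Type*} [RCLike 𝕜]
    {M : Matrix (Fin n) (Fin n) 𝕜} {S : Set (Fin n → 𝕜)}
    (hS : ∀ x ∈ S, ∀ t, (linFlow M t).mulVec x ∈ S) {p : Fin n → MvPolynomial (Fin n) 𝕜}
    (h : ∀ x ∈ S, flowAverage M (evalVec p) x = 0) {x : Fin n → 𝕜} (hx : x ∈ S) :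
    pullback M p x 1 = pullback M p x 0 := by
  have hq := continuous_pullback M p x
  -- the average at the point `exp (t M) x` is, up to a linear map, the integral over `[t, t + 1]`
  have h1 : ∀ t : ℝ, ∫ s in t..(t + 1), pullback M p x s = 0 := by
    intro t
    have h2 : ∫ s in (0 : ℝ)..1, pullback M p x (s + t) = 0 := by
      simp_rw [pullback_add_time]
      rw [intervalIntegral_mulVec _ (continuous_pullback M p _), ← flowAverage_evalVec,
        h _ (hS x hx t), Matrix.mulVec_zero]
    rwa [intervalIntegral.integral_comp_add_right (fun s => pullback M p x s), zero_add,
      add_comm] at h2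
  have hF : ∀ t : ℝ, HasDerivAt (fun t => ∫ s in (0 : ℝ)..t, pullback M p x s)
      (pullback M p x t) t := fun t => (hq.integral_hasStrictDerivAt 0 t).hasDerivAt
  have h3 : HasDerivAt (fun t : ℝ => (∫ s in (0 : ℝ)..(t + 1), pullback M p x s) -
      ∫ s in (0 : ℝ)..t, pullback M p x s) (pullback M p x (0 + 1) - pullback M p x 0) 0 :=
    (HasDerivAt.comp_add_const (0 : ℝ) 1 (hF (0 + 1))).sub (hF 0)
  have h4 : (fun t : ℝ => (∫ s in (0 : ℝ)..(t + 1), pullback M p x s) -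
      ∫ s in (0 : ℝ)..t, pullback M p x s) = fun _ => 0 := by
    ext1 t
    rw [intervalIntegral.integral_interval_sub_left (hq.intervalIntegrable _ _)
      (hq.intervalIntegrable _ _), h1]
  rw [h4, zero_add] at h3
  exact sub_eq_zero.1 (h3.unique (hasDerivAt_const _ _))

/-- The averaging operator is injective on the polynomial vector fields annihilated by a product of
factors `ad M - z` such that `exp z ≠ 1` unless `z = 0`. Indeed the last factor reduces this to an
eigenvector `p`, whose pull-back `exp (z s) p` is `1`-periodic with mean value `0`. -/
lemma evalVec_eq_zero_of_flowAverage_eq_zero (M : Matrix (Fin n) (Fin n) ℂ)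
    {S : Set (Fin n → ℂ)} (hS : ∀ x ∈ S, ∀ t, (linFlow M t).mulVec x ∈ S) (zs : Multiset ℂ)
    (hz : ∀ z ∈ zs, Complex.exp z = 1 → z = 0) (p : Fin n → MvPolynomial (Fin n) ℂ)
    (hp : Polynomial.aeval (adLin M)
      (zs.map fun z => Polynomial.X - Polynomial.C z).prod p = 0)
    (h : ∀ x ∈ S, flowAverage M (evalVec p) x = 0) : ∀ x ∈ S, evalVec p x = 0 := by
  induction zs using Multiset.induction_on generalizing p with
  | empty =>
    intro x _
    have hp0 : p = 0 := by simpa using hp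
    ext i
    simp [hp0, evalVec]
  | cons z zs ih =>
    -- `p'` also has average zero, so it vanishes by induction, and `p` is an eigenvector
    set p' : Fin n → MvPolynomial (Fin n) ℂ := adLin M p - z • p with hp'
    have hper : ∀ x ∈ S, pullback M p x 1 = pullback M p x 0 := fun x hx =>
      pullback_one_eq_of_flowAverage_eq_zero hS h hx
    have hpull : ∀ x s, pullback M p' x s = pullback M (adLin M p) x s - z • pullback M p x s := by
      intro x s
      simp only [pullback, ← Matrix.mulVec_smul, ← Matrix.mulVec_sub]
      congr 1
      ext i
      simp [evalVec, hp']
    have h1 : ∀ x ∈ S, evalVec p' x = 0 := by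
      refine ih (fun w hw => hz w (Multiset.mem_cons_of_mem hw)) p' ?_ fun x hx => ?_
      · rw [Multiset.map_cons, Multiset.prod_cons, mul_comm, map_mul, Module.End.mul_apply] at hp
        simpa [hp'] using hp
      -- the pull-back of `adLin M p` is the derivative of a periodic function
      · have hi1 : ∫ s in (0 : ℝ)..1, pullback M (adLin M p) x s = 0 := by
          rw [intervalIntegral.integral_eq_sub_of_hasDerivAt
            (fun s _ => hasDerivAt_pullback M p x s)
            ((continuous_pullback M _ x).intervalIntegrable _ _), hper x hx, sub_self]
        rw [flowAverage_evalVec]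
        simp_rw [hpull]
        rw [intervalIntegral.integral_sub ((continuous_pullback M _ x).intervalIntegrable _ _)
          ((show Continuous fun s => z • pullback M p x s from
            (continuous_pullback M p x).const_smul z).intervalIntegrable _ _), hi1,
          intervalIntegral.integral_smul, ← flowAverage_evalVec, h x hx, smul_zero, sub_zero]
    intro x hx
    have hder : ∀ s : ℝ, HasDerivAt (pullback M p x) (z • pullback M p x s) s := by
      intro s
      have h2 := hpull x s
      have h3 : pullback M p' x s = 0 := by
        rw [pullback, h1 _ (hS x hx s), Matrix.mulVec_zero]
      rw [h3] at h2
      rw [← sub_eq_zero.1 h2.symm]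
      exact hasDerivAt_pullback M p x s
    have hconst : ∀ s : ℝ, Complex.exp (-(s * z)) • pullback M p x s = pullback M p x 0 := by
      have hd : ∀ s : ℝ, HasDerivAt (fun s : ℝ => Complex.exp (-(s * z)) • pullback M p x s) 0 s := by
        intro s
        have he : HasDerivAt (fun s : ℝ => Complex.exp (-(s * z)))
            (Complex.exp (-(s * z)) * -(1 * z)) s :=
          (((Complex.ofRealCLM.hasDerivAt (x := s)).mul_const z).neg).cexp
        refine (he.smul (hder s)).congr_deriv ?_
        rw [smul_smul, ← add_smul]
        ring_nf
        rw [zero_smul]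
      intro s
      have := is_const_of_deriv_eq_zero (fun t => (hd t).differentiableAt)
        (fun t => (hd t).deriv) s 0
      simpa using this
    by_contra hne
    rw [← pullback_zero_time M p x] at hne
    have h5 := hconst 1
    rw [hper x hx] at h5
    have h6 : Complex.exp (-z) = 1 := by
      have : (Complex.exp (-z) - 1) • pullback M p x 0 = 0 := by
        rw [sub_smul, one_smul, sub_eq_zero]
        simpa using h5
      exact sub_eq_zero.1 ((smul_eq_zero.1 this).resolve_right hne)
    have hz0 : z = 0 := hz z (Multiset.mem_cons_self z zs) (by
      rw [Complex.exp_neg, inv_eq_one] at h6; exact h6)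
    have h7 : ∀ s : ℝ, pullback M p x s = pullback M p x 0 := by simpa [hz0] using hconst
    refine hne ?_
    have h8 := h x hx
    rw [flowAverage_evalVec] at h8
    simp_rw [h7] at h8
    simpa using h8

end

/-! ### The averaging operator on polynomial vector fields -/

section
variable {n : ℕ}
open MvPolynomial

lemma evalVec_sum_smul {ι K : Type*} [CommRing K] (s : Finset ι) (c : ι → K)
    (p : ι → Fin n → MvPolynomial (Fin n) K) (x : Fin n → K) :
    evalVec (∑ k ∈ s, c k • p k) x = ∑ k ∈ s, c k • evalVec (p k) x := by
  ext i
  simp [evalVec, Finset.sum_apply, smul_eval]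

/-- If the iterated brackets of `p` with the linear field eventually vanish, the pull-back of `p`
is given by the finite exponential series. -/
lemma pullback_eq_sum (M : Matrix (Fin n) (Fin n) ℝ) (x : Fin n → ℝ) (N : ℕ) (p : PolyVec n)
    (hN : (adLin M ^ N) p = 0) (s : ℝ) :
    pullback M p x s =
      ∑ k ∈ Finset.range N, (s ^ k / (k.factorial : ℝ)) • evalVec ((adLin M ^ k) p) x := by
  induction N generalizing p s with
  | zero =>
    have hp0 : p = 0 := by simpa using hN
    ext i
    simp [hp0, pullback, evalVec, Matrix.mulVec, dotProduct]
  | succ N ih =>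
    have h1 : ∀ s : ℝ, HasDerivAt (fun s : ℝ => ∑ k ∈ Finset.range (N + 1),
        (s ^ k / (k.factorial : ℝ)) • evalVec ((adLin M ^ k) p) x)
        (pullback M (adLin M p) x s) s := by
      intro s
      rw [ih (adLin M p) (by rw [← Module.End.mul_apply, ← pow_succ]; exact hN)]
      simp only [Finset.sum_range_succ', pow_zero]
      have h2 : ∀ k, HasDerivAt (fun s : ℝ => (s ^ (k + 1) / ((k + 1).factorial : ℝ)) •
          evalVec ((adLin M ^ (k + 1)) p) x)
          ((s ^ k / (k.factorial : ℝ)) • evalVec ((adLin M ^ k) (adLin M p)) x) s := by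
        intro k
        have h3 : HasDerivAt (fun s : ℝ => s ^ (k + 1) / ((k + 1).factorial : ℝ))
            (s ^ k / (k.factorial : ℝ)) s := by
          refine ((hasDerivAt_pow (k + 1) s).div_const _).congr_deriv ?_
          rw [Nat.factorial_succ, Nat.add_sub_cancel, Nat.cast_mul]
          exact mul_div_mul_left _ _ (Nat.cast_ne_zero.2 (Nat.succ_ne_zero k))
        rw [pow_succ, Module.End.mul_apply]
        exact h3.smul_const _
      exact (HasDerivAt.fun_sum fun k _ => h2 k).add_const _
    have h3 := is_const_of_deriv_eq_zero
      (fun t => ((hasDerivAt_pullback M p x t).sub (h1 t)).differentiableAt)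
      (fun t => by rw [((hasDerivAt_pullback M p x t).sub (h1 t)).deriv, sub_self]) s 0
    simp only [Pi.sub_apply, Finset.sum_range_succ', pullback_zero_time] at h3
    simp only [Finset.sum_range_succ']
    simpa [sub_eq_zero] using h3

lemma flowAverage_eq_sum (M : Matrix (Fin n) (Fin n) ℝ) (N : ℕ) (p : PolyVec n)
    (hN : (adLin M ^ N) p = 0) (x : Fin n → ℝ) :
    flowAverage M (evalVec p) x =
      evalVec (∑ k ∈ Finset.range N, ((k + 1).factorial : ℝ)⁻¹ • (adLin M ^ k) p) x := by
  rw [flowAverage_evalVec, evalVec_sum_smul]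
  simp_rw [pullback_eq_sum M x N p hN]
  rw [intervalIntegral.integral_finsetSum fun k _ => Continuous.intervalIntegrable (by fun_prop) _ _]
  refine Finset.sum_congr rfl fun k _ => ?_
  rw [intervalIntegral.integral_smul_const, intervalIntegral.integral_div, integral_pow]
  congr 1
  rw [Nat.factorial_succ, Nat.cast_mul]
  simp [div_eq_mul_inv, mul_comm]

lemma flowAverage_evalVec_sub {𝕜 : Type*} [RCLike 𝕜] (M : Matrix (Fin n) (Fin n) 𝕜)
    (p q : Fin n → MvPolynomial (Fin n) 𝕜) (x : Fin n → 𝕜) :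
    flowAverage M (evalVec (p - q)) x =
      flowAverage M (evalVec p) x - flowAverage M (evalVec q) x := by
  simp only [flowAverage_evalVec]
  rw [← intervalIntegral.integral_sub ((continuous_pullback M p x).intervalIntegrable _ _)
    ((continuous_pullback M q x).intervalIntegrable _ _)]
  refine intervalIntegral.integral_congr fun s _ => ?_
  simp only [pullback, ← Matrix.mulVec_sub]
  congr 1
  ext i
  simp [evalVec]

/-- Where the bracket with the linear field is nilpotent, the averaging operator is unipotent and
can be inverted. -/
lemma exists_flowAverage_eq (M : Matrix (Fin n) (Fin n) ℝ) {W : Submodule ℝ (PolyVec n)}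
    (hW : ∀ p ∈ W, adLin M p ∈ W) (N : ℕ) {g : PolyVec n} (hg : g ∈ W)
    (hN : (adLin M ^ N) g = 0) :
    ∃ w ∈ W, ∀ x, flowAverage M (evalVec w) x = evalVec g x := by
  induction N generalizing g with
  | zero =>
    have hg0 : g = 0 := by simpa using hN
    refine ⟨g, hg, fun x => ?_⟩
    rw [flowAverage_eq_sum M 0 g hN]
    simp [hg0]
  | succ N ih =>
    have hWk : ∀ k, (adLin M ^ k) g ∈ W := by
      intro k
      induction k with
      | zero => simpa using hg
      | succ k ihk => rw [pow_succ', Module.End.mul_apply]; exact hW _ ihk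
    -- `r` is the average of `g` minus `g`, on which the nilpotency index is smaller
    set r : PolyVec n := ∑ k ∈ Finset.range N, ((k + 1 + 1).factorial : ℝ)⁻¹ •
      (adLin M ^ (k + 1)) g with hr
    obtain ⟨w, hwW, hw⟩ := ih (g := r) (W.sum_mem fun k _ => W.smul_mem _ (hWk _)) (by
      rw [hr, map_sum]
      refine Finset.sum_eq_zero fun k _ => ?_
      rw [map_smul, ← Module.End.mul_apply, ← pow_add, show N + (k + 1) = k + (N + 1) by ring,
        pow_add, Module.End.mul_apply, hN, map_zero, smul_zero])
    refine ⟨g - w, W.sub_mem hg hwW, fun x => ?_⟩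
    rw [flowAverage_evalVec_sub, hw, flowAverage_eq_sum M (N + 1) g hN, Finset.sum_range_succ', ← hr]
    ext i
    simp [evalVec]

/-- A bilinear map satisfying the Leibniz rule adds up generalized eigenvalues. -/
lemma apply_mem_maxGenEigenspace_add {K V W U : Type*} [CommRing K] [AddCommGroup V] [Module K V]
    [AddCommGroup W] [Module K W] [AddCommGroup U] [Module K U] (β : V →ₗ[K] W →ₗ[K] U)
    {f : Module.End K V} {g : Module.End K W} {h : Module.End K U}
    (hβ : ∀ v w, h (β v w) = β (f v) w + β v (g w)) {a b : K} {v : V} {w : W}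
    (hv : v ∈ f.maxGenEigenspace a) (hw : w ∈ g.maxGenEigenspace b) :
    β v w ∈ h.maxGenEigenspace (a + b) := by
  rw [Module.End.mem_maxGenEigenspace] at *
  obtain ⟨k, hk⟩ := hv
  obtain ⟨l, hl⟩ := hw
  have key : ∀ N k l : ℕ, k + l = N → ∀ v w, ((f - a • 1) ^ k) v = 0 → ((g - b • 1) ^ l) w = 0 →
      ((h - (a + b) • 1) ^ N) (β v w) = 0 := by
    intro N
    induction N with
    | zero =>
      intro k l hkl v w hv _
      obtain rfl : k = 0 := by lia
      have : v = 0 := by simpa using hv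
      simp [this]
    | succ N ih =>
      intro k l hkl v w hv hw
      rcases k with _ | k
      · have : v = 0 := by simpa using hv
        simp [this]
      rcases l with _ | l
      · have : w = 0 := by simpa using hw
        simp [this]
      have h1 : (h - (a + b) • 1) (β v w) = β ((f - a • 1) v) w + β v ((g - b • 1) w) := by
        simp only [LinearMap.sub_apply, LinearMap.smul_apply, LinearMap.add_apply,
          Module.End.one_apply, hβ, map_sub, map_smul, add_smul]
        abel
      rw [pow_succ, Module.End.mul_apply, h1, map_add,
        ih k (l + 1) (by lia) _ _ (by rwa [pow_succ, Module.End.mul_apply] at hv) hw,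
        ih (k + 1) l (by lia) _ _ hv (by rwa [pow_succ, Module.End.mul_apply] at hw), add_zero]
  exact ⟨k + l, key _ k l rfl v w hk hl⟩

/-- The derivation along the linear field `M x`, as an endomorphism. -/
def linDeriv (M : Matrix (Fin n) (Fin n) ℂ) : Module.End ℂ (MvPolynomial (Fin n) ℂ) :=
  (mkDerivation ℂ (linPoly M)).toLinearMap

lemma linDeriv_apply (M : Matrix (Fin n) (Fin n) ℂ) (p : MvPolynomial (Fin n) ℂ) :
    linDeriv M p = mkDerivation ℂ (linPoly M) p := rfl

lemma mul_mem_maxGenEigenspace {M : Matrix (Fin n) (Fin n) ℂ} {a b : ℂ}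
    {p q : MvPolynomial (Fin n) ℂ} (hp : p ∈ (linDeriv M).maxGenEigenspace a)
    (hq : q ∈ (linDeriv M).maxGenEigenspace b) : p * q ∈ (linDeriv M).maxGenEigenspace (a + b) :=
  apply_mem_maxGenEigenspace_add (LinearMap.mul ℂ (MvPolynomial (Fin n) ℂ)) (fun v w => by
    simp only [linDeriv_apply, LinearMap.mul_apply', Derivation.leibniz, smul_eq_mul]
    ring) hp hq

lemma C_mem_maxGenEigenspace (M : Matrix (Fin n) (Fin n) ℂ) (c : ℂ) :
    (C c : MvPolynomial (Fin n) ℂ) ∈ (linDeriv M).maxGenEigenspace 0 := by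
  rw [Module.End.mem_maxGenEigenspace]
  exact ⟨1, by simp [linDeriv_apply]⟩

lemma linDeriv_pow_linear (M : Matrix (Fin n) (Fin n) ℂ) (c : ℂ) (k : ℕ) (a : Fin n → ℂ) :
    ((linDeriv M - c • 1) ^ k) (∑ s, C (a s) * X s) =
      ∑ s, C (Matrix.vecMul a ((M - Matrix.scalar (Fin n) c) ^ k) s) * X s := by
  induction k generalizing a with
  | zero => simp
  | succ k ih =>
    have h1 : (linDeriv M - c • 1) (∑ s, C (a s) * X s) =
        ∑ s, C (Matrix.vecMul a (M - Matrix.scalar (Fin n) c) s) * X s := by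
      have e1 : linDeriv M (∑ s, C (a s) * X s) = ∑ s, C (Matrix.vecMul a M s) * X s := by
        simp only [linDeriv_apply, map_sum, derivation_C_mul_eq, mkDerivation_X, linPoly,
          Finset.mul_sum, Matrix.vecMul, dotProduct, Finset.sum_mul, map_mul, mul_assoc]
        exact Finset.sum_comm
      rw [LinearMap.sub_apply, e1, LinearMap.smul_apply, Module.End.one_apply, Finset.smul_sum,
        ← Finset.sum_sub_distrib]
      refine Finset.sum_congr rfl fun s _ => ?_
      rw [Matrix.vecMul_sub, Pi.sub_apply, Matrix.scalar_apply, Matrix.vecMul_diagonal,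
        smul_eq_C_mul, C_sub, C_mul]
      ring
    rw [pow_succ, Module.End.mul_apply, h1, ih, Matrix.vecMul_vecMul, ← pow_succ']

section
variable {B : Matrix (Fin n) (Fin n) ℝ} {P : Matrix (Fin n) (Fin n) ℂ} {mu : Fin n → ℂ}

/-- The coordinate functions `y_s` attached to the basis `P` are generalized eigenvectors of the
derivation along `B x`. -/
lemma IsGenEigenbasis.linSub_X_mem (h : IsGenEigenbasis B P mu) (s : Fin n) :
    linSub P⁻¹ (X s) ∈ (linDeriv (complexify B)).maxGenEigenspace (mu s) := by
  rw [Module.End.mem_maxGenEigenspace]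
  refine ⟨n, ?_⟩
  rw [linSub_X, linDeriv_pow_linear, h.inv_row_vecMul]
  simp

lemma IsGenEigenbasis.linSub_monomial_mem (h : IsGenEigenbasis B P mu) (m : Fin n →₀ ℕ) (c : ℂ) :
    linSub P⁻¹ (monomial m c) ∈
      (linDeriv (complexify B)).maxGenEigenspace (Finsupp.weight mu m) := by
  have hpow : ∀ (s : Fin n) (k : ℕ), linSub P⁻¹ (X s) ^ k ∈
      (linDeriv (complexify B)).maxGenEigenspace (k * mu s) := by
    intro s k
    induction k with
    | zero => simpa using C_mem_maxGenEigenspace (complexify B) 1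
    | succ k ih =>
      rw [pow_succ, Nat.cast_succ, add_mul, one_mul]
      exact mul_mem_maxGenEigenspace ih (h.linSub_X_mem s)
  have hprod : ∀ t : Finset (Fin n), ∏ s ∈ t, linSub P⁻¹ (X s) ^ m s ∈
      (linDeriv (complexify B)).maxGenEigenspace (∑ s ∈ t, (m s : ℂ) * mu s) := by
    intro t
    induction t using Finset.induction_on with
    | empty => simpa using C_mem_maxGenEigenspace (complexify B) 1
    | insert s t hs ih =>
      rw [Finset.prod_insert hs, Finset.sum_insert hs]
      exact mul_mem_maxGenEigenspace (hpow _ _) ih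
  have := mul_mem_maxGenEigenspace (C_mem_maxGenEigenspace (complexify B) c) (hprod Finset.univ)
  rw [zero_add, ← weight_eq_sum_mul] at this
  convert this using 1
  rw [monomial_eq, map_mul, algHom_C, algebraMap_eq, Finsupp.prod_fintype _ _ (by simp), map_prod]
  simp only [map_pow]

lemma neg_mem_maxGenEigenspace {K V : Type*} [CommRing K] [AddCommGroup V] [Module K V]
    {f : Module.End K V} {c : K} {v : V} (hv : v ∈ f.maxGenEigenspace c) :
    v ∈ (-f).maxGenEigenspace (-c) := by
  rw [Module.End.mem_maxGenEigenspace] at hv ⊢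
  obtain ⟨k, hk⟩ := hv
  refine ⟨k, ?_⟩
  rw [show -f - -c • 1 = -(f - c • 1) by rw [neg_smul]; abel, neg_pow, Module.End.mul_apply, hk,
    map_zero]

/-- The constant vector `u` times the polynomial function `g`, a polynomial vector field. -/
def constMul : (Fin n → ℂ) →ₗ[ℂ] MvPolynomial (Fin n) ℂ →ₗ[ℂ] (Fin n → MvPolynomial (Fin n) ℂ) :=
  LinearMap.mk₂ ℂ (fun u g i => C (u i) * g)
    (fun u v g => by ext1 i; simp [add_mul]) (fun c u g => by
      ext1 i; simp [smul_eq_C_mul, mul_assoc])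
    (fun u g h => by ext1 i; simp [mul_add]) (fun c u g => by
      ext1 i; simp [smul_eq_C_mul]; ring)

lemma constMul_apply (u : Fin n → ℂ) (g : MvPolynomial (Fin n) ℂ) (i : Fin n) :
    constMul u g i = C (u i) * g := rfl

lemma adLin_constMul (M : Matrix (Fin n) (Fin n) ℂ) (u : Fin n → ℂ) (g : MvPolynomial (Fin n) ℂ) :
    adLin M (constMul u g) = constMul ((-Matrix.toLin' M) u) g + constMul u (linDeriv M g) := by
  ext1 i
  simp only [adLin_apply, constMul_apply, Pi.add_apply, linDeriv_apply, derivation_C_mul_eq,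
    LinearMap.neg_apply, Pi.neg_apply, Matrix.toLin'_apply, Matrix.mulVec, dotProduct, map_neg,
    map_sum, Finset.sum_mul, C_mul, mul_assoc]
  ring

/-- The vector field `y ^ m e_j` is a generalized eigenvector of the bracket with `B x`, for the
eigenvalue `⟨m, mu⟩ - mu_j`. -/
lemma IsGenEigenbasis.constMul_mem (h : IsGenEigenbasis B P mu) (j : Fin n) (m : Fin n →₀ ℕ)
    (c : ℂ) : constMul (P.col j) (linSub P⁻¹ (monomial m c)) ∈
      (adLin (complexify B)).maxGenEigenspace (Finsupp.weight mu m - mu j) := by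
  rw [sub_eq_neg_add]
  refine apply_mem_maxGenEigenspace_add constMul (adLin_constMul (complexify B)) ?_
    (h.linSub_monomial_mem m c)
  exact neg_mem_maxGenEigenspace (h.mem_maxGenEigenspace j)

/-- The expansion of a polynomial vector field into the monomials `y ^ m e_j`. -/
lemma map_eq_sum_constMul (hP : P * P⁻¹ = 1) (p : PolyVec n) :
    (fun i => map (algebraMap ℝ ℂ) (p i)) = ∑ j, ∑ m ∈ (inCoords P p j).support,
      constMul (P.col j) (linSub P⁻¹ (monomial m (coeff m (inCoords P p j)))) := by
  ext1 i
  rw [map_eq_sum_linSub_inCoords hP p i, Finset.sum_apply]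
  refine Finset.sum_congr rfl fun j _ => ?_
  conv_lhs => rw [(inCoords P p j).as_sum]
  rw [map_sum, Finset.mul_sum, Finset.sum_apply]
  rfl

lemma exists_multiset_aeval_eq_zero {K V : Type*} [Field K] [AddCommGroup V] [Module K V]
    (f : Module.End K V) (S : Set K) {v : V} (hv : v ∈ ⨆ z ∈ S, f.maxGenEigenspace z) :
    ∃ zs : Multiset K, (∀ z ∈ zs, z ∈ S) ∧
      Polynomial.aeval f (zs.map fun z => Polynomial.X - Polynomial.C z).prod v = 0 := by
  rw [iSup_subtype'] at hv
  induction hv using Submodule.iSup_induction' with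
  | mem z v hv =>
    obtain ⟨k, hk⟩ := (Module.End.mem_maxGenEigenspace _ _ _).1 hv
    refine ⟨Multiset.replicate k z, fun w hw => Multiset.eq_of_mem_replicate hw ▸ z.2, ?_⟩
    rw [Multiset.map_replicate, Multiset.prod_replicate, map_pow, map_sub, Polynomial.aeval_X,
      Polynomial.aeval_C]
    exact hk
  | zero => exact ⟨0, by simp, map_zero _⟩
  | add v w _ _ hv hw =>
    obtain ⟨zs, hzs, h1⟩ := hv
    obtain ⟨ws, hws, h2⟩ := hw
    refine ⟨zs + ws, fun z hz => (Multiset.mem_add.1 hz).elim (hzs z) (hws z), ?_⟩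
    have h3 := congrArg (Polynomial.aeval f
      (ws.map fun z => Polynomial.X - Polynomial.C z).prod) h1
    have h4 := congrArg (Polynomial.aeval f
      (zs.map fun z => Polynomial.X - Polynomial.C z).prod) h2
    rw [← Module.End.mul_apply, ← map_mul, map_zero] at h3 h4
    rw [Multiset.map_add, Multiset.prod_add, map_add, h4, mul_comm, h3, add_zero]

lemma adLin_complexify_map (B : Matrix (Fin n) (Fin n) ℝ) (p : PolyVec n) :
    adLin (complexify B) (fun i => map (algebraMap ℝ ℂ) (p i)) =
      fun i => map (algebraMap ℝ ℂ) (adLin B p i) := by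
  have hD : ∀ q : MvPolynomial (Fin n) ℝ, mkDerivation ℂ (linPoly (complexify B))
      (map (algebraMap ℝ ℂ) q) = map (algebraMap ℝ ℂ) (mkDerivation ℝ (linPoly B) q) := by
    intro q
    induction q using MvPolynomial.induction_on with
    | C a => simp
    | add p q hp hq => simp only [map_add, hp, hq]
    | mul_X p i hp =>
      simp only [map_mul, map_X, Derivation.leibniz, mkDerivation_X, smul_eq_mul, map_add, hp]
      simp [linPoly, complexify]
  ext1 i
  simp only [adLin_apply, hD, map_sub, map_sum, map_mul, map_C]
  rfl

/-- The bracket with the linear field is nilpotent on weight preserving polynomial maps. -/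
lemma exists_adLin_pow_eq_zero (h : IsGenEigenbasis B P mu) {p : PolyVec n}
    (hp : p ∈ weightPreserving P mu) : ∃ N, (adLin B ^ N) p = 0 := by
  have h1 : (fun i => map (algebraMap ℝ ℂ) (p i)) ∈
      (adLin (complexify B)).maxGenEigenspace 0 := by
    rw [map_eq_sum_constMul h.mul_inv]
    refine Submodule.sum_mem _ fun j _ => Submodule.sum_mem _ fun m hm => ?_
    have := h.constMul_mem j m (coeff m (inCoords P p j))
    rwa [hp.2 j (mem_support_iff.1 hm), sub_self] at this
  obtain ⟨N, hN⟩ := (Module.End.mem_maxGenEigenspace _ _ _).1 h1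
  refine ⟨N, ?_⟩
  rw [zero_smul, sub_zero] at hN
  have h2 : ∀ k, (adLin (complexify B) ^ k) (fun i => map (algebraMap ℝ ℂ) (p i)) =
      fun i => map (algebraMap ℝ ℂ) ((adLin B ^ k) p i) := by
    intro k
    induction k with
    | zero => simp
    | succ k ih => rw [pow_succ', Module.End.mul_apply, ih, adLin_complexify_map, pow_succ',
        Module.End.mul_apply]
  rw [h2] at hN
  ext1 i
  exact (map_eq_zero_iff _ (map_injective _ (algebraMap ℝ ℂ).injective)).1 (congrFun hN i)

lemma linFlow_complexify (B : Matrix (Fin n) (Fin n) ℝ) (t : ℝ) :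
    linFlow (complexify B) t = complexify (linFlow B t) := by
  unfold linFlow
  rw [complexify_exp]
  congr 1
  ext i j
  simp [complexify]

lemma complexify_mulVec_ofReal (M : Matrix (Fin n) (Fin n) ℝ) (x : Fin n → ℝ) :
    (complexify M).mulVec (fun i => (x i : ℂ)) = fun i => (M.mulVec x i : ℂ) := by
  ext i
  simp [complexify, Matrix.mulVec, dotProduct]

lemma evalVec_map_ofReal (p : PolyVec n) (x : Fin n → ℝ) :
    evalVec (fun i => map (algebraMap ℝ ℂ) (p i)) (fun i => (x i : ℂ)) =
      fun i => ((evalVec p x i : ℝ) : ℂ) := by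
  ext i
  simp only [evalVec, eval_map]
  exact (eval₂_comp (algebraMap ℝ ℂ) x (p i)).symm

lemma flowAverage_map_ofReal (B : Matrix (Fin n) (Fin n) ℝ) (p : PolyVec n) (x : Fin n → ℝ) :
    flowAverage (complexify B) (evalVec fun i => map (algebraMap ℝ ℂ) (p i)) (fun i => (x i : ℂ)) =
      fun i => ((flowAverage B (evalVec p) x i : ℝ) : ℂ) := by
  have h1 : ∀ s, pullback (complexify B) (fun i => map (algebraMap ℝ ℂ) (p i))
      (fun i => (x i : ℂ)) s = fun i => ((pullback B p x s i : ℝ) : ℂ) := fun s => by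
    unfold pullback
    rw [linFlow_complexify, linFlow_complexify, complexify_mulVec_ofReal, evalVec_map_ofReal,
      complexify_mulVec_ofReal]
  rw [flowAverage_evalVec, flowAverage_evalVec]
  simp_rw [h1]
  exact (LinearMap.toContinuousLinearMap (Complex.ofRealCLM.toLinearMap.compLeft (Fin n))
    ).intervalIntegral_comp_comm ((continuous_pullback B p x).intervalIntegrable _ _)

/-- Under weak nonresonance, the averaging operator is injective on polynomial maps all of whose
monomials have degree at least `2`. -/
lemma eq_zero_of_flowAverage_eq_zero (h : IsGenEigenbasis B P mu)
    (hres : ∀ j k, ¬ WeakResonance mu j k) {p : PolyVec n}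
    (hp : ∀ d < 2, ∀ i, homogeneousComponent d (p i) = 0)
    (havg : ∀ x, flowAverage B (evalVec p) x = 0) : p = 0 := by
  obtain ⟨zs, hzs, hann⟩ := exists_multiset_aeval_eq_zero (adLin (complexify B))
    {z | Complex.exp z = 1 → z = 0} (v := fun i => map (algebraMap ℝ ℂ) (p i)) (by
      rw [map_eq_sum_constMul h.mul_inv]
      refine Submodule.sum_mem _ fun j _ => Submodule.sum_mem _ fun m hm => ?_
      refine Submodule.mem_iSup_of_mem _ (Submodule.mem_iSup_of_mem ?_ (h.constMul_mem j m _))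
      intro hz
      obtain ⟨l, hl⟩ := Complex.exp_eq_one_iff.1 hz
      by_contra hne
      refine hres j m ⟨?_, -l, fun hl0 => hne ?_, ?_⟩
      · rw [← Finsupp.degree_eq_sum]
        by_contra! hlt
        exact degree_ne_of_homogeneousComponent_eq_zero (hp _ hlt) hm rfl
      · rw [hl, neg_eq_zero.1 hl0]; simp
      · rw [weight_eq_sum_mul] at hl
        rw [← neg_sub, hl]
        push_cast
        ring)
  -- the average is only known to vanish at real points, which form an invariant set
  have key := evalVec_eq_zero_of_flowAverage_eq_zero (complexify B)
    (S := Set.range fun (x : Fin n → ℝ) i => (x i : ℂ)) (by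
      rintro _ ⟨x, rfl⟩ t
      exact ⟨(linFlow B t).mulVec x, by simp only [linFlow_complexify, complexify_mulVec_ofReal]⟩)
    zs hzs _ hann (by
      rintro _ ⟨x, rfl⟩
      rw [flowAverage_map_ofReal, havg]
      ext i
      simp)
  ext1 i
  refine MvPolynomial.funext fun x => ?_
  have h1 := congrFun (key _ ⟨x, rfl⟩) i
  rw [evalVec_map_ofReal] at h1
  simpa [evalVec] using h1

end
end

/-! ### Polynomial flows -/

section
variable {n : ℕ}

/-- The Picard-Lindelöf theorem, with the information that the solution stays in the given ball. -/
lemma IsPicardLindelof.exists_curve_mem {E : Type*} [NormedAddCommGroup E] [NormedSpace ℝ E]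
    [CompleteSpace E] {f : ℝ → E → E} {tmin tmax : ℝ} {t₀ : Set.Icc tmin tmax} {x₀ x : E}
    {a r L K : NNReal} (hf : IsPicardLindelof f t₀ x₀ a r L K) (hx : x ∈ Metric.closedBall x₀ r) :
    ∃ α : ℝ → E, α t₀ = x ∧ ∀ t ∈ Set.Icc tmin tmax, α t ∈ Metric.closedBall x₀ a ∧
      HasDerivWithinAt α (f t (α t)) (Set.Icc tmin tmax) t := by
  obtain ⟨α, hα⟩ := ODE.FunSpace.exists_isFixedPt_next hf hx
  refine ⟨α.compProj, by rw [ODE.FunSpace.compProj_val, ← hα, ODE.FunSpace.next_apply₀],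
    fun t ht => ⟨α.compProj_mem_closedBall hf.mul_max_le, ?_⟩⟩
  refine (ODE.hasDerivWithinAt_picard_Icc t₀.2 hf.continuousOn_uncurry
    α.continuous_compProj.continuousOn (fun _ ht' => α.compProj_mem_closedBall hf.mul_max_le)
    x ht).congr_of_mem (fun t' ht' => ?_) ht
  nth_rw 1 [← hα]
  rw [ODE.FunSpace.compProj_of_mem ht', ODE.FunSpace.next_apply]

/-- Near an equilibrium, the solutions exist up to time `1`. In the coordinates moving with the
linearised flow, the vector field is Lipschitz with a small constant, so that the time of existence
given by the Picard-Lindelöf theorem exceeds `1`. -/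
lemma eventually_exists_curve {X : (Fin n → ℝ) → (Fin n → ℝ)} {B : Matrix (Fin n) (Fin n) ℝ}
    (hX : HasStrictFDerivAt X (LinearMap.toContinuousLinearMap (Matrix.mulVecLin B)) 0)
    (hX0 : X 0 = 0) {U : Set (Fin n → ℝ)} (hU : U ∈ 𝓝 0) :
    ∀ᶠ x in 𝓝 (0 : Fin n → ℝ), ∃ γ : ℝ → Fin n → ℝ, γ 0 = x ∧ IsCurveIn X U γ := by
  obtain ⟨M, hM1, hM⟩ := exists_linFlow_bound B
  have hM0 : 0 < M := by linarith
  have hc0 : 0 < 1 / (2 * M ^ 2) := by positivity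
  -- the Lipschitz constant `1 / (2 M ^ 2)` turns into `1 / 2` in the moving coordinates
  obtain ⟨s, hs, hlin⟩ := hX.approximates_deriv_on_nhds (c := (1 / (2 * M ^ 2)).toNNReal)
    (Or.inr (Real.toNNReal_pos.2 hc0))
  obtain ⟨ρ, hρ0, hρ⟩ := Metric.nhds_basis_closedBall.mem_iff.1 (Filter.inter_mem hs hU)
  set a : NNReal := (ρ / M).toNNReal with ha
  have haρ : (a : ℝ) = ρ / M := Real.coe_toNNReal _ (by positivity)
  have hmem : ∀ t ∈ Set.Icc (0 : ℝ) 1, ∀ z ∈ Metric.closedBall (0 : Fin n → ℝ) a,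
      (linFlow B t).mulVec z ∈ s ∩ U := by
    intro t ht z hz
    refine hρ (mem_closedBall_zero_iff.2 ((hM t ⟨by linarith [ht.1], ht.2⟩ z).trans ?_))
    rw [mem_closedBall_zero_iff, haρ, le_div_iff₀ hM0] at hz
    linarith
  -- the vector field in the coordinates moving with the linear flow
  set f : ℝ → (Fin n → ℝ) → Fin n → ℝ := fun t z =>
    (linFlow B (-t)).mulVec (X ((linFlow B t).mulVec z) - B.mulVec ((linFlow B t).mulVec z)) with hf
  have hlip : ∀ t ∈ Set.Icc (0 : ℝ) 1, LipschitzOnWith (1 / 2) (f t) (Metric.closedBall 0 a) := by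
    intro t ht
    refine LipschitzOnWith.of_dist_le_mul fun z hz w hw => ?_
    rw [dist_eq_norm, dist_eq_norm, hf]
    simp only
    rw [← Matrix.mulVec_sub]
    refine (hM (-t) ⟨by linarith [ht.2], by linarith [ht.1]⟩ _).trans ?_
    have h1 := hlin _ (hmem t ht z hz).1 _ (hmem t ht w hw).1
    rw [Real.coe_toNNReal _ hc0.le, ← Matrix.mulVec_sub] at h1
    have h2 := hM t ⟨by linarith [ht.1], ht.2⟩ (z - w)
    have h3 : X ((linFlow B t).mulVec z) - B.mulVec ((linFlow B t).mulVec z) -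
        (X ((linFlow B t).mulVec w) - B.mulVec ((linFlow B t).mulVec w)) =
        X ((linFlow B t).mulVec z) - X ((linFlow B t).mulVec w) -
          B.mulVec ((linFlow B t).mulVec (z - w)) := by
      simp only [Matrix.mulVec_sub]; abel
    rw [h3]
    calc _ ≤ M * (1 / (2 * M ^ 2) * ‖(linFlow B t).mulVec (z - w)‖) := by gcongr; exact h1
      _ ≤ M * (1 / (2 * M ^ 2) * (M * ‖z - w‖)) := by gcongr
      _ = _ := by push_cast; field_simp
  have hpl : IsPicardLindelof f (tmin := 0) (tmax := 1) ⟨0, by simp⟩ (0 : Fin n → ℝ) a (a / 2)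
      (a / 2) (1 / 2) := by
    refine ⟨hlip, fun z hz => ?_, fun t ht z hz => ?_, ?_⟩
    · have hc := (continuous_linFlow_mulVec B).comp
        (continuous_id.prodMk (continuous_const (y := z)))
      have h1 : ContinuousOn (fun t => X ((linFlow B t).mulVec z)) (Set.Icc 0 1) :=
        hlin.continuousOn.comp hc.continuousOn fun t ht => (hmem t ht z hz).1
      have h2 : ContinuousOn (fun t => X ((linFlow B t).mulVec z) -
          B.mulVec ((linFlow B t).mulVec z)) (Set.Icc 0 1) :=
        h1.sub (continuous_const.matrix_mulVec hc).continuousOn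
      exact (continuous_linFlow_mulVec B).comp_continuousOn (continuousOn_neg.prodMk h2)
    · have h0 : f t 0 = 0 := by simp [hf, hX0]
      have h1 := (hlip t ht).dist_le_mul z hz 0 (by simp)
      rw [h0, dist_zero_right, dist_zero_right] at h1
      rw [mem_closedBall_zero_iff] at hz
      push_cast at h1 ⊢
      linarith
    · push_cast
      simp
      linarith
  have hr : 0 < (a : ℝ) / 2 := by rw [haρ]; positivity
  filter_upwards [Metric.closedBall_mem_nhds (0 : Fin n → ℝ) hr] with x hx
  obtain ⟨α, hα0, hα⟩ := hpl.exists_curve_mem (x := x) (by simpa using hx)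
  refine ⟨fun t => (linFlow B t).mulVec (α t), by simpa [linFlow_zero] using hα0,
    fun t ht => ⟨(hmem t ht _ (hα t ht).1).2, ?_⟩⟩
  refine (hasDerivWithinAt_linFlow_mulVec B (hα t ht).2).congr_deriv ?_
  simp only [hf, linFlow_mulVec_neg_cancel]
  abel

lemma eq_linFlow_mulVec_of_hasDerivWithinAt {m : ℕ} (N : Matrix (Fin m) (Fin m) ℝ)
    {y : ℝ → Fin m → ℝ}
    (hy : ∀ t ∈ Set.Icc (0 : ℝ) 1, HasDerivWithinAt y (N.mulVec (y t)) (Set.Icc 0 1) t) :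
    y 1 = (linFlow N 1).mulVec (y 0) := by
  have hd : ∀ t ∈ Set.Icc (0 : ℝ) 1,
      HasDerivWithinAt (fun t => (linFlow N (-t)).mulVec (y t)) 0 (Set.Icc 0 1) t := by
    intro t ht
    simpa using hasDerivWithinAt_linFlow_neg_mulVec N (hy t ht)
  have h1 := constant_of_has_deriv_right_zero (fun t ht => (hd t ht).continuousWithinAt)
    (fun t ht => (hd t ⟨ht.1, ht.2.le⟩).mono_of_mem_nhdsWithin (Icc_mem_nhdsGE_of_mem ht)) 1
    (by simp)
  simp only [neg_zero, linFlow_zero, Matrix.one_mulVec] at h1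
  rw [← h1, linFlow_mulVec_neg_cancel]

open MvPolynomial

/-- A finite dimensional space of polynomial maps that contains the identity and is stable under the
derivation along a polynomial vector field contains its time one map: along a solution the values
of a basis solve a linear differential equation with constant coefficients. -/
lemma exists_evalVec_eq_curve_one {W : Submodule ℝ (PolyVec n)} [Module.Finite ℝ W] (V : PolyVec n)
    (hX : (X : PolyVec n) ∈ W) (hV : ∀ p ∈ W, (fun i => mkDerivation ℝ V (p i)) ∈ W) :
    ∃ φ ∈ W, ∀ γ : ℝ → Fin n → ℝ, IsCurveIn (evalVec V) Set.univ γ →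
      γ 1 = evalVec φ (γ 0) := by
  set b := Module.finBasis ℝ W with hb
  set ξ := b.repr ⟨X, hX⟩ with hξ
  set N : Matrix (Fin (Module.finrank ℝ W)) (Fin (Module.finrank ℝ W)) ℝ :=
    fun k l => b.repr ⟨_, hV _ (b k).2⟩ l with hN
  have hexp : ∀ w : W, (w : PolyVec n) = ∑ l, b.repr w l • (b l : PolyVec n) := by
    intro w
    have := congrArg W.subtype (b.sum_repr w)
    rw [map_sum] at this
    exact this.symm
  refine ⟨∑ k, ∑ l, (ξ k * linFlow N 1 k l) • (b l : PolyVec n),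
    W.sum_mem fun k _ => W.sum_mem fun l _ => W.smul_mem _ (b l).2, fun γ hγ => ?_⟩
  ext i
  set y : ℝ → Fin (Module.finrank ℝ W) → ℝ := fun t k => eval (γ t) ((b k : PolyVec n) i) with hy
  have hy1 : y 1 = (linFlow N 1).mulVec (y 0) := by
    refine eq_linFlow_mulVec_of_hasDerivWithinAt N fun t ht => hasDerivWithinAt_pi.2 fun k => ?_
    refine (hasDerivWithinAt_eval (hγ t ht).2 _).congr_deriv ?_
    have := congrFun (hexp ⟨_, hV _ (b k).2⟩) i
    simp only at this
    rw [this, Finset.sum_apply, map_sum]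
    refine Finset.sum_congr rfl fun l _ => ?_
    rw [Pi.smul_apply, smul_eval]
  have h1 : ∀ t, γ t i = ∑ k, ξ k * y t k := by
    intro t
    have := congrArg (eval (γ t)) (congrFun (hexp ⟨X, hX⟩) i)
    rw [eval_X, Finset.sum_apply, map_sum] at this
    rw [this]
    refine Finset.sum_congr rfl fun k _ => ?_
    rw [Pi.smul_apply, smul_eval]
  rw [h1, hy1]
  simp only [evalVec, Finset.sum_apply, map_sum, Pi.smul_apply, smul_eval, Matrix.mulVec,
    dotProduct, Finset.mul_sum, mul_assoc]
  rfl

lemma totalDegree_le_of_homogeneousComponent_eq_zero {K : ℕ} {p : MvPolynomial (Fin n) ℝ}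
    (h : ∀ d, K < d → homogeneousComponent d p = 0) : p.totalDegree ≤ K := by
  refine Finset.sup_le fun m hm => ?_
  by_contra! hlt
  have h1 := congrArg (coeff m) (h _ hlt)
  rw [coeff_homogeneousComponent, if_pos (by rw [Finsupp.degree_apply]; rfl), coeff_zero] at h1
  exact mem_support_iff.1 hm h1

lemma finite_weightPreserving {P : Matrix (Fin n) (Fin n) ℂ} {mu : Fin n → ℂ} {K : ℕ}
    (hK : ∀ p ∈ weightPreserving P mu, ∀ d, K < d → ∀ i, homogeneousComponent d (p i) = 0) :
    Module.Finite ℝ (weightPreserving P mu) := by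
  set T := (restrictTotalDegree (Fin n) ℝ K).subtype.compLeft (Fin n) with hT
  have hle : weightPreserving P mu ≤ LinearMap.range T := by
    intro p hp
    refine ⟨fun i => ⟨p i, ?_⟩, rfl⟩
    rw [mem_restrictTotalDegree]
    exact totalDegree_le_of_homogeneousComponent_eq_zero fun d hd => hK p hp d hd i
  exact Submodule.finiteDimensional_of_le hle

lemma contDiff_evalVec {k : WithTop ℕ∞} (p : PolyVec n) : ContDiff ℝ k (evalVec p) := by
  refine contDiff_pi.2 fun i => ?_
  simp only [evalVec]
  generalize p i = q
  induction q using MvPolynomial.induction_on with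
  | C a => simpa using contDiff_const
  | add p q hp hq => simpa using hp.add hq
  | mul_X p j hp => simpa using hp.mul (contDiff_apply ℝ ℝ j)

/-- The time one map of a weight preserving polynomial vector field is a weight preserving
polynomial map, if there are only finitely many resonances. -/
lemma IsGenEigenbasis.exists_isEmbeddingField {B : Matrix (Fin n) (Fin n) ℝ}
    {P : Matrix (Fin n) (Fin n) ℂ} {mu : Fin n → ℂ} (h : IsGenEigenbasis B P mu) {K : ℕ}
    (hK : ∀ p ∈ weightPreserving P mu, ∀ d, K < d → ∀ i, homogeneousComponent d (p i) = 0)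
    {V : PolyVec n} (hV : V ∈ weightPreserving P mu) (hVB : HasLinearPart (evalVec V) B) :
    ∃ φ ∈ weightPreserving P mu, IsEmbeddingField ω (evalVec V) (evalVec φ) := by
  have := finite_weightPreserving hK
  obtain ⟨φ, hφ, hφγ⟩ := exists_evalVec_eq_curve_one V h.X_mem_weightPreserving
    fun p hp => h.mkDerivation_mem_weightPreserving hV hp
  have hC : ContDiff ℝ ω (evalVec V) := contDiff_evalVec V
  refine ⟨φ, hφ, ⟨Set.univ, Filter.univ_mem, hC.contDiffOn⟩, fun U hU => ?_⟩
  have hV0 : evalVec V 0 = 0 := by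
    ext i
    simp [evalVec, hV.1 i]
  filter_upwards [eventually_exists_curve (hVB.hasStrictFDerivAt hC.contDiffAt (by simp)) hV0 hU]
    with x ⟨γ, h0, hγ⟩
  exact ⟨γ, h0, by rw [hφγ γ (hγ.mono (Set.subset_univ _)), h0], hγ⟩

end

/-! ### Embedding vector fields -/

section
variable {n : ℕ}
open MvPolynomial

lemma linAdd_eq_evalVec (M : Matrix (Fin n) (Fin n) ℝ) (p : PolyVec n) :
    linAdd M p = evalVec (linPoly M + p) := by
  ext x i
  have := congrFun (evalVec_linPoly M x) i
  simp only [evalVec] at this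
  simp [linAdd, evalVec, this]

lemma evalVec_add (p q : PolyVec n) (x : Fin n → ℝ) :
    evalVec (p + q) x = evalVec p x + evalVec q x := by
  ext i; simp [evalVec]

lemma evalVec_sub (p q : PolyVec n) (x : Fin n → ℝ) :
    evalVec (p - q) x = evalVec p x - evalVec q x := by
  ext i; simp [evalVec]

lemma eq_of_evalVec_eq {p q : PolyVec n} (h : ∀ x, evalVec p x = evalVec q x) : p = q :=
  funext fun i => MvPolynomial.funext fun x => congrFun (h x) i

lemma evalVec_smul_of_isHomogeneous {p : PolyVec n} {d : ℕ} (hp : ∀ i, (p i).IsHomogeneous d)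
    (c : ℝ) (x : Fin n → ℝ) : evalVec p (c • x) = c ^ d • evalVec p x := by
  ext i
  simp only [evalVec, Pi.smul_apply, eval_eq', smul_eq_mul, Finset.mul_sum, mul_pow,
    Finset.prod_mul_distrib, Finset.prod_pow_eq_pow_sum]
  refine Finset.sum_congr rfl fun m hm => ?_
  rw [← Finsupp.degree_eq_sum, show m.degree = d from
    ((hp i).degree_eq_sum_deg_support hm).symm]
  ring

lemma flowAverage_smul {B : Matrix (Fin n) (Fin n) ℝ} {P : (Fin n → ℝ) → Fin n → ℝ} {d : ℕ}
    (hP : ∀ (c : ℝ) x, P (c • x) = c ^ d • P x) (c : ℝ) (x : Fin n → ℝ) :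
    flowAverage B P (c • x) = c ^ d • flowAverage B P x := by
  simp only [flowAverage, Matrix.mulVec_smul, hP, intervalIntegral.integral_smul]

/-- A map that is homogeneous of degree `d` and `o(‖x‖ ^ d)` at `0` vanishes identically. -/
lemma eq_zero_of_homogeneous_of_isLittleO {P : (Fin n → ℝ) → Fin n → ℝ} {d : ℕ}
    (hP : ∀ (c : ℝ) x, P (c • x) = c ^ d • P x) (h : P =o[𝓝 0] fun x => ‖x‖ ^ d)
    (x : Fin n → ℝ) : P x = 0 := by
  have h1 : Filter.Tendsto (fun c : ℝ => c • x) (𝓝[≠] 0) (𝓝 0) := by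
    refine tendsto_nhdsWithin_of_tendsto_nhds ?_
    have h0 : Continuous fun c : ℝ => c • x := by fun_prop
    simpa using h0.tendsto 0
  have h2 : ∀ ε > 0, ‖P x‖ ≤ ε * ‖x‖ ^ d := by
    intro ε hε
    obtain ⟨c, hc, hc0⟩ := ((h1.eventually (h.def hε)).and self_mem_nhdsWithin).exists
    have hc0 : 0 < |c| := abs_pos.2 hc0
    rw [hP, norm_smul, norm_pow, norm_pow, norm_norm, norm_smul, mul_pow, Real.norm_eq_abs,
      mul_left_comm] at hc
    exact le_of_mul_le_mul_left hc (pow_pos hc0 d)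
  rw [← norm_le_zero_iff]
  refine le_of_forall_pos_le_add fun ε hε => ?_
  refine (h2 (ε / (‖x‖ ^ d + 1)) (by positivity)).trans ?_
  rw [zero_add, div_mul_eq_mul_div, div_le_iff₀ (by positivity)]
  nlinarith

/-- A polynomial map without terms of degree less than `d` is `O(‖x‖ ^ d)`. -/
lemma isBigO_evalVec {p : PolyVec n} {d : ℕ}
    (hp : ∀ k < d, ∀ i, homogeneousComponent k (p i) = 0) :
    evalVec p =O[𝓝 0] fun x => ‖x‖ ^ d := by
  refine Asymptotics.isBigO_pi.2 fun i => ?_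
  simp only [evalVec, eval_eq']
  have hmon : ∀ m ∈ (p i).support,
      (fun x : Fin n → ℝ => coeff m (p i) * ∏ j, x j ^ m j) =O[𝓝 0] fun x => ‖x‖ ^ d := ?_
  · exact Asymptotics.IsBigO.fun_sum hmon
  intro m hm
  have hdeg : d ≤ m.degree := by
    by_contra! hlt
    have h1 := congrArg (coeff m) (hp _ hlt i)
    rw [coeff_homogeneousComponent, if_pos rfl, coeff_zero] at h1
    exact mem_support_iff.1 hm h1
  refine Asymptotics.IsBigO.of_bound ‖coeff m (p i)‖ ?_
  filter_upwards [Metric.closedBall_mem_nhds (0 : Fin n → ℝ) one_pos] with x hx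
  rw [mem_closedBall_zero_iff] at hx
  rw [norm_mul, norm_prod, norm_pow, norm_norm]
  gcongr
  calc ∏ j, ‖x j ^ m j‖ ≤ ∏ j, ‖x‖ ^ m j := by
        refine Finset.prod_le_prod (fun _ _ => norm_nonneg _) fun j _ => ?_
        rw [norm_pow]
        gcongr
        exact norm_le_pi_norm x j
    _ = ‖x‖ ^ m.degree := by rw [Finset.prod_pow_eq_pow_sum, Finsupp.degree_eq_sum]
    _ ≤ ‖x‖ ^ d := pow_le_pow_of_le_one (norm_nonneg _) hx hdeg

lemma isLittleO_norm_pow {d e : ℕ} (h : d < e) :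
    (fun x : Fin n → ℝ => ‖x‖ ^ e) =o[𝓝 0] fun x => ‖x‖ ^ d :=
  Asymptotics.isLittleO_norm_pow_norm_pow h

/-- A polynomial map that is `o(‖x‖ ^ d)` has no terms of degree at most `d`. -/
lemma homogeneousComponent_eq_zero_of_isLittleO {p : PolyVec n} {d : ℕ}
    (hp : evalVec p =o[𝓝 0] fun x => ‖x‖ ^ d) (k : ℕ) (hk : k ≤ d) :
    ∀ i, homogeneousComponent k (p i) = 0 := by
  induction k using Nat.strong_induction_on with
  | _ k ih =>
    set q : PolyVec n := fun i => homogeneousComponent k (p i) with hq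
    have hqh : ∀ i, (q i).IsHomogeneous k := fun i => homogeneousComponent_isHomogeneous k (p i)
    have h1 : evalVec (p - q) =O[𝓝 0] fun x => ‖x‖ ^ (k + 1) := by
      refine isBigO_evalVec fun l hl i => ?_
      rw [Pi.sub_apply, map_sub, homogeneousComponent_of_mem (hqh i)]
      split_ifs with h
      · rw [h, sub_self]
      · rw [ih l (by lia) (by lia) i, sub_zero]
    have h2 : evalVec p =o[𝓝 0] fun x => ‖x‖ ^ k := by
      rcases hk.eq_or_lt with rfl | hlt
      · exact hp
      · exact hp.trans (isLittleO_norm_pow hlt)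
    have h3 : evalVec q =o[𝓝 0] fun x => ‖x‖ ^ k := by
      refine (h2.sub (h1.trans_isLittleO (isLittleO_norm_pow (Nat.lt_succ_self k)))).congr_left ?_
      intro x
      rw [evalVec_sub, sub_sub_cancel]
    have h4 : q = 0 := eq_of_evalVec_eq fun x => by
      rw [eq_zero_of_homogeneous_of_isLittleO (evalVec_smul_of_isHomogeneous hqh) h3 x]
      ext i
      simp [evalVec]
    exact fun i => congrFun h4 i

lemma hasLinearPart_evalVec (M : Matrix (Fin n) (Fin n) ℝ) {p : PolyVec n}
    (hp : ∀ d < 2, ∀ i, homogeneousComponent d (p i) = 0) :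
    HasLinearPart (evalVec (linPoly M + p)) M := by
  have h1 : evalVec p =o[𝓝 0] fun x => x := by
    have := (isBigO_evalVec hp).trans_isLittleO (isLittleO_norm_pow (n := n) one_lt_two)
    simp only [pow_one] at this
    exact this.of_norm_right
  have h0 : evalVec p 0 = 0 := by
    ext i
    have := hp 0 two_pos i
    rw [homogeneousComponent_zero, C_eq_zero] at this
    simpa [evalVec, constantCoeff_eq] using this
  rw [HasLinearPart, hasFDerivAt_iff_isLittleO_nhds_zero]
  refine h1.congr_left fun x => ?_
  simp [evalVec_add, evalVec_linPoly, h0]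

lemma eq_zero_of_homogeneousComponent_eq_zero {p : PolyVec n}
    (hp : ∀ d i, homogeneousComponent d (p i) = 0) : p = 0 := by
  ext1 i
  rw [← sum_homogeneousComponent (p i)]
  simp [hp]

/-- The polynomial maps all of whose components are homogeneous of degree `d`. -/
def homogeneousVec (n d : ℕ) : Submodule ℝ (PolyVec n) :=
  Submodule.pi Set.univ fun _ => homogeneousSubmodule (Fin n) ℝ d

lemma mem_homogeneousVec {d : ℕ} {p : PolyVec n} :
    p ∈ homogeneousVec n d ↔ ∀ i, (p i).IsHomogeneous d := by
  simp [homogeneousVec, Submodule.mem_pi]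

lemma matPoly_mem_homogeneousVec (M : Matrix (Fin n) (Fin n) ℝ) {d : ℕ} {p : PolyVec n}
    (hp : p ∈ homogeneousVec n d) : matPoly M p ∈ homogeneousVec n d := by
  rw [mem_homogeneousVec] at *
  exact fun i => IsHomogeneous.sum _ _ _ fun j _ => (hp j).C_mul _

lemma adLin_mem_homogeneousVec (M : Matrix (Fin n) (Fin n) ℝ) {d : ℕ} (hd : d ≠ 0) {p : PolyVec n}
    (hp : p ∈ homogeneousVec n d) : adLin M p ∈ homogeneousVec n d := by
  refine Submodule.sub_mem _ (mem_homogeneousVec.2 fun i => ?_) (matPoly_mem_homogeneousVec M hp)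
  rw [mkDerivation_apply_eq_sum]
  refine IsHomogeneous.sum _ _ _ fun j _ => ?_
  have h1 : (linPoly M j).IsHomogeneous 1 :=
    IsHomogeneous.sum _ _ _ fun k _ => isHomogeneous_C_mul_X _ _
  have := h1.mul ((mem_homogeneousVec.1 hp i).pderiv (i := j))
  rwa [Nat.add_sub_cancel' (Nat.one_le_iff_ne_zero.2 hd)] at this

section
variable {B : Matrix (Fin n) (Fin n) ℝ} {P : Matrix (Fin n) (Fin n) ℂ} {mu : Fin n → ℂ}

lemma commute_complexify_linFlow (B : Matrix (Fin n) (Fin n) ℝ) (t : ℝ) :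
    Commute (complexify (linFlow B t)) (complexify B) :=
  ((commute_linFlow B t).map (algebraMap ℝ ℂ).mapMatrix).symm

/-- Weight preserving diffeomorphisms with linear part `exp B` are embedded, up to any order, in
flows of weight preserving vector fields: the terms of degree `d` of the time one map change by
`exp B` times the average of the terms of degree `d` added to the vector field. -/
lemma IsGenEigenbasis.exists_embedding_up_to (h : IsGenEigenbasis B P mu) {K : ℕ}
    (hK : ∀ p ∈ weightPreserving P mu, ∀ d, K < d → ∀ i, homogeneousComponent d (p i) = 0)
    {f : PolyVec n} (hf : f ∈ weightPreserving P mu)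
    (hf2 : ∀ d < 2, ∀ i, homogeneousComponent d (f i) = 0) (d : ℕ) :
    ∃ v ∈ weightPreserving P mu, (∀ d < 2, ∀ i, homogeneousComponent d (v i) = 0) ∧
      ∃ φ ∈ weightPreserving P mu,
        IsEmbeddingField ω (evalVec (linPoly B + v)) (evalVec φ) ∧
        ∀ k ≤ d + 1, ∀ i, homogeneousComponent k ((linPoly (linFlow B 1) + f - φ) i) = 0 := by
  induction d with
  | zero =>
    have h0 : ∀ d < 2, ∀ i, homogeneousComponent d ((0 : PolyVec n) i) = 0 := by simp
    obtain ⟨φ, hφ, hemb⟩ := h.exists_isEmbeddingField hK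
      (Submodule.add_mem _ h.linPoly_mem_weightPreserving (Submodule.zero_mem _))
      (hasLinearPart_evalVec B h0)
    refine ⟨0, Submodule.zero_mem _, h0, φ, hφ, hemb, ?_⟩
    refine homogeneousComponent_eq_zero_of_isLittleO ?_
    have h1 := hemb.isLittleO_sub_linFlow (hasLinearPart_evalVec B h0)
    have h2 := (isBigO_evalVec hf2).trans_isLittleO (isLittleO_norm_pow (n := n) one_lt_two)
    simp only [zero_add, pow_one] at h2 ⊢
    refine (h2.sub h1).congr_left fun x => ?_
    rw [evalVec_sub, evalVec_add, evalVec_linPoly]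
    abel
  | succ d ih =>
    obtain ⟨v, hv, hv2, φ, hφ, hemb, hcomp⟩ := ih
    set F : PolyVec n := linPoly (linFlow B 1) + f with hF
    have hFW : F ∈ weightPreserving P mu := Submodule.add_mem _
      (h.matPoly_mem_weightPreserving (commute_complexify_linFlow B 1) h.X_mem_weightPreserving) hf
    -- the error in degree `d + 2`, to be removed by a field `w` with average `exp (-B) g`
    set g : PolyVec n := fun i => homogeneousComponent (d + 2) ((F - φ) i) with hg
    have hgW : g ∈ weightPreserving P mu :=
      homogeneousComponent_mem_weightPreserving (Submodule.sub_mem _ hFW hφ) _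
    have hgh : g ∈ homogeneousVec n (d + 2) :=
      mem_homogeneousVec.2 fun i => homogeneousComponent_isHomogeneous _ _
    have hg'W := h.matPoly_mem_weightPreserving (commute_complexify_linFlow B (-1)) hgW
    obtain ⟨N, hN⟩ := exists_adLin_pow_eq_zero h hg'W
    obtain ⟨w, ⟨hwW, hwh⟩, hw⟩ := exists_flowAverage_eq B
      (W := weightPreserving P mu ⊓ homogeneousVec n (d + 2))
      (fun p hp => ⟨Submodule.sub_mem _ (h.mkDerivation_mem_weightPreserving
        h.linPoly_mem_weightPreserving hp.1) (h.matPoly_mem_weightPreserving (Commute.refl _) hp.1),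
        adLin_mem_homogeneousVec B (by lia) hp.2⟩)
      N ⟨hg'W, matPoly_mem_homogeneousVec _ hgh⟩ hN
    rw [SetLike.mem_coe, mem_homogeneousVec] at hwh
    have hvw2 : ∀ k < 2, ∀ i, homogeneousComponent k ((v + w) i) = 0 := by
      intro k hk i
      rw [Pi.add_apply, map_add, hv2 k hk, homogeneousComponent_of_mem (hwh i), if_neg (by lia),
        add_zero]
    have hvwW : v + w ∈ weightPreserving P mu := Submodule.add_mem _ hv hwW
    obtain ⟨φ', hφ', hemb'⟩ := h.exists_isEmbeddingField hK
      (Submodule.add_mem _ h.linPoly_mem_weightPreserving hvwW) (hasLinearPart_evalVec B hvw2)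
    refine ⟨v + w, hvwW, hvw2, φ', hφ', hemb', fun k hk i => ?_⟩
    have h1 := hemb.isLittleO_sub_sub_flowAverage (P := evalVec w) (d := d + 2) hemb' (by simp)
      (hasLinearPart_evalVec B hv2) (hasLinearPart_evalVec B hvw2) (by simp) (continuous_evalVec w)
      (evalVec_smul_of_isHomogeneous hwh) (by
        refine (Asymptotics.isLittleO_zero _ _).congr_left fun x => ?_
        simp only [evalVec_add]
        abel)
    have h2 : evalVec (φ' - φ - g) =o[𝓝 0] fun x => ‖x‖ ^ (d + 2) := by
      refine h1.congr_left fun x => ?_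
      rw [hw, evalVec_matPoly, linFlow_mulVec_neg_cancel, evalVec_sub, evalVec_sub]
    have h3 := homogeneousComponent_eq_zero_of_isLittleO h2 k hk i
    have h4 : homogeneousComponent k ((F - φ) i) = homogeneousComponent k (g i) := by
      rw [homogeneousComponent_of_mem (mem_homogeneousVec.1 hgh i)]
      split_ifs with hkd
      · rw [hkd]
      · exact hcomp k (by lia) i
    simp only [Pi.sub_apply, map_sub] at h3 h4 ⊢
    rw [← h4] at h3
    linear_combination -h3

/-- If there are only finitely many resonances, then weight preserving diffeomorphisms with linear
part `exp B` are embedded in flows of weight preserving vector fields. -/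
lemma IsGenEigenbasis.exists_embedding (h : IsGenEigenbasis B P mu) {K : ℕ}
    (hK : ∀ p ∈ weightPreserving P mu, ∀ d, K < d → ∀ i, homogeneousComponent d (p i) = 0)
    {f : PolyVec n} (hf : f ∈ weightPreserving P mu)
    (hf2 : ∀ d < 2, ∀ i, homogeneousComponent d (f i) = 0) :
    ∃ v ∈ weightPreserving P mu, (∀ d < 2, ∀ i, homogeneousComponent d (v i) = 0) ∧
      IsEmbeddingField ω (evalVec (linPoly B + v)) (evalVec (linPoly (linFlow B 1) + f)) := by
  obtain ⟨v, hv, hv2, φ, hφ, hemb, hcomp⟩ := h.exists_embedding_up_to hK hf hf2 K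
  refine ⟨v, hv, hv2, ?_⟩
  have hFW : linPoly (linFlow B 1) + f ∈ weightPreserving P mu := Submodule.add_mem _
    (h.matPoly_mem_weightPreserving (commute_complexify_linFlow B 1) h.X_mem_weightPreserving) hf
  have h0 := eq_zero_of_homogeneousComponent_eq_zero (p := linPoly (linFlow B 1) + f - φ)
    fun d i => by
      rcases le_or_gt d (K + 1) with hd | hd
      · exact hcomp d hd i
      · exact hK _ (Submodule.sub_mem _ hFW hφ) d (by lia) i
  rw [sub_eq_zero.1 h0]
  exact hemb

/-- Two smooth embedding vector fields with the same linear part have the same Taylor series. The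
first terms where they differed would have average zero along the linear flow. -/
lemma IsGenEigenbasis.iteratedFDeriv_sub_eq_zero (h : IsGenEigenbasis B P mu)
    (hres : ∀ j k, ¬ WeakResonance mu j k) {X Y F : (Fin n → ℝ) → (Fin n → ℝ)}
    (hX : IsEmbeddingField ∞ X F) (hY : IsEmbeddingField ∞ Y F) (hXB : HasLinearPart X B)
    (hYB : HasLinearPart Y B) (d : ℕ) : iteratedFDeriv ℝ d (Y - X) 0 = 0 := by
  have hC : ∀ k : ℕ, ContDiffAt ℝ k (Y - X) 0 := fun k =>
    (hY.contDiffAt.sub hX.contDiffAt).of_le (by exact_mod_cast le_top)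
  induction d using Nat.strong_induction_on with
  | _ d ih =>
    rcases d with _ | _ | d
    · ext m
      simp [hX.field_zero, hY.field_zero]
    · have h1 : fderiv ℝ (Y - X) 0 = 0 := by
        rw [(HasFDerivAt.sub hYB hXB).fderiv, sub_self]
      ext m
      rw [iteratedFDeriv_one_apply, h1]
      simp
    · refine (hC (d + 2)).iteratedFDeriv_eq_zero_of_diagonal ?_
      -- the Taylor polynomial of degree `d + 2` of the difference, which is homogeneous
      set M := (((d + 2).factorial : ℝ)⁻¹ •
        (iteratedFDeriv ℝ (d + 2) (Y - X) 0)).toMultilinearMap with hM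
      set p : PolyVec n := diagonalPoly M with hp
      have hpe : ∀ x, evalVec p x = ((d + 2).factorial : ℝ)⁻¹ •
          iteratedFDeriv ℝ (d + 2) (Y - X) 0 (fun _ => x) := fun x => by
        ext i
        exact eval_diagonalPoly M x i
      have hph := evalVec_smul_of_isHomogeneous (isHomogeneous_diagonalPoly M)
      have h1 : (fun x => Y x - X x - evalVec p x) =o[𝓝 0] fun x => ‖x‖ ^ (d + 2) := by
        refine ((isBigO_sub_diagonal_of_iteratedFDeriv_eq_zero (hC (d + 2 + 1)) ih).congr_left
          fun x => ?_).trans_isLittleO (isLittleO_norm_pow (Nat.lt_succ_self _))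
        rw [hpe]
        rfl
      have h2 := hX.isLittleO_sub_sub_flowAverage hY (by simp) hXB hYB (by simp)
        (continuous_evalVec p) hph h1
      simp only [sub_self, zero_sub, ← Matrix.mulVec_neg] at h2
      have h3 := eq_zero_of_homogeneous_of_isLittleO (fun c x => by
        rw [flowAverage_smul hph, ← smul_neg, Matrix.mulVec_smul]) h2
      have h4 : p = 0 := by
        refine eq_zero_of_flowAverage_eq_zero h hres (fun k hk i => ?_) fun x => ?_
        · rw [homogeneousComponent_of_mem (isHomogeneous_diagonalPoly M i), if_neg (by lia)]
        · rw [← neg_eq_zero, ← linFlow_neg_mulVec_cancel B 1 (-flowAverage B (evalVec p) x), h3,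
            Matrix.mulVec_zero]
      intro y
      have h5 := hpe y
      rw [h4, eq_comm, show evalVec (0 : PolyVec n) y = 0 by ext i; simp [evalVec]] at h5
      exact (smul_eq_zero.1 h5).resolve_left
        (inv_ne_zero (Nat.cast_ne_zero.2 (Nat.factorial_ne_zero _)))

end

lemma IsEmbeddingField.of_le {k l : WithTop ℕ∞} {X F : (Fin n → ℝ) → (Fin n → ℝ)}
    (h : IsEmbeddingField k X F) (hl : l ≤ k) : IsEmbeddingField l X F :=
  ⟨h.1.imp fun _ hW => ⟨hW.1, hW.2.of_le hl⟩, h.2⟩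

/-- A smooth map with vanishing Taylor series is flat. -/
lemma isBigO_norm_pow_of_iteratedFDeriv_eq_zero {Z : (Fin n → ℝ) → (Fin n → ℝ)}
    (hC : ContDiffAt ℝ ∞ Z 0) (hZ : ∀ k, iteratedFDeriv ℝ k Z 0 = 0) (N : ℕ) :
    Z =O[𝓝 0] fun x => ‖x‖ ^ N := by
  have h1 := isBigO_sub_diagonal_of_iteratedFDeriv_eq_zero (d := N)
    (hC.of_le (by exact_mod_cast le_top)) fun k _ => hZ k
  refine (h1.congr_left fun x => ?_).trans
    (isLittleO_norm_pow (Nat.lt_succ_self N)).isBigO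
  simp [hZ N]

end

end

theorem theorem1p4 (n : ℕ) (A B : Matrix (Fin n) (Fin n) ℝ) (f : PolyVec n)
    (hA : IsHyperbolic A)
    (hB : NormedSpace.exp B = A)
    (hBres : IsWeaklyNonresonant B)
    (hAfin : HasFinitelyManyResonances A)
    (hf : IsResonantForDiffeo A f) :
    ∃ v : PolyVec n,
      IsResonantForField B v ∧
      IsEmbeddingField ω (linAdd B v) (linAdd A f) ∧
      (∀ Y : (Fin n → ℝ) → (Fin n → ℝ),
        IsEmbeddingField ω Y (linAdd A f) → HasLinearPart Y B →
          Y =ᶠ[𝓝 0] linAdd B v) ∧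
      (∀ Y : (Fin n → ℝ) → (Fin n → ℝ),
        IsEmbeddingField ∞ Y (linAdd A f) → HasLinearPart Y B →
          ∀ r : ℕ, iteratedFDeriv ℝ r Y 0 = iteratedFDeriv ℝ r (linAdd B v) 0) ∧
      (InPoincareDomain A → ∀ Y : (Fin n → ℝ) → (Fin n → ℝ),
        IsEmbeddingField ∞ Y (linAdd A f) → HasLinearPart Y B →
          Y =ᶠ[𝓝 0] linAdd B v) := by
  obtain ⟨P, mu, hP⟩ := exists_isGenEigenbasis B
  have hres := hBres mu hP.isEigenvalueTuple
  subst hB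
  obtain ⟨K, hK⟩ := exists_degree_bound_weightPreserving hP hAfin
  have hf2 : ∀ d < 2, ∀ i, MvPolynomial.homogeneousComponent d (f i) = 0 :=
    fun d hd i => hf.homogeneousComponent_eq_zero hd i
  obtain ⟨v, hv, hv2, hemb⟩ := hP.exists_embedding hK (hf.mem_weightPreserving hP hres) hf2
  have hexp : linFlow B 1 = NormedSpace.exp B := by rw [linFlow, one_smul]
  have hvB := hasLinearPart_evalVec B hv2
  have hFA := hasLinearPart_evalVec (NormedSpace.exp B) hf2
  rw [hexp, ← linAdd_eq_evalVec, ← linAdd_eq_evalVec] at hemb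
  rw [← linAdd_eq_evalVec] at hvB hFA
  have htaylor : ∀ Y : (Fin n → ℝ) → (Fin n → ℝ),
      IsEmbeddingField ∞ Y (linAdd (NormedSpace.exp B) f) → HasLinearPart Y B →
        ∀ r : ℕ, iteratedFDeriv ℝ r (Y - linAdd B v) 0 = 0 := fun Y hY hYB r =>
    hP.iteratedFDeriv_sub_eq_zero hres (hemb.of_le le_top) hY hvB hYB r
  refine ⟨v, isResonantForField_of_mem_weightPreserving hP hv hv2, hemb, fun Y hY hYB => ?_,
    fun Y hY hYB r => ?_, fun hdom Y hY hYB => ?_⟩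
  · have h1 := (hY.contDiffAt.sub hemb.contDiffAt).analyticAt
    filter_upwards [h1.eventually_eq_zero_of_iteratedFDeriv_eq_zero
      (htaylor Y (hY.of_le le_top) hYB)] with x hx
    exact sub_eq_zero.1 hx
  · have h1 := htaylor Y hY hYB r
    rw [iteratedFDeriv_sub_apply (hY.contDiffAt.of_le (by exact_mod_cast le_top))
      (hemb.contDiffAt.of_le le_top)] at h1
    exact sub_eq_zero.1 h1
  · refine eventually_eq_of_isEmbeddingField_of_flat (A' := linFlow B (-1)) ?_ hdom ?_ hFA hemb hY
      le_top (by exact_mod_cast le_top) (isBigO_norm_pow_of_iteratedFDeriv_eq_zero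
        (hY.contDiffAt.sub (hemb.contDiffAt.of_le le_top)) (htaylor Y hY hYB))
    · rw [← hexp]
      exact linFlow_mul_neg B 1
    · rw [linAdd_eq_evalVec]
      exact contDiff_evalVec _
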